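/- **Notation.** Let $\Lambda=\mathbf C[P_1,P_2,\dots]$ be the ring of symmetric functions ($P_k$ the power sums, $P_\mu=\prod_i P_{\mu_i}$, $S_\lambda$ the Schur functions), and let $\overline{\Lambda[P_0]}=\mathbf C[[P_0,P_1,P_2,\dots]]$. For a partition $\lambda$ let $h_\lambda$ be the product of its hook lengths, $\chi_\lambda$ the irreducible character of $S_{|\lambda|}$ attached to $\lambda$, and $$F_\lambda=\frac1{h_\lambda}\sum_{g\in S_{|\lambda|}}\chi_\lambda(g)\,g\in\mathcal Z(\mathbf C[S_{|\lambda|}])$$ the corresponding central idempotent. The characteristic map $\mathrm{ch}:\bigoplus_{n\ge0}\mathcal Z(\mathbf C[S_n])\to\Lambda$ is the restriction of the linear map with $g\mapsto P_{\mathrm{cyc}(g)}/n!$ for $g\in S_n$, where $\mathrm{cyc}(g)$ is the cycle type of $g$. Let $\mathcal F$ be the fermionic Fock space, $\mathcal F_0$ its charge $0$ sector with basis $|\lambda;0\rangle$ (occupied sites $\lambda_i-i$, $i\ge1$), $\psi_j,\psi_j^\dagger$ ($j\in\mathbf Z$) the Fermi operators, and $:\psi_j\psi_j^\dagger:\;=\psi_j\psi_j^\dagger-\langle0|\psi_j\psi_j^\dagger|0\rangle$.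 Let $\hat C$ be the abelian group of operators $\hat C_\rho=e^{\sum_{j\in\mathbf Z}T_j:\psi_j\psi_j^\dagger:}$ with $T_j\in\mathbf C$ and $\rho_j=e^{T_j}$. Let $\theta_0\in\mathbf C$, $m\ge0$, and let $\mathbf z=(z_1,\dots,z_m)$ be complex numbers with $kz_\alpha\ne1$ for all $k\in\mathbf Z$ and all $\alpha$; put $\theta_i=\frac1i\sum_\alpha z_\alpha^i$ for $i\ge1$. Let $\mathcal A_P$ be the subgroup of the unit group of $\overline{\Lambda[P_0]}$ generated by all the elements $e^{\sum_{i\ge0}\theta_iP_i}=e^{\theta_0P_0}\prod_\alpha H(z_\alpha)$ so obtained, where $H(z)=e^{\sum_{i\ge1}P_iz^i/i}$ is the generating function of the complete symmetric functions. Let $\mathcal J_b=\sum_{a<b}(a\,b)\in\mathbf C[S_n]$ ($1\le b\le n$) be the Jucys–Murphy elements, and $H(z,\mathcal J)=\prod_{b=1}^n(1-z\mathcal J_b)^{-1}$. **Theorem.** 1. There is a linear isomorphism $\Lambda\to\mathcal F_0$ (fermionization) with $S_\lambda\mapsto|\lambda;0\rangle$ for all $\lambda$. Its composition with $\mathrm{ch}$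 is a linear isomorphism $\mathfrak F:\bigoplus_{n\ge0}\mathcal Z(\mathbf C[S_n])\to\mathcal F_0$, and $\mathfrak F(F_\lambda)=\frac1{h_\lambda}|\lambda;0\rangle$. 2. For admissible $(\theta_0,\mathbf z)$ the elements $1-z_\alpha\mathcal J_b$ are invertible. For every $n$ there is a group homomorphism from $\mathcal A_P$ to the units of $\mathcal Z(\mathbf C[S_n])$ (evaluation at the Jucys–Murphy elements) with $$e^{\sum_{i\ge0}\theta_iP_i}\mapsto e^{\theta_0n}\prod_{\alpha=1}^mH(z_\alpha,\mathcal J).$$ Hence $\mathcal A_P$ acts on $\bigoplus_n\mathcal Z(\mathbf C[S_n])$ by multiplication. 3. There is a group homomorphism $\mathcal I:\mathcal A_P\to\hat C$ with $\mathcal I\big(e^{\sum_{i\ge0}\theta_iP_i}\big)=e^{\sum_jT_j:\psi_j\psi_j^\dagger:}$, where $$T_j=j\theta_0-\sum_{\alpha}\sum_{k=1}^{j}\ln(1-kz_\alpha)\ (j\ge0),\qquad T_j=j\theta_0+\sum_{\alpha}\sum_{k=j+1}^{0}\ln(1-kz_\alpha)\ (j<0);$$ equivalently $\rho_j=e^{T_j}$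 is $e^{j\theta_0}\prod_\alpha\prod_{k=1}^j(1-kz_\alpha)^{-1}$ for $j\ge0$ and $e^{j\theta_0}\prod_\alpha\prod_{k=j+1}^0(1-kz_\alpha)$ for $j<0$. 4. $\mathfrak F$ intertwines the two actions: $\mathfrak F(a\cdot x)=\mathcal I(a)\,\mathfrak F(x)$ for all $a\in\mathcal A_P$ and $x\in\bigoplus_n\mathcal Z(\mathbf C[S_n])$. For $a=e^{\sum_{i\ge0}\theta_iP_i}$ both operators are diagonal, in the bases $\{F_\lambda\}$ and $\{|\lambda;0\rangle\}$ respectively, with the common eigenvalue $$e^{\theta_0|\lambda|}\prod_{\alpha=1}^m\prod_{(i,j)\in\lambda}\frac1{1-(j-i)z_\alpha}.$$ -/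

import Mathlib

open scoped DirectSum

namespace TodaFock

noncomputable section

/-! ## Symmetric functions -/

/-- The ring of symmetric functions `Λ = ℂ[P₁, P₂, …]`, a polynomial ring in the power sums. -/
abbrev SymFun : Type := MvPolynomial ℕ+ ℂ

/-- The power sum symmetric function `P_k`, for `k ≥ 1`. -/
def powerSum (k : ℕ) : SymFun := MvPolynomial.X k.toPNat'

/-- `P_μ = P_{μ₁} P_{μ₂} ⋯` for a multiset `μ` of positive parts. -/
def powerSumProd (s : Multiset ℕ) : SymFun := (s.map powerSum).prod

/-- `Z_μ = ∏ᵢ mᵢ! i^{mᵢ}`, where `mᵢ` is the number of parts of `μ` equal to `i`. -/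
def zPart (s : Multiset ℕ) : ℕ :=
  ∏ i ∈ s.toFinset, (s.count i).factorial * i ^ s.count i

/-- The complete homogeneous symmetric function `h_n = ∑_{μ ⊢ n} P_μ / Z_μ`. -/
def completeSym (n : ℕ) : SymFun :=
  ∑ μ : n.Partition, ((zPart μ.parts : ℂ)⁻¹) • powerSumProd μ.parts

/-- `h_k` for an integer index, with `h_k = 0` for `k < 0`. -/
def completeSymInt (k : ℤ) : SymFun := if 0 ≤ k then completeSym k.toNat else 0

/-- The Schur function `S_λ = det (h_{λ_i - i + j})_{1 ≤ i, j ≤ ℓ(λ)}`. -/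
def schur (lam : YoungDiagram) : SymFun :=
  Matrix.det (Matrix.of fun i j : Fin (lam.colLen 0) =>
    completeSymInt ((lam.rowLen i : ℤ) - (i : ℤ) + (j : ℤ)))

/-! ## The group algebra of the symmetric group -/

/-- The group algebra `ℂ[S_n]`. -/
abbrev GroupAlg (n : ℕ) : Type := MonoidAlgebra ℂ (Equiv.Perm (Fin n))

/-- A permutation as an element of `ℂ[S_n]`. -/
abbrev permElt {n : ℕ} (g : Equiv.Perm (Fin n)) : GroupAlg n :=
  MonoidAlgebra.of ℂ (Equiv.Perm (Fin n)) g

/-- The center `𝒵(ℂ[S_n])`. -/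
abbrev ZAlg (n : ℕ) : Type := Subalgebra.center ℂ (GroupAlg n)

/-- The (extended) characteristic map on `ℂ[S_n]`: `ch_n(g) = P_{cyc(g)} / n!`, where `cyc(g)` is
the partition of `n` formed by all cycle lengths of `g`, fixed points included. -/
def chAlg (n : ℕ) : GroupAlg n →ₗ[ℂ] SymFun :=
  Finsupp.linearCombination ℂ (fun g : Equiv.Perm (Fin n) =>
    ((n.factorial : ℂ)⁻¹) • powerSumProd (Equiv.Perm.partition g).parts) ∘ₗ
    (MonoidAlgebra.coeffLinearEquiv ℂ).toLinearMap

/-- The characteristic map `ch : ⨁_{n ≥ 0} 𝒵(ℂ[S_n]) → Λ`. -/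
def ch : (⨁ n : ℕ, ZAlg n) →ₗ[ℂ] SymFun :=
  DirectSum.toModule ℂ ℕ SymFun fun n =>
    chAlg n ∘ₗ (Subalgebra.center ℂ (GroupAlg n)).val.toLinearMap

/-! ## Irreducible characters and the idempotents `F_λ` -/

/-- The cell of `λ` carrying the label `k` in a fixed (arbitrary) tableau of shape `λ`. -/
def tableauCell (lam : YoungDiagram) (k : Fin lam.card) : ℕ × ℕ :=
  (lam.cells.equivFin.symm k : lam.cells)

open Classical in
/-- The Young symmetrizer `c_λ = (∑_{p ∈ R} p) (∑_{q ∈ C} sgn(q) q)`, where `R` and `C` are the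
row and the column stabilizer of the tableau. -/
def youngSymmetrizer (lam : YoungDiagram) : GroupAlg lam.card :=
  (∑ p : Equiv.Perm (Fin lam.card),
      if ∀ k, (tableauCell lam (p k)).1 = (tableauCell lam k).1 then permElt p else 0) *
    ∑ q : Equiv.Perm (Fin lam.card),
      if ∀ k, (tableauCell lam (q k)).2 = (tableauCell lam k).2 then
        ((Equiv.Perm.sign q : ℤ) : ℂ) • permElt q
      else 0

/-- The irreducible (Specht) module of `λ`: the left ideal `ℂ[S_n] c_λ`, `n = |λ|`. -/
abbrev spechtModule (lam : YoungDiagram) : Ideal (GroupAlg lam.card) :=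
  Ideal.span {youngSymmetrizer lam}

/-- The irreducible character `χ_λ(g)`: the trace of `g` acting on the Specht module. -/
def irrChar (lam : YoungDiagram) (g : Equiv.Perm (Fin lam.card)) : ℂ :=
  LinearMap.trace ℂ (spechtModule lam)
    (Algebra.lsmul ℂ ℂ (spechtModule lam) (permElt g))

theorem irrChar_conj (lam : YoungDiagram) (h g : Equiv.Perm (Fin lam.card)) :
    irrChar lam (h * g * h⁻¹) = irrChar lam g := by
  unfold irrChar permElt
  rw [map_mul, map_mul, LinearMap.trace_mul_comm, ← map_mul, ← map_mul,
    inv_mul_cancel_left]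

/-- The hook length of the cell `(i, j)` of `λ`. -/
def hookLength (lam : YoungDiagram) (c : ℕ × ℕ) : ℕ :=
  (lam.rowLen c.1 - c.2) + (lam.colLen c.2 - c.1) - 1

/-- The product `h_λ` of the hook lengths of `λ`. -/
def hookProd (lam : YoungDiagram) : ℕ := ∏ c ∈ lam.cells, hookLength lam c

theorem classSum_mem_center {n : ℕ} (f : Equiv.Perm (Fin n) → ℂ)
    (hf : ∀ h g, f (h * g * h⁻¹) = f g) :
    (∑ g, f g • permElt g : GroupAlg n) ∈ Subalgebra.center ℂ (GroupAlg n) := by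
  have key : ∀ h : Equiv.Perm (Fin n),
      (permElt h : GroupAlg n) * (∑ g, f g • permElt g) = (∑ g, f g • permElt g) * permElt h := by
    intro h
    rw [Finset.mul_sum, Finset.sum_mul]
    refine Fintype.sum_equiv (MulAut.conj h).toEquiv _ _ fun g => ?_
    simp only [MulEquiv.toEquiv_eq_coe, EquivLike.coe_coe, MulAut.conj_apply, hf,
      mul_smul_comm, smul_mul_assoc, ← map_mul, inv_mul_cancel_right]
  rw [Subalgebra.mem_center_iff]
  intro b
  induction b using MonoidAlgebra.induction_on with
  | of h => exact key h
  | add a b ha hb => rw [add_mul, mul_add, ha, hb]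
  | smul r a ha => rw [smul_mul_assoc, mul_smul_comm, ha]

/-- The central idempotent `F_λ = (1 / h_λ) ∑_{g ∈ S_{|λ|}} χ_λ(g) g`, that is
`(1 / h_λ) ∑_μ χ_λ(μ) C_μ` with the conjugacy class sums `C_μ`. -/
def idemF (lam : YoungDiagram) : ZAlg lam.card :=
  ((hookProd lam : ℂ)⁻¹) •
    ⟨∑ g, irrChar lam g • permElt g, classSum_mem_center _ (irrChar_conj lam)⟩

/-- `F_λ` as an element of `⨁_{n ≥ 0} 𝒵(ℂ[S_n])`. -/
def idemSum (lam : YoungDiagram) : ⨁ n : ℕ, ZAlg n :=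
  DirectSum.lof ℂ ℕ (fun n => ZAlg n) lam.card (idemF lam)

/-! ## Jucys–Murphy elements -/

/-- The Jucys–Murphy element `𝒥_b = ∑_{a < b} (a b)`. -/
def jucysMurphy {n : ℕ} (b : Fin n) : GroupAlg n :=
  ∑ a ∈ Finset.univ.filter (fun a => a < b), permElt (Equiv.swap a b)

/-- The generating function `H(z, 𝒥) = ∏_{b = 1}^n (1 - z 𝒥_b)⁻¹` of the complete symmetric
functions, evaluated at the Jucys–Murphy elements. -/
def completeJM (n : ℕ) (z : ℂ) : GroupAlg n :=
  ((List.finRange n).map fun b => Ring.inverse (1 - z • jucysMurphy b)).prod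

/-- `e^{θ₀ P₀(𝒥)} ∏_{α} H(z_α, 𝒥)` in `ℂ[S_n]`, where `P₀(𝒥) = n`. -/
def twistJM (n : ℕ) (θ₀ : ℂ) {m : ℕ} (z : Fin m → ℂ) : GroupAlg n :=
  Complex.exp (θ₀ * n) • ((List.finRange m).map fun α => completeJM n (z α)).prod

/-! ## The group `𝒜_P` -/

/-- The completion of `Λ[P₀] = ℂ[P₀, P₁, P₂, …]`: formal power series in `P₀, P₁, P₂, …`. -/
abbrev SymFunCompl : Type := MvPowerSeries ℕ ℂ

/-- The formal series `exp (∑_{i ≥ 0} θ_i P_i) = ∏_{i ≥ 0} exp (θ_i P_i)`: the coefficient of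
`∏ P_i^{d_i}` is `∏ θ_i^{d_i} / d_i!`. -/
def expPower (θ : ℕ → ℂ) : SymFunCompl :=
  fun d => d.prod fun i k => θ i ^ k / (k.factorial : ℂ)

theorem isUnit_expPower (θ : ℕ → ℂ) : IsUnit (expPower θ) := by
  rw [MvPowerSeries.isUnit_iff_constantCoeff]
  have : MvPowerSeries.constantCoeff (expPower θ) = (1 : ℂ) := by
    rw [← MvPowerSeries.coeff_zero_eq_constantCoeff_apply]
    change Finsupp.prod (0 : ℕ →₀ ℕ) (fun i k => θ i ^ k / (k.factorial : ℂ)) = 1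
    exact Finsupp.prod_zero_index
  rw [this]
  exact isUnit_one

/-- The parameters `θ_i = (1 / i) ∑_α z_α^i` for `i ≥ 1`, together with a given `θ₀`. -/
def thetaParam (θ₀ : ℂ) {m : ℕ} (z : Fin m → ℂ) (i : ℕ) : ℂ :=
  if i = 0 then θ₀ else (i : ℂ)⁻¹ * ∑ α, z α ^ i

/-- No `z_α` is the reciprocal of an integer. -/
def Admissible {m : ℕ} (z : Fin m → ℂ) : Prop := ∀ α, ∀ k : ℤ, (k : ℂ) * z α ≠ 1

/-- The element `exp (∑_{i ≥ 0} θ_i P_i)`, as an invertible series. -/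
def twistUnit (θ₀ : ℂ) {m : ℕ} (z : Fin m → ℂ) : SymFunComplˣ :=
  (isUnit_expPower (thetaParam θ₀ z)).unit

/-- The abelian group `𝒜_P` generated by the elements
`exp (∑_{i ≥ 0} θ_i P_i) = e^{θ₀ P₀} ∏_{α = 1}^m H(z_α)` with admissible `z_1, …, z_m`. -/
def groupAP : Subgroup SymFunComplˣ :=
  Subgroup.closure {u | ∃ (θ₀ : ℂ) (m : ℕ) (z : Fin m → ℂ), Admissible z ∧ u = twistUnit θ₀ z}

/-- The element `exp (∑_{i ≥ 0} θ_i P_i)` of `𝒜_P`. -/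
def twistElt (θ₀ : ℂ) {m : ℕ} (z : Fin m → ℂ) (hz : Admissible z) : groupAP :=
  ⟨twistUnit θ₀ z, Subgroup.subset_closure ⟨θ₀, m, z, hz, rfl⟩⟩

/-- Multiplication on `⨁_{n ≥ 0} 𝒵(ℂ[S_n])` by a family of central elements. -/
def mulFamily (u : ∀ n : ℕ, ZAlg n) : (⨁ n : ℕ, ZAlg n) →ₗ[ℂ] ⨁ n : ℕ, ZAlg n :=
  DirectSum.lmap fun n => LinearMap.mulLeft ℂ (u n)

/-! ## Fermionic Fock space -/

/-- Maya diagrams: sets `M ⊆ ℤ` of occupied sites such that only finitely many sites `≥ 0` are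
occupied and only finitely many sites `< 0` are empty. -/
def Maya : Type :=
  {M : Set ℤ // (M ∩ Set.Ici 0).Finite ∧ (Set.Iio 0 \ M).Finite}

/-- The fermionic Fock space `𝓕`, with the Maya diagrams as a basis. -/
abbrev Fock : Type := Maya →₀ ℂ

/-- The basis vector of a Maya diagram. -/
abbrev mayaVec (M : Maya) : Fock := Finsupp.single M 1

/-- The charge of a Maya diagram. -/
def charge (M : Maya) : ℤ :=
  ((M.1 ∩ Set.Ici 0).ncard : ℤ) - ((Set.Iio 0 \ M.1).ncard : ℤ)

/-- The charge `N` sector `𝓕_N`. -/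
abbrev sector (N : ℤ) : Submodule ℂ Fock := Finsupp.supported ℂ ℂ {M | charge M = N}

/-- The Maya diagram `{λ_i - i + N : i ≥ 1}`. -/
def mayaOf (lam : YoungDiagram) (N : ℤ) : Maya :=
  ⟨Set.range fun i : ℕ => (lam.rowLen i : ℤ) - ((i : ℤ) + 1) + N, by
    constructor
    · refine (Set.finite_Icc (0 : ℤ) ((lam.rowLen 0 : ℤ) + N)).subset ?_
      rintro _ ⟨⟨i, rfl⟩, h⟩
      refine ⟨h, ?_⟩
      have := lam.rowLen_anti 0 i (Nat.zero_le i)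
      dsimp only
      omega
    · refine (Set.finite_Ico (N - (lam.colLen 0 : ℤ)) 0).subset ?_
      rintro k ⟨hk, hM⟩
      refine ⟨?_, hk⟩
      by_contra hlt
      refine hM ⟨(N - k - 1).toNat, ?_⟩
      have hi : lam.rowLen (N - k - 1).toNat = 0 := by
        by_contra hpos
        have h1 : ((N - k - 1).toNat, 0) ∈ lam :=
          YoungDiagram.mem_iff_lt_rowLen.2 (Nat.pos_of_ne_zero hpos)
        have h2 := YoungDiagram.mem_iff_lt_colLen.1 h1
        omega
      dsimp only
      rw [hi]
      omega⟩

/-- The basis vector `|λ; N⟩`. -/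
def ket (lam : YoungDiagram) (N : ℤ) : Fock := mayaVec (mayaOf lam N)

/-- The vacuum Maya diagram, with exactly the sites `< 0` occupied. -/
def vacMaya : Maya := ⟨Set.Iio 0, by
  constructor
  · refine Set.Finite.subset Set.finite_empty ?_
    rintro x ⟨h1, h2⟩
    exact absurd (Set.mem_Iio.1 h1) (not_lt.2 (Set.mem_Ici.1 h2))
  · simp⟩

/-- Occupy the site `j`. -/
def addSite (j : ℤ) (M : Maya) : Maya :=
  ⟨insert j M.1,
    ((M.2.1.insert j).subset fun _ hx => hx.1.elim Or.inl fun h => Or.inr ⟨h, hx.2⟩),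
    M.2.2.subset fun _ hx => ⟨hx.1, fun h => hx.2 (Or.inr h)⟩⟩

/-- Empty the site `j`. -/
def removeSite (j : ℤ) (M : Maya) : Maya :=
  ⟨M.1 \ {j}, M.2.1.subset fun _ hx => ⟨hx.1.1, hx.2⟩,
    ((M.2.2.insert j).subset fun x hx => by
      by_cases h : x = j
      · exact Or.inl h
      · exact Or.inr ⟨hx.1, fun hM => hx.2 ⟨hM, h⟩⟩)⟩

/-- The sign `(-1)^{#{k ∈ M : k > j}}`. -/
def siteSign (j : ℤ) (M : Maya) : ℂ := (-1) ^ (M.1 ∩ Set.Ioi j).ncard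

open Classical in
/-- The creation operator `ψ_j`. -/
def psi (j : ℤ) : Fock →ₗ[ℂ] Fock :=
  Finsupp.linearCombination ℂ fun M =>
    if j ∈ M.1 then 0 else siteSign j M • mayaVec (addSite j M)

open Classical in
/-- The annihilation operator `ψ_j†`. -/
def psiDag (j : ℤ) : Fock →ₗ[ℂ] Fock :=
  Finsupp.linearCombination ℂ fun M =>
    if j ∈ M.1 then siteSign j M • mayaVec (removeSite j M) else 0

/-- The normal ordered product `:ψ_j ψ_j†: = ψ_j ψ_j† - ⟨0| ψ_j ψ_j† |0⟩`. -/
def normalOrd (j : ℤ) : Fock →ₗ[ℂ] Fock :=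
  psi j ∘ₗ psiDag j - (psi j (psiDag j (mayaVec vacMaya)) vacMaya) • LinearMap.id

/-- The operator `∑_{j ∈ ℤ} T_j :ψ_j ψ_j†:`. On each basis vector only finitely many terms are
nonzero. -/
def diagGen (T : ℤ → ℂ) : Fock →ₗ[ℂ] Fock :=
  Finsupp.linearCombination ℂ fun M => ∑ᶠ j : ℤ, T j • normalOrd j (mayaVec M)

open Classical in
/-- The exponential of an operator on `𝓕`, whose matrix entries are given by the exponential
series: `⟨M'| e^A |M⟩ = ∑_k ⟨M'| A^k |M⟩ / k!`. (The value is `0` on a basis vector for which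
infinitely many of these entries are nonzero, which does not happen for diagonal `A`.) -/
def expOp (A : Fock →ₗ[ℂ] Fock) : Fock →ₗ[ℂ] Fock :=
  Finsupp.linearCombination ℂ fun M =>
    if h : (Function.support fun M' : Maya =>
        ∑' k : ℕ, ((k.factorial : ℂ)⁻¹) * (A ^ k) (mayaVec M) M').Finite then
      Finsupp.ofSupportFinite _ h
    else 0

/-- The convolution symmetry `Ĉ_ρ = exp (∑_{j ∈ ℤ} T_j :ψ_j ψ_j†:)`, where `ρ_j = e^{T_j}`. -/
def convSym (T : ℤ → ℂ) : Fock →ₗ[ℂ] Fock := expOp (diagGen T)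

/-- The eigenvalue of `:ψ_j ψ_j†:` on the basis vector of `M`. -/
def occ (j : ℤ) (M : Maya) : ℂ := by
  classical exact (if j ∈ M.1 then 1 else 0) - (if j < 0 then 1 else 0)

theorem psi_psiDag (j : ℤ) (M : Maya) :
    psi j (psiDag j (mayaVec M)) = (by classical exact if j ∈ M.1 then mayaVec M else 0) := by
  classical
  unfold psi psiDag
  rw [Finsupp.linearCombination_single, one_smul]
  by_cases h : j ∈ M.1
  · have h1 : j ∉ (removeSite j M).1 := fun hx => hx.2 rfl
    have h2 : addSite j (removeSite j M) = M := by
      apply Subtype.ext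
      change insert j (M.1 \ {j}) = M.1
      rw [Set.insert_sdiff_singleton, Set.insert_eq_of_mem h]
    have h3 : siteSign j (removeSite j M) = siteSign j M := by
      unfold siteSign
      congr 2
      ext x
      constructor
      · exact fun hx => ⟨hx.1.1, hx.2⟩
      · exact fun hx => ⟨⟨hx.1, ne_of_gt hx.2⟩, hx.2⟩
    rw [if_pos h, if_pos h, map_smul, Finsupp.linearCombination_single, one_smul, if_neg h1,
      h2, h3, smul_smul]
    unfold siteSign
    rw [← mul_pow]
    simp
  · rw [if_neg h, if_neg h, map_zero]

theorem normalOrd_mayaVec (j : ℤ) (M : Maya) :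
    normalOrd j (mayaVec M) = occ j M • mayaVec M := by
  classical
  unfold normalOrd occ
  rw [LinearMap.sub_apply, LinearMap.comp_apply, psi_psiDag, LinearMap.smul_apply,
    LinearMap.id_apply, psi_psiDag, sub_smul]
  have hv : (j ∈ vacMaya.1) = (j < 0) := rfl
  simp only [hv]
  congr 1
  · split_ifs <;> simp
  · split_ifs <;> simp

theorem occ_support_finite (M : Maya) : {j : ℤ | occ j M ≠ 0}.Finite := by
  classical
  refine (M.2.1.union M.2.2).subset fun j hj => ?_
  simp only [Set.mem_ofPred_eq, occ] at hj
  by_cases h : j ∈ M.1 <;> by_cases h0 : j < 0 <;> simp_all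

/-- The eigenvalue of `∑_j T_j :ψ_j ψ_j†:` on the basis vector of `M`. -/
def diagEig (T : ℤ → ℂ) (M : Maya) : ℂ := ∑ᶠ j : ℤ, T j * occ j M

theorem diagGen_mayaVec (T : ℤ → ℂ) (M : Maya) :
    diagGen T (mayaVec M) = diagEig T M • mayaVec M := by
  unfold diagGen diagEig
  rw [Finsupp.linearCombination_single, one_smul, finsum_smul']
  · simp only [normalOrd_mayaVec, smul_smul]
  · refine (occ_support_finite M).subset fun j hj h0 => hj ?_
    change T j * occ j M = 0
    rw [h0, mul_zero]

theorem diagGen_pow_mayaVec (T : ℤ → ℂ) (M : Maya) (k : ℕ) :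
    (diagGen T ^ k) (mayaVec M) = diagEig T M ^ k • mayaVec M := by
  induction k with
  | zero => simp
  | succ k ih =>
    rw [pow_succ', Module.End.mul_apply, ih, map_smul, diagGen_mayaVec, smul_smul, pow_succ]

theorem convSym_mayaVec (T : ℤ → ℂ) (M : Maya) :
    convSym T (mayaVec M) = Complex.exp (diagEig T M) • mayaVec M := by
  classical
  have key : (fun M' : Maya =>
      ∑' k : ℕ, ((k.factorial : ℂ)⁻¹) * (diagGen T ^ k) (mayaVec M) M') =
      (Complex.exp (diagEig T M) • mayaVec M : Fock) := by
    funext M'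
    simp only [diagGen_pow_mayaVec, Finsupp.smul_apply, smul_eq_mul, ← mul_assoc]
    rw [tsum_mul_right, Complex.exp_eq_exp_ℂ, NormedSpace.exp_eq_tsum ℂ]
    simp only [smul_eq_mul]
  unfold convSym expOp
  rw [Finsupp.linearCombination_single, one_smul]
  have hfin : (Function.support fun M' : Maya =>
      ∑' k : ℕ, ((k.factorial : ℂ)⁻¹) * (diagGen T ^ k) (mayaVec M) M').Finite := by
    rw [key]
    exact Finsupp.hasFiniteSupport _
  rw [dif_pos hfin]
  ext M'
  exact congrFun key M'

theorem diagEig_add (S T : ℤ → ℂ) (M : Maya) :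
    diagEig (S + T) M = diagEig S M + diagEig T M := by
  unfold diagEig
  have h : ∀ R : ℤ → ℂ, (Function.support fun j => R j * occ j M).Finite := fun R =>
    (occ_support_finite M).subset fun j hj h0 => hj (by
      change R j * occ j M = 0
      rw [h0, mul_zero])
  rw [← finsum_add_distrib (h S) (h T)]
  simp only [Pi.add_apply, add_mul]

theorem convSym_mul (S T : ℤ → ℂ) : convSym S * convSym T = convSym (S + T) := by
  refine Finsupp.lhom_ext' fun M => LinearMap.ext_ring ?_
  change convSym S (convSym T (mayaVec M)) = convSym (S + T) (mayaVec M)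
  rw [convSym_mayaVec, map_smul, convSym_mayaVec, convSym_mayaVec, smul_smul, diagEig_add,
    Complex.exp_add, mul_comm]

theorem convSym_zero : convSym 0 = 1 := by
  refine Finsupp.lhom_ext' fun M => LinearMap.ext_ring ?_
  change convSym 0 (mayaVec M) = mayaVec M
  rw [convSym_mayaVec]
  simp [diagEig]

/-- The abelian group `Ĉ` of convolution symmetries, acting on `𝓕`. -/
def convGroup : Subgroup (Module.End ℂ Fock)ˣ where
  carrier := {u | ∃ T : ℤ → ℂ, (u : Module.End ℂ Fock) = convSym T}
  one_mem' := ⟨0, by rw [convSym_zero]; rfl⟩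
  mul_mem' := by
    rintro u v ⟨S, hS⟩ ⟨T, hT⟩
    exact ⟨S + T, by rw [Units.val_mul, hS, hT, convSym_mul]⟩
  inv_mem' := by
    rintro u ⟨T, hT⟩
    refine ⟨-T, Units.inv_eq_of_mul_eq_one_right ?_⟩
    rw [hT, convSym_mul, add_neg_cancel, convSym_zero]

/-! ## The parameters of the homomorphism `𝓘` -/

/-- `T_j = j θ₀ - ∑_α ∑_{k = 1}^j ln (1 - k z_α)` for `j ≥ 0`, and
`T_j = j θ₀ + ∑_α ∑_{k = j + 1}^0 ln (1 - k z_α)` for `j < 0`. -/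
def paramT (θ₀ : ℂ) {m : ℕ} (z : Fin m → ℂ) (j : ℤ) : ℂ :=
  if 0 ≤ j then
    j * θ₀ - ∑ α, ∑ k ∈ Finset.Icc 1 j, Complex.log (1 - k * z α)
  else
    j * θ₀ + ∑ α, ∑ k ∈ Finset.Icc (j + 1) 0, Complex.log (1 - k * z α)

/-- `ρ_j = e^{j θ₀} ∏_α ∏_{k = 1}^j (1 - k z_α)⁻¹` for `j ≥ 0`, and
`ρ_j = e^{j θ₀} ∏_α ∏_{k = j + 1}^0 (1 - k z_α)` for `j < 0`. -/
def paramRho (θ₀ : ℂ) {m : ℕ} (z : Fin m → ℂ) (j : ℤ) : ℂ :=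
  if 0 ≤ j then
    Complex.exp (j * θ₀) * ∏ α, ∏ k ∈ Finset.Icc 1 j, (1 - k * z α)⁻¹
  else
    Complex.exp (j * θ₀) * ∏ α, ∏ k ∈ Finset.Icc (j + 1) 0, (1 - k * z α)

/-- The eigenvalue `e^{θ₀ |λ|} ∏_α ∏_{(i, j) ∈ λ} (1 - (j - i) z_α)⁻¹`. -/
def contentEig (θ₀ : ℂ) {m : ℕ} (z : Fin m → ℂ) (lam : YoungDiagram) : ℂ :=
  Complex.exp (θ₀ * lam.card) *
    ∏ α, ∏ c ∈ lam.cells, (1 - ((c.2 : ℂ) - (c.1 : ℂ)) * z α)⁻¹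

end

end TodaFock

open TodaFock

open TodaFock
open scoped DirectSum
namespace TodaFock
noncomputable section

/-! ## Complete symmetric functions and specializations -/

/-! Everything is compared on one index set, the Young diagrams. Put `e_λ = ∑_g χ_λ(g) g`, a
multiple of `F_λ`. The `e_λ` form a basis of the sum of the centers, the characteristic map sends
them to the Schur functions, and charge zero Maya diagrams are the diagrams again. Fermionization is
the resulting change of labels. Both actions are diagonal in these bases, so intertwining means
equality of eigenvalues for the generators of `𝒜_P`, and it then passes to products and inverses.

Two facts carry the algebra. The first is the Frobenius formula `schur_eq_frob`, which links the
trace on the ideal of a Young symmetrizer with the Jacobi–Trudi determinant. Orthogonality makes the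
irreducible characters a basis of the class functions. A product of `h`'s is the Frobenius image of
a permutation character, so `s_λ` is a combination of the images of the `χ_μ`. It is unitriangular
with `μ ≥ λ` in dominance order, because the Kostka numbers are. Column operations in the
determinant (`det_flag`) show that every monomial of `s_λ` is dominated by `λ`. A maximal `μ ≠ λ`
occurring in the combination would leave the monomial `x^μ`, which is a contradiction.

The second is the eigenvalue of `∏_b (1 - z 𝒥_b)`. The product `∏_b (x + 𝒥_b)` equals `∑_g
x^{#cycles} g`. It acts on `e_λ` by `∑_g χ_λ(g) x^{#cycles} / χ_λ(1)`, which the Frobenius formula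
identifies, up to normalization, with `s_λ` at `P_k = x`. That is a product over contents. Contents
are integers, so admissibility gives invertibility.

On the Fock side, row `i` moves a particle from site `-(i+1)` to `λ_i - (i+1)` in zero-based
numbering. The difference of the `T_j` telescopes over the cells of the row and gives the same
product over contents.

Both homomorphisms are well defined because an element `exp(∑ θ_i P_i)` determines `θ₀` and all
power sums of the `z_α`, hence the multiset of the nonzero `z_α`
(`filter_ne_zero_eq_of_pow_sum_eq`). -/

/-- The multisets of positive integers with sum `n`. -/
def partsFinset (n : ℕ) : Finset (Multiset ℕ) :=
  Finset.univ.image (Nat.Partition.parts : n.Partition → Multiset ℕ)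

theorem mem_partsFinset {n : ℕ} {s : Multiset ℕ} :
    s ∈ partsFinset n ↔ (∀ i ∈ s, 0 < i) ∧ s.sum = n := by
  constructor
  · intro h
    obtain ⟨μ, -, rfl⟩ := Finset.mem_image.1 h
    exact ⟨fun i hi => μ.parts_pos hi, μ.parts_sum⟩
  · rintro ⟨h1, h2⟩
    exact Finset.mem_image.2 ⟨⟨s, fun hi => h1 _ hi, h2⟩, Finset.mem_univ _, rfl⟩

/-- Plain multisets carry no dependence on `n`, which allows the bijections below that add or remove
a part. -/
theorem sum_partition_eq_sum_partsFinset {M : Type*} [AddCommMonoid M] (n : ℕ)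
    (F : Multiset ℕ → M) : ∑ μ : n.Partition, F μ.parts = ∑ s ∈ partsFinset n, F s := by
  rw [partsFinset, Finset.sum_image]
  intro a _ b _ h
  exact Nat.Partition.ext h

theorem completeSym_eq_sum (n : ℕ) :
    completeSym n = ∑ s ∈ partsFinset n, ((zPart s : ℂ)⁻¹) • powerSumProd s :=
  sum_partition_eq_sum_partsFinset n fun s => ((zPart s : ℂ)⁻¹) • powerSumProd s

theorem zPart_eq_prod {s : Multiset ℕ} {U : Finset ℕ} (h : s.toFinset ⊆ U) :
    zPart s = ∏ i ∈ U, (s.count i).factorial * i ^ s.count i := by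
  refine Finset.prod_subset h fun i _ hi => ?_
  rw [Multiset.count_eq_zero.2 (by simpa using hi)]
  simp

/-- The factor gained is `k` times the new multiplicity of `k`; these are the weights that appear in
Newton's identity. -/
theorem zPart_cons (k : ℕ) (t : Multiset ℕ) :
    zPart (k ::ₘ t) = k * (t.count k + 1) * zPart t := by
  have hk : k ∈ (k ::ₘ t).toFinset := by simp
  rw [zPart_eq_prod (s := k ::ₘ t) subset_rfl,
    zPart_eq_prod (s := t) (U := (k ::ₘ t).toFinset)
      (Multiset.toFinset_subset.2 (Multiset.subset_cons t k)),
    ← Finset.mul_prod_erase _ _ hk, ← Finset.mul_prod_erase _ _ hk]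
  have : ∀ i ∈ ((k ::ₘ t).toFinset.erase k),
      ((k ::ₘ t).count i).factorial * i ^ (k ::ₘ t).count i =
        (t.count i).factorial * i ^ t.count i := by
    intro i hi
    rw [Multiset.count_cons_of_ne (Finset.ne_of_mem_erase hi)]
  rw [Finset.prod_congr rfl this, Multiset.count_cons_self, Nat.factorial_succ, pow_succ]
  ring

theorem zPart_ne_zero {s : Multiset ℕ} (h : ∀ i ∈ s, 0 < i) : zPart s ≠ 0 := by
  refine Finset.prod_ne_zero_iff.2 fun i hi => ?_
  have := h i (by simpa using hi)
  positivity

theorem powerSumProd_cons (k : ℕ) (t : Multiset ℕ) :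
    powerSumProd (k ::ₘ t) = powerSum k * powerSumProd t := by
  simp [powerSumProd]

theorem completeSym_zero : completeSym 0 = 1 := by
  rw [completeSym_eq_sum]
  have : partsFinset 0 = {0} := by
    ext s
    rw [mem_partsFinset, Finset.mem_singleton]
    constructor
    · rintro ⟨h1, h2⟩
      rw [Multiset.sum_eq_zero_iff] at h2
      exact Multiset.eq_zero_of_forall_notMem fun i hi => (h1 i hi).ne' (h2 i hi)
    · rintro rfl; simp
  rw [this]
  simp [zPart, powerSumProd]

/-- Newton's identity. -/
theorem nsmul_completeSym (m : ℕ) :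
    (m : ℂ) • completeSym m =
      ∑ k ∈ Finset.Icc 1 m, powerSum k * completeSym (m - k) := by
  classical
  simp only [completeSym_eq_sum, Finset.mul_sum, Finset.smul_sum]
  -- The scalar `m` is the sum of the parts of `s`. It splits over the distinct parts `k` with
  -- weight `k` times multiplicity, which is the ratio of `zPart s` to `zPart (s.erase k)`.
  have h1 : ∀ s ∈ partsFinset m, (m : ℂ) • ((zPart s : ℂ)⁻¹ • powerSumProd s) =
      ∑ k ∈ s.toFinset, powerSum k * ((zPart (s.erase k) : ℂ)⁻¹ • powerSumProd (s.erase k)) := by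
    intro s hs
    obtain ⟨hpos, hsum⟩ := mem_partsFinset.1 hs
    have h2 : ∀ k ∈ s.toFinset,
        powerSum k * ((zPart (s.erase k) : ℂ)⁻¹ • powerSumProd (s.erase k)) =
          ((s.count k * k : ℕ) : ℂ) • ((zPart s : ℂ)⁻¹ • powerSumProd s) := by
      intro k hk
      have hk' : k ∈ s := by simpa using hk
      obtain ⟨t, rfl⟩ := Multiset.exists_cons_of_mem hk'
      have hz : (zPart t : ℂ) ≠ 0 := by
        exact_mod_cast zPart_ne_zero fun i hi => hpos i (Multiset.mem_cons_of_mem hi)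
      have hk0 : (k : ℂ) ≠ 0 := by exact_mod_cast (hpos k hk').ne'
      have hc : ((t.count k : ℂ) + 1) ≠ 0 := by exact_mod_cast Nat.succ_ne_zero (t.count k)
      rw [Multiset.erase_cons_head, zPart_cons, powerSumProd_cons, mul_smul_comm, smul_smul,
        Multiset.count_cons_self]
      congr 1
      push_cast
      field_simp
    rw [Finset.sum_congr rfl h2, ← Finset.sum_smul, ← Nat.cast_sum]
    congr 2
    rw [← hsum, Finset.sum_multiset_count]
    simp
  rw [Finset.sum_congr rfl h1, Finset.sum_sigma', Finset.sum_sigma']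
  -- A partition with a marked distinct part is the same as a part together with the remaining
  -- partition.
  refine Finset.sum_bij' (fun x _ => ⟨x.2, x.1.erase x.2⟩) (fun x _ => ⟨x.1 ::ₘ x.2, x.1⟩)
    ?_ ?_ ?_ ?_ ?_
  · rintro ⟨s, k⟩ h
    simp only [Finset.mem_sigma, mem_partsFinset, Multiset.mem_toFinset, Finset.mem_Icc] at h ⊢
    obtain ⟨⟨h1, h2⟩, h3⟩ := h
    obtain ⟨t, rfl⟩ := Multiset.exists_cons_of_mem h3
    rw [Multiset.sum_cons] at h2
    rw [Multiset.erase_cons_head]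
    exact ⟨⟨h1 k h3, by omega⟩, fun i hi => h1 i (Multiset.mem_cons_of_mem hi), by omega⟩
  · rintro ⟨k, t⟩ h
    simp only [Finset.mem_sigma, mem_partsFinset, Multiset.mem_toFinset, Finset.mem_Icc] at h ⊢
    obtain ⟨⟨h1, h2⟩, h3, h4⟩ := h
    refine ⟨⟨fun i hi => ?_, by rw [Multiset.sum_cons]; omega⟩, Multiset.mem_cons_self _ _⟩
    rcases Multiset.mem_cons.1 hi with rfl | hi
    · omega
    · exact h3 i hi
  · rintro ⟨s, k⟩ h
    simp only [Finset.mem_sigma, Multiset.mem_toFinset] at h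
    simp only [Multiset.cons_erase h.2]
  · rintro ⟨k, t⟩ h
    simp
  · rintro ⟨s, k⟩ h
    rfl

/-! ### Generating series of specializations. -/

section PowerSeries
open PowerSeries
variable {R : Type*} [CommRing R] [Algebra ℂ R]

/-- The generating series `∑ φ(h_n) tⁿ` of a specialization `φ`. -/
def hSeries (φ : SymFun →ₐ[ℂ] R) : PowerSeries R := PowerSeries.mk fun n => φ (completeSym n)

/-- The generating series `∑_{n ≥ 1} φ(P_n) tⁿ` of a specialization `φ`. -/
def pSeries (φ : SymFun →ₐ[ℂ] R) : PowerSeries R :=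
  PowerSeries.mk fun n => if n = 0 then 0 else φ (powerSum n)

theorem coeff_X_mul_derivative {R : Type*} [CommRing R] (f : PowerSeries R) (n : ℕ) :
    coeff n (X * d⁄dX R f) = (n : R) * coeff n f := by
  cases n with
  | zero => simp
  | succ n => rw [coeff_succ_X_mul, coeff_derivative]; push_cast; ring

/-- Newton's identity in the form `t H' = P H`: the power sums are the logarithmic derivative of
`H`. -/
theorem X_mul_derivative_hSeries (φ : SymFun →ₐ[ℂ] R) :
    X * d⁄dX R (hSeries φ) = pSeries φ * hSeries φ := by
  ext n
  rw [coeff_X_mul_derivative, coeff_mul, Finset.Nat.sum_antidiagonal_eq_sum_range_succ_mk]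
  have h := congrArg φ (nsmul_completeSym n)
  rw [map_smul, Nat.cast_smul_eq_nsmul, nsmul_eq_mul, map_sum] at h
  simp only [hSeries, pSeries, coeff_mk]
  rw [h, Finset.sum_range_succ', if_pos rfl, zero_mul, add_zero, Finset.range_eq_Ico,
    Finset.sum_Ico_add' (fun k => (if k = 0 then 0 else φ (powerSum k)) *
      φ (completeSym (n - k))) 0 n 1]
  refine Finset.sum_congr (by ext; simp) fun k hk => ?_
  rw [Finset.mem_Ico] at hk
  rw [if_neg (by omega), map_mul]

/-- As `Q` has no constant term, the `n`-th coefficient of `Q * A` involves only lower coefficients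
of `A`. It determines `n` times the `n`-th coefficient of `A`, and `n` is invertible in a
`ℂ`-algebra. -/
theorem eq_of_X_mul_derivative_eq {Q A B : PowerSeries R} (hQ : coeff 0 Q = 0)
    (h0 : coeff 0 A = coeff 0 B) (hA : X * d⁄dX R A = Q * A) (hB : X * d⁄dX R B = Q * B) :
    A = B := by
  ext n
  induction n using Nat.strong_induction_on with
  | _ n ih =>
    rcases Nat.eq_zero_or_pos n with rfl | hn
    · exact h0
    · have hA' := congrArg (coeff n) hA
      have hB' := congrArg (coeff n) hB
      rw [coeff_X_mul_derivative, coeff_mul] at hA' hB'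
      have h : (n : R) * coeff n A = (n : R) * coeff n B := by
        rw [hA', hB']
        refine Finset.sum_congr rfl fun p hp => ?_
        rw [Finset.HasAntidiagonal.mem_antidiagonal] at hp
        rcases Nat.eq_zero_or_pos p.1 with h1 | h1
        · rw [h1, hQ, zero_mul, zero_mul]
        · rw [ih p.2 (by omega)]
      have hn' : (n : ℂ) ≠ 0 := by exact_mod_cast hn.ne'
      have h2 := congrArg (fun r : R => (n : ℂ)⁻¹ • r) h
      simpa only [← nsmul_eq_mul, ← Nat.cast_smul_eq_nsmul ℂ, smul_smul, inv_mul_cancel₀ hn',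
        one_smul] using h2

/-- Logarithmic derivatives add, so both sides solve the same differential equation with constant
term `1`. -/
theorem hSeries_add {φ ψ₁ ψ₂ : SymFun →ₐ[ℂ] R}
    (h : ∀ k, 0 < k → φ (powerSum k) = ψ₁ (powerSum k) + ψ₂ (powerSum k)) :
    hSeries φ = hSeries ψ₁ * hSeries ψ₂ := by
  refine eq_of_X_mul_derivative_eq (Q := pSeries φ) (by simp [pSeries]) ?_
    (X_mul_derivative_hSeries φ) ?_
  · rw [coeff_mul]
    simp [hSeries, completeSym_zero]
  · have hp : pSeries φ = pSeries ψ₁ + pSeries ψ₂ := by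
      ext n
      simp only [pSeries, coeff_mk, map_add]
      split_ifs with hn
      · simp
      · exact h n (Nat.pos_of_ne_zero hn)
    rw [Derivation.leibniz, smul_eq_mul, smul_eq_mul, mul_add, hp, add_mul]
    have h1 := X_mul_derivative_hSeries ψ₁
    have h2 := X_mul_derivative_hSeries ψ₂
    linear_combination hSeries ψ₂ * h1 + hSeries ψ₁ * h2

theorem hSeries_eq_one {φ : SymFun →ₐ[ℂ] R} (h : ∀ k, 0 < k → φ (powerSum k) = 0) :
    hSeries φ = 1 := by
  refine eq_of_X_mul_derivative_eq (Q := 0) (by simp) ?_ ?_ (by simp)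
  · simp [hSeries, completeSym_zero]
  · rw [X_mul_derivative_hSeries]
    congr 1
    ext n
    simp only [pSeries, coeff_mk, map_zero]
    split_ifs with hn
    · rfl
    · exact h n (Nat.pos_of_ne_zero hn)

theorem hSeries_prod {ι : Type*} [DecidableEq ι] (s : Finset ι) (ψ : ι → SymFun →ₐ[ℂ] R)
    {φ : SymFun →ₐ[ℂ] R}
    (h : ∀ k, 0 < k → φ (powerSum k) = ∑ i ∈ s, ψ i (powerSum k)) :
    hSeries φ = ∏ i ∈ s, hSeries (ψ i) := by
  induction s using Finset.induction_on generalizing φ with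
  | empty => rw [Finset.prod_empty]; exact hSeries_eq_one (by simpa using h)
  | insert a s ha ih =>
    let χ : SymFun →ₐ[ℂ] R := MvPolynomial.aeval fun k => ∑ i ∈ s, ψ i (MvPolynomial.X k)
    have hχ : ∀ k, 0 < k → χ (powerSum k) = ∑ i ∈ s, ψ i (powerSum k) := by
      intro k _
      simp [χ, powerSum]
    rw [Finset.prod_insert ha, ← ih hχ]
    refine hSeries_add fun k hk => ?_
    rw [h k hk, Finset.sum_insert ha, hχ k hk]

end PowerSeries

theorem map_powerSumProd {R : Type*} [CommRing R] [Algebra ℂ R] (φ : SymFun →ₐ[ℂ] R)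
    (s : Multiset ℕ) : φ (powerSumProd s) = (s.map fun k => φ (powerSum k)).prod := by
  rw [powerSumProd, map_multiset_prod, Multiset.map_map]
  rfl

theorem map_completeSym {R : Type*} [CommRing R] [Algebra ℂ R] (φ : SymFun →ₐ[ℂ] R) (n : ℕ) :
    φ (completeSym n) =
      ∑ s ∈ partsFinset n, ((zPart s : ℂ)⁻¹) • (s.map fun k => φ (powerSum k)).prod := by
  simp only [completeSym_eq_sum, map_sum, map_smul, map_powerSumProd]

theorem prod_map_pow_eq_pow_sum {M : Type*} [CommMonoid M] (y : M) (s : Multiset ℕ) :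
    (s.map fun k => y ^ k).prod = y ^ s.sum := by
  induction s using Multiset.induction_on with
  | empty => simp
  | cons a s ih => simp [ih, pow_add]

/-- A specialization multiplying each `P_k` by `yᵏ` multiplies `h_n` by `yⁿ`. -/
theorem map_completeSym_of_homogeneous {R : Type*} [CommRing R] [Algebra ℂ R]
    {φ ψ : SymFun →ₐ[ℂ] R} {y : R}
    (h : ∀ k, 0 < k → φ (powerSum k) = y ^ k * ψ (powerSum k)) (n : ℕ) :
    φ (completeSym n) = y ^ n * ψ (completeSym n) := by
  rw [map_completeSym, map_completeSym, Finset.mul_sum]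
  refine Finset.sum_congr rfl fun s hs => ?_
  obtain ⟨hpos, hsum⟩ := mem_partsFinset.1 hs
  rw [mul_smul_comm]
  congr 1
  have : (s.map fun k => φ (powerSum k)) = s.map fun k => y ^ k * ψ (powerSum k) :=
    Multiset.map_congr rfl fun k hk => h k (hpos k hk)
  rw [this, Multiset.prod_map_mul, prod_map_pow_eq_pow_sum, hsum]

/-! ### The Cauchy identity. -/

section Cauchy
open MvPolynomial

/-- The specialization `P_k ↦ ∑_i y_i^k`. -/
def specAt {ι R : Type*} [CommRing R] [Algebra ℂ R] (s : Finset ι) (y : ι → R) :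
    SymFun →ₐ[ℂ] R :=
  aeval fun k => ∑ i ∈ s, y i ^ (k : ℕ)

theorem specAt_powerSum {ι R : Type*} [CommRing R] [Algebra ℂ R] (s : Finset ι) (y : ι → R)
    {k : ℕ} (hk : 0 < k) : specAt s y (powerSum k) = ∑ i ∈ s, y i ^ k := by
  have : ((k.toPNat' : ℕ+) : ℕ) = k := by rw [Nat.toPNat'_coe, if_pos hk]
  simp [specAt, powerSum, this]

/-- The product of the `h_{α_i}` in terms of power sums: a form of the Cauchy identity. -/
theorem prod_completeSym {ι : Type*} [Fintype ι] [DecidableEq ι] (α : ι →₀ ℕ) :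
    ∏ i, completeSym (α i) =
      ∑ s ∈ partsFinset (∑ i, α i), ((zPart s : ℂ)⁻¹ *
        coeff α (specAt Finset.univ (X : ι → MvPolynomial ι ℂ) (powerSumProd s))) •
          powerSumProd s := by
  -- Work with polynomials in the `x_i` over `Λ`: `ψ i` is `P_k ↦ x_i^k P_k`, and their sum `φ` on
  -- power sums has the Cauchy kernel as its generating series.
  let ψ : ι → SymFun →ₐ[ℂ] MvPolynomial ι SymFun :=
    fun i => aeval fun k => (X i : MvPolynomial ι SymFun) ^ (k : ℕ) * C (X k)
  let Cψ : SymFun →ₐ[ℂ] MvPolynomial ι SymFun := IsScalarTower.toAlgHom ℂ SymFun _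
  let φ : SymFun →ₐ[ℂ] MvPolynomial ι SymFun :=
    aeval fun k => ∑ i, (X i : MvPolynomial ι SymFun) ^ (k : ℕ) * C (X k)
  have hk' : ∀ {k : ℕ}, 0 < k → ((k.toPNat' : ℕ+) : ℕ) = k := fun {k} hk => by
    rw [Nat.toPNat'_coe, if_pos hk]
  have hψ : ∀ i n, ψ i (completeSym n) = X i ^ n * C (completeSym n) := by
    intro i n
    have := map_completeSym_of_homogeneous (φ := ψ i) (ψ := Cψ) (y := X i) (fun k hk => by
      simp [ψ, Cψ, powerSum, hk' hk, MvPolynomial.algebraMap_eq]) n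
    rw [this]
    rfl
  have hφψ : hSeries φ = ∏ i, hSeries (ψ i) := hSeries_prod _ _ fun k hk => by
    simp [φ, ψ, powerSum]
  -- Compare the coefficients of `t^{|α|} x^α`. In the product of the series of the `ψ i`, only the
  -- choice of degree `α i` in each factor yields `x^α`.
  have h1 := congrArg (fun f => coeff α (PowerSeries.coeff (∑ i, α i) f)) hφψ
  simp only [PowerSeries.coeff_prod, hSeries, PowerSeries.coeff_mk, hψ] at h1
  rw [coeff_sum] at h1
  have h2 : ∀ l ∈ Finset.finsuppAntidiag Finset.univ (∑ i, α i),
      coeff α (∏ i, ((X i : MvPolynomial ι SymFun) ^ l i * C (completeSym (l i)))) =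
        if l = α then ∏ i, completeSym (α i) else 0 := by
    intro l _
    rw [Finset.prod_mul_distrib, ← map_prod, mul_comm, coeff_C_mul]
    have : (∏ i, (X i : MvPolynomial ι SymFun) ^ l i) = monomial l 1 := by
      rw [monomial_eq, C_1, one_mul, Finsupp.prod_fintype _ _ (fun i => pow_zero _)]
    rw [this, coeff_monomial]
    split_ifs with h
    · rw [h, mul_one]
    · rw [mul_zero]
  rw [Finset.sum_congr rfl h2, Finset.sum_ite_eq', if_pos (by
    rw [Finset.mem_finsuppAntidiag]; exact ⟨rfl, Finset.subset_univ _⟩)] at h1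
  rw [← h1, map_completeSym, coeff_sum]
  refine Finset.sum_congr rfl fun s hs => ?_
  obtain ⟨hpos, hsum⟩ := mem_partsFinset.1 hs
  have h3 : (s.map fun k => φ (powerSum k)).prod =
      MvPolynomial.map (C : ℂ →+* SymFun) (specAt Finset.univ (X : ι → MvPolynomial ι ℂ)
        (powerSumProd s)) * C (powerSumProd s) := by
    have h4 : (s.map fun k => φ (powerSum k)) = s.map fun k =>
        MvPolynomial.map (C : ℂ →+* SymFun)
          (specAt Finset.univ (X : ι → MvPolynomial ι ℂ) (powerSum k)) * C (powerSum k) := by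
      refine Multiset.map_congr rfl fun k hk => ?_
      rw [specAt_powerSum _ _ (hpos k hk)]
      simp [φ, powerSum, hk' (hpos k hk), Finset.sum_mul]
    rw [h4, Multiset.prod_map_mul, map_powerSumProd, map_multiset_prod, Multiset.map_map]
    congr 1
    rw [powerSumProd, map_multiset_prod, Multiset.map_map]
    rfl
  rw [h3, coeff_smul, mul_comm, coeff_C_mul, coeff_map, mul_smul]
  congr 1
  rw [mul_comm, MvPolynomial.C_mul']

end Cauchy

/-! ## Cycle types -/

/-- The subgroup of permutations `p` with `f ∘ p = f`. -/
def fixer {α β : Type*} (f : α → β) : Subgroup (Equiv.Perm α) where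
  carrier := {p | ∀ x, f (p x) = f x}
  one_mem' := fun _ => rfl
  mul_mem' := fun {p q} hp hq x => (hp (q x)).trans (hq x)
  inv_mem' := fun {p} hp x => by
    have := hp (p⁻¹ x)
    simpa using this.symm

theorem mem_fixer {α β : Type*} {f : α → β} {p : Equiv.Perm α} :
    p ∈ fixer f ↔ ∀ x, f (p x) = f x := Iff.rfl

section Cycles
variable {α : Type*} [Fintype α] [DecidableEq α]

-- The classes of `SameCycle` are the cycles, including the trivial ones, whereas `cycleType`
-- forgets fixed points. The classes are therefore split by whether a representative is moved: the
-- moved ones match the cycle factors, the others are singletons.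
open Classical in
theorem prod_sameCycle_classes {M : Type*} [CommMonoid M] (g : Equiv.Perm α) (φ : ℕ → M) :
    ∏ q : Quotient (Equiv.Perm.SameCycle.setoid g),
      φ (Finset.univ.filter fun x : α => (Quotient.mk _ x : Quotient
        (Equiv.Perm.SameCycle.setoid g)) = q).card = (g.partition.parts.map φ).prod := by
  have hout : ∀ (q : Quotient (Equiv.Perm.SameCycle.setoid g)) (x : α),
      (Quotient.mk _ x : Quotient (Equiv.Perm.SameCycle.setoid g)) = q ↔
        g.SameCycle q.out x := by
    intro q x
    conv_lhs => rw [← Quotient.out_eq q]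
    rw [Quotient.eq]
    exact ⟨fun h => Equiv.Perm.SameCycle.symm h, fun h => Equiv.Perm.SameCycle.symm h⟩
  rw [Equiv.Perm.parts_partition, Multiset.map_add, Multiset.prod_add, Multiset.map_replicate,
    Multiset.prod_replicate, Equiv.Perm.cycleType_def, Multiset.map_map,
    ← Finset.prod_filter_mul_prod_filter_not Finset.univ
      (fun q : Quotient (Equiv.Perm.SameCycle.setoid g) => q.out ∈ g.support)]
  congr 1
  · change _ = ∏ c ∈ g.cycleFactorsFinset, φ c.support.card
    refine Finset.prod_bij (fun q _ => g.cycleOf q.out) ?_ ?_ ?_ ?_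
    · intro q hq
      rw [Finset.mem_filter] at hq
      exact Equiv.Perm.cycleOf_mem_cycleFactorsFinset_iff.2 hq.2
    · intro q hq r hr h
      rw [Finset.mem_filter] at hq hr
      have h1 : r.out ∈ (g.cycleOf r.out).support :=
        Equiv.Perm.mem_support_cycleOf_iff.2 ⟨Equiv.Perm.SameCycle.refl _ _, hr.2⟩
      rw [← h, Equiv.Perm.mem_support_cycleOf_iff] at h1
      have h2 := (hout q r.out).2 h1.1
      rw [Quotient.out_eq] at h2
      exact h2.symm
    · intro c hc
      have hcyc := (Equiv.Perm.mem_cycleFactorsFinset_iff.1 hc).1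
      obtain ⟨x, hx⟩ := hcyc.nonempty_support
      have hcx : c = g.cycleOf x := Equiv.Perm.cycle_is_cycleOf hx hc
      have hxg : x ∈ g.support := Equiv.Perm.mem_cycleFactorsFinset_support_le hc hx
      have hs := (hout (Quotient.mk _ x) x).1 rfl
      refine ⟨Quotient.mk _ x, ?_, ?_⟩
      · rw [Finset.mem_filter, Equiv.Perm.mem_support]
        refine ⟨Finset.mem_univ _, fun h => Equiv.Perm.mem_support.1 hxg ?_⟩
        exact (Equiv.Perm.SameCycle.apply_eq_self_iff hs).1 h
      · rw [hcx]
        exact Equiv.Perm.SameCycle.cycleOf_eq hs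
    · intro q hq
      rw [Finset.mem_filter] at hq
      congr 2
      ext x
      rw [Finset.mem_filter, Equiv.Perm.mem_support_cycleOf_iff, hout]
      exact ⟨fun h => ⟨h.2, hq.2⟩, fun h => ⟨Finset.mem_univ _, h.1⟩⟩
  · have hself : ∀ q ∈ Finset.univ.filter (fun q : Quotient (Equiv.Perm.SameCycle.setoid g) =>
        ¬ q.out ∈ g.support), φ (Finset.univ.filter fun x : α => (Quotient.mk _ x : Quotient
        (Equiv.Perm.SameCycle.setoid g)) = q).card = φ 1 := by
      intro q hq
      rw [Finset.mem_filter, Equiv.Perm.notMem_support] at hq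
      congr 1
      rw [Finset.card_eq_one]
      refine ⟨q.out, ?_⟩
      ext x
      rw [Finset.mem_filter, Finset.mem_singleton, hout]
      refine ⟨fun h => ?_, fun h => ⟨Finset.mem_univ _, h ▸ Equiv.Perm.SameCycle.refl _ _⟩⟩
      obtain ⟨k, hk⟩ := h.2
      rw [← hk]
      exact Equiv.Perm.zpow_apply_eq_self_of_apply_eq_self hq.2 k
    rw [Finset.prod_congr rfl hself, Finset.prod_const]
    congr 1
    rw [← Finset.card_compl]
    refine Finset.card_bij (fun q _ => q.out) ?_ ?_ ?_
    · intro q hq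
      rw [Finset.mem_filter] at hq
      exact Finset.mem_compl.2 hq.2
    · intro q _ r _ h
      rw [← Quotient.out_eq q, ← Quotient.out_eq r, h]
    · intro x hx
      rw [Finset.mem_compl, Equiv.Perm.notMem_support] at hx
      obtain ⟨k, hk⟩ := ((hout (Quotient.mk _ x) x).1 rfl).symm
      rw [Equiv.Perm.zpow_apply_eq_self_of_apply_eq_self hx k] at hk
      refine ⟨Quotient.mk _ x, ?_, hk.symm⟩
      rw [Finset.mem_filter, Equiv.Perm.notMem_support, ← hk]
      exact ⟨Finset.mem_univ _, hx⟩

open Classical in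
/-- Colourings fixed by `g`, weighted by their content. -/
theorem sum_fixed_colourings {R ι : Type*} [CommRing R] [Fintype ι] (g : Equiv.Perm α)
    (y : ι → R) :
    ∑ f ∈ Finset.univ.filter (fun f : α → ι => g ∈ fixer f), ∏ x, y (f x) =
      (g.partition.parts.map fun k => ∑ i, y i ^ k).prod := by
  rw [← prod_sameCycle_classes g, Finset.prod_univ_sum, Fintype.piFinset_univ]
  symm
  refine Finset.sum_bij (fun F _ x => F (Quotient.mk _ x)) ?_ ?_ ?_ ?_
  · intro F _
    rw [Finset.mem_filter]
    refine ⟨Finset.mem_univ _, fun x => congrArg F ?_⟩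
    exact Quotient.sound ⟨-1, by simp⟩
  · intro F _ G _ h
    funext q
    induction q using Quotient.inductionOn with
    | _ x => exact congrFun h x
  · intro f hf
    rw [Finset.mem_filter] at hf
    refine ⟨Quotient.lift f ?_, Finset.mem_univ _, rfl⟩
    rintro a b ⟨k, rfl⟩
    exact ((fixer f).zpow_mem hf.2 k a).symm
  · intro F _
    rw [← Finset.prod_fiberwise Finset.univ
      (fun x : α => (Quotient.mk _ x : Quotient (Equiv.Perm.SameCycle.setoid g)))]
    refine Finset.prod_congr rfl fun q _ => ?_
    rw [← Finset.prod_const]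
    refine Finset.prod_congr rfl fun x hx => ?_
    exact congrArg (fun q => y (F q)) (Finset.mem_filter.1 hx).2.symm

end Cycles

/-! ### Class sizes, permutation characters and Frobenius images. -/

/-- The cycle type of a permutation, fixed points included. -/
abbrev cyc {n : ℕ} (g : Equiv.Perm (Fin n)) : Multiset ℕ := (Equiv.Perm.partition g).parts

theorem cyc_mem_partsFinset {n : ℕ} (g : Equiv.Perm (Fin n)) : cyc g ∈ partsFinset n := by
  rw [mem_partsFinset]
  exact ⟨fun i hi => (Equiv.Perm.partition g).parts_pos hi, by
    rw [(Equiv.Perm.partition g).parts_sum, Fintype.card_fin]⟩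

theorem cyc_eq_iff_isConj {n : ℕ} {g h : Equiv.Perm (Fin n)} : cyc g = cyc h ↔ IsConj g h := by
  rw [Equiv.Perm.partition_eq_of_isConj]
  exact ⟨fun H => Nat.Partition.ext H, fun H => by rw [cyc, H]⟩

/-- The class size is `n! / Z_s`. The count by `cycleType` sees only the parts at least `2`,
collected in `m`; the ones supply the factor `(n - m.sum)!`. -/
theorem card_cyc_eq_mul_zPart {n : ℕ} {s : Multiset ℕ} (hs : s ∈ partsFinset n) :
    (Finset.univ.filter fun g : Equiv.Perm (Fin n) => cyc g = s).card * zPart s =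
      n.factorial := by
  obtain ⟨hpos, hsum⟩ := mem_partsFinset.1 hs
  set m := s.filter (2 ≤ ·) with hm
  set a := s.count 1 with ha
  have hs' : s = m + Multiset.replicate a 1 := by
    rw [ha, ← Multiset.filter_eq']
    conv_lhs => rw [← Multiset.filter_add_not (2 ≤ ·) s]
    congr 1
    refine Multiset.filter_congr fun i hi => ?_
    have := hpos i hi
    omega
  have hm2 : ∀ i ∈ m, 2 ≤ i := fun i hi => (Multiset.mem_filter.1 hi).2
  have hsum' : m.sum + a = n := by
    rw [← hsum]
    conv_rhs => rw [hs']
    simp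
  have h1 : (Finset.univ.filter fun g : Equiv.Perm (Fin n) => cyc g = s) =
      Finset.univ.filter fun g : Equiv.Perm (Fin n) => g.cycleType = m := by
    ext g
    simp only [Finset.mem_filter, Finset.mem_univ, true_and]
    constructor
    · intro h
      rw [← Equiv.Perm.filter_parts_partition_eq_cycleType, hm, ← h]
    · intro h
      rw [cyc, Equiv.Perm.parts_partition, ← Equiv.Perm.sum_cycleType, h, hs', Fintype.card_fin]
      congr 2
      omega
  have h2 : zPart s = (n - m.sum).factorial * m.prod *
      ∏ i ∈ m.toFinset, (m.count i).factorial := by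
    have h1m : 1 ∉ m.toFinset := fun h => by
      have := hm2 1 (Multiset.mem_toFinset.1 h)
      omega
    have hU : s.toFinset ⊆ insert 1 m.toFinset := by
      intro i hi
      rw [hs', Multiset.mem_toFinset, Multiset.mem_add] at hi
      rcases hi with hi | hi
      · exact Finset.mem_insert_of_mem (Multiset.mem_toFinset.2 hi)
      · rw [Multiset.eq_of_mem_replicate hi]
        exact Finset.mem_insert_self _ _
    rw [zPart_eq_prod hU, Finset.prod_insert h1m, one_pow, mul_one, mul_assoc]
    have h3 : s.count 1 = n - m.sum := by omega
    rw [h3, Finset.prod_multiset_count m, mul_comm (∏ i ∈ m.toFinset, i ^ _),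
      ← Finset.prod_mul_distrib]
    congr 1
    refine Finset.prod_congr rfl fun i hi => ?_
    have hi2 := hm2 i (Multiset.mem_toFinset.1 hi)
    rw [hs', Multiset.count_add, Multiset.count_replicate, if_neg (by omega), add_zero]
  have h4 := Equiv.Perm.card_of_cycleType_mul_eq (Fin n) m
  rw [Fintype.card_fin, if_pos ⟨by omega, hm2⟩] at h4
  rw [h1, h2, h4]

theorem sum_perm_eq_sum_partsFinset {V : Type*} [AddCommGroup V] [Module ℂ V] (n : ℕ)
    (F : Multiset ℕ → V) :
    ∑ g : Equiv.Perm (Fin n), F (cyc g) =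
      ∑ s ∈ partsFinset n, ((n.factorial : ℂ) * (zPart s : ℂ)⁻¹) • F s := by
  rw [← Finset.sum_fiberwise_of_maps_to (s := Finset.univ) (t := partsFinset n) (g := cyc)
    (fun g _ => cyc_mem_partsFinset g)]
  refine Finset.sum_congr rfl fun s hs => ?_
  have h0 : (zPart s : ℂ) ≠ 0 := by
    exact_mod_cast zPart_ne_zero (mem_partsFinset.1 hs).1
  rw [Finset.sum_congr rfl (g := fun _ => F s) (fun g hg => by rw [(Finset.mem_filter.1 hg).2]),
    Finset.sum_const, ← card_cyc_eq_mul_zPart hs, ← Nat.cast_smul_eq_nsmul ℂ]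
  congr 1
  push_cast
  field_simp

theorem exists_cyc_eq {n : ℕ} {s : Multiset ℕ} (hs : s ∈ partsFinset n) :
    ∃ g : Equiv.Perm (Fin n), cyc g = s := by
  by_contra! h
  have := card_cyc_eq_mul_zPart hs
  rw [Finset.filter_false_of_mem (fun g _ => h g), Finset.card_empty, zero_mul] at this
  exact n.factorial_ne_zero this.symm

theorem cyc_inv {n : ℕ} (g : Equiv.Perm (Fin n)) : cyc g⁻¹ = cyc g := by
  simp [cyc, Equiv.Perm.parts_partition]

/-- The content of a colouring. -/
def content {n : ℕ} {ι : Type*} (f : Fin n → ι) : ι →₀ ℕ := ∑ x, Finsupp.single (f x) 1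

open Classical in
theorem content_apply {n : ℕ} {ι : Type*} (f : Fin n → ι) (i : ι) :
    content f i = (Finset.univ.filter fun x => f x = i).card := by
  rw [content, Finsupp.finsetSum_apply, Finset.card_filter]
  exact Finset.sum_congr rfl fun x _ => Finsupp.single_apply

open Classical in
/-- The number of colourings of content `α` fixed by `g`. -/
def permChar {n : ℕ} {ι : Type*} [Fintype ι] (α : ι →₀ ℕ) (g : Equiv.Perm (Fin n)) : ℕ :=
  (Finset.univ.filter fun f : Fin n → ι => content f = α ∧ g ∈ fixer f).card

open Classical in
theorem specAt_cyc {n : ℕ} {ι R : Type*} [CommRing R] [Algebra ℂ R] [Fintype ι]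
    (g : Equiv.Perm (Fin n)) (y : ι → R) :
    specAt Finset.univ y (powerSumProd (cyc g)) =
      ∑ f ∈ Finset.univ.filter (fun f : Fin n → ι => g ∈ fixer f), ∏ x, y (f x) := by
  rw [sum_fixed_colourings, map_powerSumProd]
  congr 1
  exact Multiset.map_congr rfl fun k hk =>
    specAt_powerSum _ _ ((Equiv.Perm.partition g).parts_pos hk)

/-- A colouring is fixed by `g` exactly when it is constant on cycles, so `P_{cyc(g)}` in the
variables `x_i` enumerates the fixed colourings by content. -/
theorem coeff_specAt_cyc {n : ℕ} {ι : Type*} [Fintype ι] (α : ι →₀ ℕ)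
    (g : Equiv.Perm (Fin n)) :
    MvPolynomial.coeff α (specAt Finset.univ (MvPolynomial.X : ι → MvPolynomial ι ℂ)
      (powerSumProd (cyc g))) = permChar α g := by
  classical
  rw [specAt_cyc, MvPolynomial.coeff_sum]
  have h : ∀ f : Fin n → ι, ∏ x, (MvPolynomial.X (f x) : MvPolynomial ι ℂ) =
      MvPolynomial.monomial (content f) 1 := by
    intro f
    rw [content, MvPolynomial.monomial_sum_one]
    rfl
  simp only [h, MvPolynomial.coeff_monomial]
  rw [← Finset.sum_filter, Finset.filter_filter, Finset.sum_const, permChar, nsmul_eq_mul,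
    mul_one]
  congr 2
  ext f
  simp only [Finset.mem_filter, and_comm]

/-- The Frobenius image `(1 / n!) ∑_g β(g) P_{cyc(g)}` of a function on `S_n`. -/
def frob {n : ℕ} (β : Equiv.Perm (Fin n) → ℂ) : SymFun :=
  ∑ g, ((n.factorial : ℂ)⁻¹ * β g) • powerSumProd (cyc g)

/-- The Cauchy expansion, rewritten as a sum over permutations through the class sizes. It brings
symmetric group characters into the Jacobi–Trudi determinant. -/
theorem prod_completeSym_eq_frob {n : ℕ} {ι : Type*} [Fintype ι] (α : ι →₀ ℕ)
    (hα : ∑ i, α i = n) :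
    ∏ i, completeSym (α i) = frob (n := n) fun g => permChar α g := by
  classical
  subst hα
  rw [prod_completeSym, frob]
  have := sum_perm_eq_sum_partsFinset (∑ i, α i) fun s =>
    (((∑ i, α i).factorial : ℂ)⁻¹ * MvPolynomial.coeff α
      (specAt Finset.univ (MvPolynomial.X : ι → MvPolynomial ι ℂ) (powerSumProd s))) •
        powerSumProd s
  simp only [coeff_specAt_cyc] at this
  rw [this]
  refine Finset.sum_congr rfl fun s _ => ?_
  rw [smul_smul]
  congr 1
  have : ((∑ i, α i).factorial : ℂ) ≠ 0 := by exact_mod_cast Nat.factorial_ne_zero _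
  field_simp

/-! ## Jacobi–Trudi determinants -/

theorem completeSymInt_natCast (m : ℕ) : completeSymInt m = completeSym m := by
  simp [completeSymInt]

theorem completeSymInt_of_neg {m : ℤ} (h : m < 0) : completeSymInt m = 0 := by
  simp [completeSymInt, h]

/-- The class sizes `n! / Z_s` add up to `n!`. -/
theorem sum_inv_zPart (n : ℕ) : ∑ s ∈ partsFinset n, ((zPart s : ℂ)⁻¹) = 1 := by
  have h := sum_perm_eq_sum_partsFinset n (fun _ => (1 : ℂ))
  have h0 : (n.factorial : ℂ) ≠ 0 := by exact_mod_cast n.factorial_ne_zero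
  rw [Finset.sum_const, Finset.card_univ, Fintype.card_perm, Fintype.card_fin, nsmul_eq_mul,
    mul_one] at h
  simp only [smul_eq_mul, mul_one] at h
  rw [← Finset.mul_sum] at h
  exact mul_left_cancel₀ h0 (by rw [← h, mul_one])

section Flag
variable {R : Type*} [CommRing R]

/-- The transition coefficients of `det_flag`. -/
def flagCoeff (y : ℕ → R) : ℕ → ℕ → R
  | 0, 0 => 1
  | 0, _ + 1 => 0
  | j + 1, 0 => -(y j * flagCoeff y j 0)
  | j + 1, k + 1 => flagCoeff y j k - y j * flagCoeff y j (k + 1)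

theorem flagCoeff_of_lt (y : ℕ → R) {j k : ℕ} (h : j < k) : flagCoeff y j k = 0 := by
  induction j generalizing k with
  | zero => obtain ⟨k, rfl⟩ := Nat.exists_eq_add_of_lt h; rw [Nat.zero_add]; rfl
  | succ j ih =>
    cases k with
    | zero => omega
    | succ k => rw [flagCoeff, ih (by omega), ih (by omega)]; ring

theorem flagCoeff_self (y : ℕ → R) (j : ℕ) : flagCoeff y j j = 1 := by
  induction j with
  | zero => rfl
  | succ j ih => rw [flagCoeff, ih, flagCoeff_of_lt y (Nat.lt_succ_self j)]; ring

/-- The recursion of `flagCoeff` is `hH` unrolled. The coefficients do not depend on the offset `a`,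
so they act as column operations on all rows at once. -/
theorem flag_expansion {H : ℕ → ℤ → R} {y : ℕ → R}
    (hH : ∀ j m, H j m - y j * H j (m - 1) = H (j + 1) m) (j L : ℕ) (h : j < L) (a : ℤ) :
    H j (a + j) = ∑ k ∈ Finset.range L, flagCoeff y j k * H 0 (a + k) := by
  induction j generalizing L a with
  | zero =>
    obtain ⟨L, rfl⟩ := Nat.exists_eq_add_of_lt h
    rw [Finset.sum_range_succ', Finset.sum_eq_zero]
    · simp [flagCoeff]
    · intro k _
      rw [flagCoeff, zero_mul]
  | succ j ih =>
    obtain ⟨L, rfl⟩ := Nat.exists_eq_add_of_lt (Nat.zero_lt_of_lt h)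
    rw [Nat.zero_add] at h ⊢
    rw [← hH, Finset.sum_range_succ']
    have h1 : a + ((j + 1 : ℕ) : ℤ) = (a + 1) + j := by push_cast; ring
    have h2 : a + 1 + (j : ℤ) - 1 = a + j := by ring
    rw [h1, h2, ih L (by omega) (a + 1), ih (L + 1) (by omega) a, Finset.sum_range_succ' _ L]
    simp only [flagCoeff, sub_mul, Finset.sum_sub_distrib]
    rw [mul_add, Finset.mul_sum]
    have h3 : ∀ k : ℕ, a + 1 + (k : ℤ) = a + ((k + 1 : ℕ) : ℤ) := fun k => by push_cast; ring
    simp only [h3]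
    simp only [mul_assoc]
    ring

/-- The two matrices differ by a unitriangular factor on the right. -/
theorem det_flag {H : ℕ → ℤ → R} {y : ℕ → R}
    (hH : ∀ j m, H j m - y j * H j (m - 1) = H (j + 1) m) {l : ℕ} (a : Fin l → ℤ) :
    (Matrix.of fun i j : Fin l => H 0 (a i + j)).det =
      (Matrix.of fun i j : Fin l => H j (a i + j)).det := by
  have h : (Matrix.of fun i j : Fin l => H j (a i + j)) =
      (Matrix.of fun i j : Fin l => H 0 (a i + j)) *
        Matrix.of fun k j : Fin l => flagCoeff y j k := by
    ext i j
    rw [Matrix.mul_apply]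
    simp only [Matrix.of_apply]
    rw [flag_expansion hH j l j.2, Finset.sum_range fun k => flagCoeff y j k * H 0 (a i + k)]
    exact Finset.sum_congr rfl fun k _ => mul_comm _ _
  have hU : (Matrix.of fun k j : Fin l => flagCoeff y j k).det = 1 := by
    have hT : (Matrix.of fun k j : Fin l => flagCoeff y j k).IsUpperTriangular :=
      fun k j hjk => flagCoeff_of_lt y hjk
    rw [Matrix.det_of_isUpperTriangular hT]
    simp [flagCoeff_self]
  rw [h, Matrix.det_mul, hU, mul_one]

variable [Algebra ℂ R]

theorem map_completeSym_of_pow {φ : SymFun →ₐ[ℂ] R} {y : R}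
    (h : ∀ k, 0 < k → φ (powerSum k) = y ^ k) (n : ℕ) : φ (completeSym n) = y ^ n := by
  rw [map_completeSym]
  have : ∀ s ∈ partsFinset n, ((zPart s : ℂ)⁻¹) • (s.map fun k => φ (powerSum k)).prod =
      ((zPart s : ℂ)⁻¹) • y ^ n := by
    intro s hs
    obtain ⟨hpos, hsum⟩ := mem_partsFinset.1 hs
    rw [Multiset.map_congr rfl fun k hk => h k (hpos k hk), prod_map_pow_eq_pow_sum, hsum]
  rw [Finset.sum_congr rfl this, ← Finset.sum_smul, sum_inv_zPart, one_smul]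

/-- Removing one variable from a specialization. -/
theorem map_completeSymInt_sub {φ φ' : SymFun →ₐ[ℂ] R} {y : R}
    (h : ∀ k, 0 < k → φ (powerSum k) = φ' (powerSum k) + y ^ k) (m : ℤ) :
    φ (completeSymInt m) - y * φ (completeSymInt (m - 1)) = φ' (completeSymInt m) := by
  let ψ : SymFun →ₐ[ℂ] R := MvPolynomial.aeval fun k => y ^ (k : ℕ)
  have hψ : ∀ k, 0 < k → ψ (powerSum k) = y ^ k := fun k hk => by
    have : ((k.toPNat' : ℕ+) : ℕ) = k := by rw [Nat.toPNat'_coe, if_pos hk]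
    simp [ψ, powerSum, this]
  have hs : hSeries φ = hSeries φ' * hSeries ψ := hSeries_add fun k hk => by rw [h k hk, hψ k hk]
  -- For a single variable `y` the generating series is geometric.
  have hg : hSeries ψ * (1 - PowerSeries.X * PowerSeries.C y) = 1 := by
    ext n
    rw [mul_sub, mul_one, map_sub, ← mul_assoc, PowerSeries.coeff_mul_C]
    cases n with
    | zero => simp [hSeries, map_completeSym_of_pow hψ]
    | succ n =>
      rw [PowerSeries.coeff_succ_mul_X]
      simp [hSeries, map_completeSym_of_pow hψ, PowerSeries.coeff_one, pow_succ]
  have hs' : hSeries φ * (1 - PowerSeries.X * PowerSeries.C y) = hSeries φ' := by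
    rw [hs, mul_assoc, hg, mul_one]
  rcases lt_or_ge m 0 with hm | hm
  · rw [completeSymInt_of_neg hm, completeSymInt_of_neg (by omega)]
    simp
  · obtain ⟨n, rfl⟩ := Int.eq_ofNat_of_zero_le hm
    have hc := congrArg (PowerSeries.coeff n) hs'
    rw [mul_sub, mul_one, map_sub, ← mul_assoc, PowerSeries.coeff_mul_C] at hc
    cases n with
    | zero =>
      rw [Nat.cast_zero, completeSymInt_of_neg (m := 0 - 1) (by omega)]
      simp [completeSymInt, completeSym_zero]
    | succ n =>
      rw [PowerSeries.coeff_succ_mul_X] at hc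
      simp only [hSeries, PowerSeries.coeff_mk] at hc
      have : ((n + 1 : ℕ) : ℤ) - 1 = (n : ℕ) := by push_cast; ring
      rw [this, completeSymInt_natCast, completeSymInt_natCast, ← hc]
      ring

/-- Column `j` may be evaluated with the variables `y 0, …, y (j - 1)` removed. This serves twice:
all variables equal to `1` give the content formula, and independent variables bound the monomials.
-/
theorem map_schur_flag {φ : ℕ → SymFun →ₐ[ℂ] R} {y : ℕ → R}
    (h : ∀ j k, 0 < k → φ j (powerSum k) = φ (j + 1) (powerSum k) + y j ^ k)
    (lam : YoungDiagram) :
    φ 0 (schur lam) = (Matrix.of fun i j : Fin (lam.colLen 0) =>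
      φ j (completeSymInt ((lam.rowLen i : ℤ) - (i : ℤ) + (j : ℤ)))).det := by
  rw [← det_flag (H := fun j m => φ j (completeSymInt m)) (y := y)
    (fun j m => map_completeSymInt_sub (h j) m) fun i => (lam.rowLen i : ℤ) - (i : ℤ),
    schur, AlgHom.map_det]
  rfl

end Flag

/-! ### Principal specialization -/

theorem prod_cells {M : Type*} [CommMonoid M] (lam : YoungDiagram) (F : ℕ × ℕ → M) :
    ∏ c ∈ lam.cells, F c =
      ∏ i ∈ Finset.range (lam.colLen 0), ∏ j ∈ Finset.range (lam.rowLen i), F (i, j) := by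
  refine Finset.prod_finset_product _ _ _ fun p => ?_
  rw [YoungDiagram.mem_cells, Finset.mem_range, Finset.mem_range,
    ← YoungDiagram.mem_iff_lt_rowLen, ← YoungDiagram.mem_iff_lt_colLen]
  exact ⟨fun h => ⟨lam.up_left_mem le_rfl (Nat.zero_le _) h, h⟩, fun h => h.2⟩

/-- This is `h_n` at `M + 1` variables equal to `1`, the coefficient of `t^n` in `(1 - t)^{-(M+1)}`.
-/
theorem map_completeSym_of_const {φ : SymFun →ₐ[ℂ] ℂ} {M : ℕ}
    (h : ∀ k, 0 < k → φ (powerSum k) = (M : ℂ) + 1) (n : ℕ) :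
    φ (completeSym n) = ((M + n).choose M : ℂ) := by
  let ψ : SymFun →ₐ[ℂ] ℂ := MvPolynomial.aeval fun _ => 1
  have hψ : hSeries ψ = PowerSeries.mk 1 := by
    ext n
    simp only [hSeries, PowerSeries.coeff_mk]
    rw [map_completeSym_of_pow (y := 1) (fun k _ => by simp [ψ, powerSum])]
    simp
  have h1 : hSeries φ = ∏ _i ∈ Finset.range (M + 1), hSeries ψ :=
    hSeries_prod _ _ fun k hk => by rw [h k hk]; simp [ψ, powerSum]
  rw [Finset.prod_const, Finset.card_range, hψ, PowerSeries.mk_one_pow_eq_mk_choose_add] at h1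
  simpa [hSeries] using congrArg (PowerSeries.coeff n) h1

/-- With `N - j` variables in column `j`, the entries become `(N-1-i+λ_i)! / ((N-1-j)! (λ_i-i+j)!)`.
Row and column factors come out of the determinant and combine to the product over contents; the
rest is independent of `N`. Its value `K` is not needed here, because a leading coefficient fixes it
later. -/
theorem exists_schur_principal (lam : YoungDiagram) : ∃ K : ℂ, ∀ N : ℕ, lam.colLen 0 ≤ N →
    MvPolynomial.aeval (fun _ : ℕ+ => (N : ℂ)) (schur lam) =
      K * ∏ c ∈ lam.cells, ((N : ℂ) + ((c.2 : ℂ) - (c.1 : ℂ))) := by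
  -- The convention `1 / m! = 0` for `m < 0` matches `h_m = 0`.
  let invf : ℤ → ℂ := fun m => if 0 ≤ m then ((m.toNat.factorial : ℂ))⁻¹ else 0
  refine ⟨(Matrix.of fun i j : Fin (lam.colLen 0) =>
    invf ((lam.rowLen i : ℤ) - (i : ℤ) + (j : ℤ))).det, fun N hN => ?_⟩
  let φ : ℕ → SymFun →ₐ[ℂ] ℂ := fun j => MvPolynomial.aeval fun _ => (N : ℂ) - j
  have hφ := map_schur_flag (φ := φ) (y := fun _ => 1)
    (fun j k _ => by simp [φ, powerSum]; ring) lam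
  have h0 : φ 0 = MvPolynomial.aeval (fun _ : ℕ+ => (N : ℂ)) := by simp [φ]
  rw [h0] at hφ
  have hentry : (Matrix.of fun i j : Fin (lam.colLen 0) =>
      φ j (completeSymInt ((lam.rowLen i : ℤ) - (i : ℤ) + (j : ℤ)))) =
      Matrix.of fun i j : Fin (lam.colLen 0) =>
        ((N - 1 - i + lam.rowLen i).factorial : ℂ) *
          (Matrix.of fun i j : Fin (lam.colLen 0) => (((N - 1 - j).factorial : ℂ))⁻¹ *
            (Matrix.of fun i j : Fin (lam.colLen 0) =>
              invf ((lam.rowLen i : ℤ) - (i : ℤ) + (j : ℤ))) i j) i j := by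
    ext i j
    simp only [Matrix.of_apply]
    have hi := i.2
    have hj := j.2
    rcases lt_or_ge ((lam.rowLen i : ℤ) - (i : ℤ) + (j : ℤ)) 0 with hm | hm
    · rw [completeSymInt_of_neg hm]
      simp [invf, hm]
    · obtain ⟨m, hm'⟩ := Int.eq_ofNat_of_zero_le hm
      rw [hm']
      have hN1 : ((N - 1 - (j : ℕ) : ℕ) : ℂ) + 1 = N - (j : ℕ) := by
        have : N = (N - 1 - (j : ℕ)) + 1 + j := by omega
        conv_rhs => rw [this]
        push_cast
        ring
      change φ j (completeSymInt (m : ℤ)) = _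
      rw [completeSymInt_natCast, map_completeSym_of_const (M := N - 1 - j) (fun k _ => by
        rw [hN1]; simp [φ, powerSum]), Nat.choose_symm_add, Nat.add_choose]
      have h1 : N - 1 - (i : ℕ) + lam.rowLen i = N - 1 - j + m := by omega
      rw [h1, Nat.cast_div (Nat.factorial_mul_factorial_dvd_factorial_add _ _)
        (by exact_mod_cast (Nat.mul_ne_zero (Nat.factorial_ne_zero _) (Nat.factorial_ne_zero _)))]
      simp [invf]
      rw [div_eq_mul_inv, mul_inv]
  rw [hφ, hentry, Matrix.det_mul_column, Matrix.det_mul_row, prod_cells,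
    Finset.prod_range fun i => ∏ j ∈ Finset.range (lam.rowLen i), ((N : ℂ) + ((j : ℂ) - (i : ℂ))),
    ← mul_assoc, ← Finset.prod_mul_distrib, mul_comm]
  congr 1
  refine Finset.prod_congr rfl fun i _ => ?_
  have hi := i.2
  have h1 : ((N - 1 - i + lam.rowLen i).factorial : ℂ) = ((N - 1 - i).factorial : ℂ) *
      ∏ j ∈ Finset.range (lam.rowLen i), ((N : ℂ) + ((j : ℂ) - ((i : ℕ) : ℂ))) := by
    rw [← Nat.factorial_mul_ascFactorial, Nat.ascFactorial_eq_prod_range]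
    push_cast
    congr 1
    refine Finset.prod_congr rfl fun j _ => ?_
    have : N = (N - 1 - (i : ℕ)) + 1 + i := by omega
    conv_rhs => rw [this]
    push_cast
    ring
  have h2 : ((N - 1 - i).factorial : ℂ) ≠ 0 := by exact_mod_cast Nat.factorial_ne_zero _
  rw [h1]
  field_simp

/-! ### Triangularity -/

/-- `λ_1 + ⋯ + λ_k`. -/
def rowSum (lam : YoungDiagram) (k : ℕ) : ℕ := ∑ i ∈ Finset.range k, lam.rowLen i

/-- Exchange argument: the elements of `S` outside the initial segment are as many as the missing
ones, and `l k` separates their values. -/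
theorem sum_le_sum_range_card {l : ℕ → ℤ} (hl : Antitone l) (S : Finset ℕ) :
    ∑ i ∈ S, l i ≤ ∑ i ∈ Finset.range S.card, l i := by
  classical
  set k := S.card
  rw [← Finset.sum_inter_add_sum_sdiff S (Finset.range k),
    ← Finset.sum_inter_add_sum_sdiff (Finset.range k) S, Finset.inter_comm]
  refine add_le_add le_rfl ?_
  have hc : (S \ Finset.range k).card = (Finset.range k \ S).card := by
    have h1 := Finset.card_sdiff_add_card_inter S (Finset.range k)
    have h2 := Finset.card_sdiff_add_card_inter (Finset.range k) S
    rw [Finset.inter_comm, Finset.card_range] at h2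
    omega
  calc ∑ i ∈ S \ Finset.range k, l i ≤ (S \ Finset.range k).card • l k :=
        Finset.sum_le_card_nsmul _ _ _ fun i hi => hl (by simpa using (Finset.mem_sdiff.1 hi).2)
    _ = (Finset.range k \ S).card • l k := by rw [hc]
    _ ≤ ∑ i ∈ Finset.range k \ S, l i := Finset.card_nsmul_le_sum _ _ _ fun i hi =>
        hl (by have := Finset.mem_range.1 (Finset.mem_sdiff.1 hi).1; omega)

section Support
open MvPolynomial
variable {ι : Type*}

/-- The polynomials all of whose monomials have weight at most `d`. -/
def weightLE (w : (ι →₀ ℕ) →+ ℕ) (d : ℕ) : Submodule ℂ (MvPolynomial ι ℂ) :=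
  restrictSupport ℂ {ν | w ν ≤ d}

theorem mem_weightLE {w : (ι →₀ ℕ) →+ ℕ} {d : ℕ} {p : MvPolynomial ι ℂ} :
    p ∈ weightLE w d ↔ ∀ ν, coeff ν p ≠ 0 → w ν ≤ d := by
  rw [weightLE, mem_restrictSupport_iff]
  exact ⟨fun h ν hν => h (mem_support_iff.2 hν), fun h ν hν => h ν (mem_support_iff.1 hν)⟩

theorem mul_mem_weightLE {w : (ι →₀ ℕ) →+ ℕ} {d e : ℕ} {p q : MvPolynomial ι ℂ}
    (hp : p ∈ weightLE w d) (hq : q ∈ weightLE w e) : p * q ∈ weightLE w (d + e) := by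
  classical
  rw [mem_weightLE] at *
  intro ν hν
  obtain ⟨x, hx, h⟩ := Finset.exists_ne_zero_of_sum_ne_zero (by rwa [coeff_mul] at hν)
  rw [Finset.HasAntidiagonal.mem_antidiagonal] at hx
  rw [← hx, map_add]
  exact add_le_add (hp _ (left_ne_zero_of_mul h)) (hq _ (right_ne_zero_of_mul h))

theorem one_mem_weightLE (w : (ι →₀ ℕ) →+ ℕ) : (1 : MvPolynomial ι ℂ) ∈ weightLE w 0 := by
  classical
  rw [mem_weightLE]
  intro ν hν
  rw [coeff_one] at hν
  have : (0 : ι →₀ ℕ) = ν := by by_contra h; simp [h] at hν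
  rw [← this, map_zero]

theorem multiset_prod_mem_weightLE {w : (ι →₀ ℕ) →+ ℕ} {s : Multiset ℕ} {e : ℕ → ℕ}
    {F : ℕ → MvPolynomial ι ℂ} (h : ∀ k ∈ s, F k ∈ weightLE w (e k)) :
    (s.map F).prod ∈ weightLE w (s.map e).sum := by
  induction s using Multiset.induction_on with
  | empty => simpa using one_mem_weightLE w
  | cons a s ih =>
    simp only [Multiset.map_cons, Multiset.prod_cons, Multiset.sum_cons]
    exact mul_mem_weightLE (h a (Multiset.mem_cons_self a s))
      (ih fun k hk => h k (Multiset.mem_cons_of_mem hk))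

theorem prod_mem_weightLE {κ : Type*} {w : (ι →₀ ℕ) →+ ℕ} (s : Finset κ) {e : κ → ℕ}
    {F : κ → MvPolynomial ι ℂ} (h : ∀ k ∈ s, F k ∈ weightLE w (e k)) :
    ∏ k ∈ s, F k ∈ weightLE w (∑ k ∈ s, e k) := by
  classical
  induction s using Finset.induction_on with
  | empty => simpa using one_mem_weightLE w
  | insert a s ha ih =>
    rw [Finset.prod_insert ha, Finset.sum_insert ha]
    exact mul_mem_weightLE (h a (Finset.mem_insert_self a s))
      (ih fun k hk => h k (Finset.mem_insert_of_mem hk))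

theorem completeSym_mem_weightLE {w : (ι →₀ ℕ) →+ ℕ} {φ : SymFun →ₐ[ℂ] MvPolynomial ι ℂ}
    {a : ℕ} (h : ∀ k, 0 < k → φ (powerSum k) ∈ weightLE w (a * k)) (n : ℕ) :
    φ (completeSym n) ∈ weightLE w (a * n) := by
  rw [map_completeSym]
  refine Submodule.sum_mem _ fun s hs => Submodule.smul_mem _ _ ?_
  obtain ⟨hpos, hsum⟩ := mem_partsFinset.1 hs
  have := multiset_prod_mem_weightLE (w := w) (s := s) (e := fun k => a * k)
    (F := fun k => φ (powerSum k)) fun k hk => h k (hpos k hk)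
  rwa [Multiset.sum_map_mul_left, Multiset.map_id', hsum] at this

/-- The sum of the first `k` exponents. -/
def headWeight (r k : ℕ) : (Fin r →₀ ℕ) →+ ℕ where
  toFun ν := ∑ i ∈ Finset.univ.filter (fun i : Fin r => (i : ℕ) < k), ν i
  map_zero' := by simp
  map_add' := fun a b => by simp [Finset.sum_add_distrib]

theorem X_pow_mem_weightLE (r k j n : ℕ) (i : Fin r) (hi : j ≤ i) :
    (X i : MvPolynomial (Fin r) ℂ) ^ n ∈ weightLE (headWeight r k)
      ((if j < k then 1 else 0) * n) := by
  classical
  rw [mem_weightLE]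
  intro ν hν
  rw [coeff_X_pow] at hν
  have : Finsupp.single i n = ν := by by_contra h; simp [h] at hν
  rw [← this]
  change ∑ i' ∈ Finset.univ.filter (fun i : Fin r => (i : ℕ) < k), (Finsupp.single i n) i' ≤ _
  simp only [Finsupp.single_apply]
  rw [Finset.sum_ite_eq]
  split_ifs with h1 h2 h2
  · simp
  · simp only [Finset.mem_filter, Finset.mem_univ, true_and] at h1
    omega
  · simp
  · simp

/-- The monomials of a Schur polynomial are dominated by the partition. -/
theorem sum_le_rowSum_of_coeff_schur_ne_zero {r : ℕ} (lam : YoungDiagram) (ν : Fin r →₀ ℕ)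
    (h : coeff ν (specAt Finset.univ (X : Fin r → MvPolynomial (Fin r) ℂ) (schur lam)) ≠ 0)
    (k : ℕ) : headWeight r k ν ≤ rowSum lam k := by
  classical
  suffices hm : specAt Finset.univ (X : Fin r → MvPolynomial (Fin r) ℂ) (schur lam) ∈
      weightLE (headWeight r k) (rowSum lam k) from mem_weightLE.1 hm ν h
  -- Column `j` uses only the variables `x_i` with `i ≥ j`, so columns `j ≥ k` contribute nothing to
  -- the degree in the first `k` variables.
  let φ : ℕ → SymFun →ₐ[ℂ] MvPolynomial (Fin r) ℂ := fun j =>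
    specAt (Finset.univ.filter fun i : Fin r => j ≤ i) X
  let y : ℕ → MvPolynomial (Fin r) ℂ := fun j => if h : j < r then X ⟨j, h⟩ else 0
  have hφ : ∀ j k, 0 < k → φ j (powerSum k) = φ (j + 1) (powerSum k) + y j ^ k := by
    intro j k hk
    simp only [φ, specAt_powerSum _ _ hk]
    by_cases hj : j < r
    · have : (Finset.univ.filter fun i : Fin r => j ≤ i) =
          insert ⟨j, hj⟩ (Finset.univ.filter fun i : Fin r => j + 1 ≤ i) := by
        ext i
        simp only [Finset.mem_filter, Finset.mem_univ, true_and, Finset.mem_insert, Fin.ext_iff]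
        omega
      rw [this, Finset.sum_insert (by simp), add_comm]
      simp [y, hj]
    · have h1 : ∀ a, j ≤ a → (Finset.univ.filter fun i : Fin r => a ≤ i) = ∅ := by
        intro a ha
        ext i
        have := i.2
        simp
        omega
      rw [h1 j le_rfl, h1 (j + 1) (by omega)]
      simp [y, hj, hk.ne']
  have h0 : φ 0 = specAt Finset.univ X := by simp [φ]
  rw [← h0, map_schur_flag hφ, Matrix.det_apply]
  refine Submodule.sum_mem _ fun τ _ => ?_
  rw [Units.smul_def, ← Int.cast_smul_eq_zsmul ℂ]
  refine Submodule.smul_mem _ _ ?_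
  simp only [Matrix.of_apply]
  by_cases hneg : ∃ j : Fin (lam.colLen 0), (lam.rowLen (τ j) : ℤ) - (τ j : ℕ) + (j : ℕ) < 0
  · obtain ⟨j, hj⟩ := hneg
    rw [Finset.prod_eq_zero (Finset.mem_univ j)
      (by rw [completeSymInt_of_neg hj, map_zero])]
    exact Submodule.zero_mem _
  push Not at hneg
  have hmem : ∀ j ∈ (Finset.univ : Finset (Fin (lam.colLen 0))),
      φ j (completeSymInt ((lam.rowLen (τ j) : ℤ) - (τ j : ℕ) + (j : ℕ))) ∈
        weightLE (headWeight r k) ((if (j : ℕ) < k then 1 else 0) *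
          ((lam.rowLen (τ j) : ℤ) - (τ j : ℕ) + (j : ℕ)).toNat) := by
    intro j _
    rw [completeSymInt, if_pos (hneg j)]
    refine completeSym_mem_weightLE (fun m hm => ?_) _
    rw [specAt_powerSum _ _ hm]
    exact Submodule.sum_mem _ fun i hi => X_pow_mem_weightLE r k j m i (Finset.mem_filter.1 hi).2
  have hprod := prod_mem_weightLE Finset.univ hmem
  refine mem_weightLE.2 fun ν hν => (mem_weightLE.1 hprod ν hν).trans ?_
  simp only [ite_mul, one_mul, zero_mul]
  rw [← Finset.sum_filter]
  set J := Finset.univ.filter fun j : Fin (lam.colLen 0) => (j : ℕ) < k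
  rw [← Nat.cast_le (α := ℤ), Nat.cast_sum, Finset.sum_congr rfl fun j _ => Int.toNat_of_nonneg (hneg j), Finset.sum_add_distrib]
  -- The columns `j < k` contribute degree at most `∑ (l (τ j) + j)`. Since `l` is antitone, this is
  -- largest when the rows `τ j` are the first ones, and then the shifts cancel.
  let l : ℕ → ℤ := fun i => (lam.rowLen i : ℤ) - i
  have hl : Antitone l := fun a b hab => by
    have := lam.rowLen_anti a b hab
    simp only [l]
    omega
  let e : Fin (lam.colLen 0) ↪ ℕ := Fin.valEmbedding
  have h1 : ∑ j ∈ J, ((lam.rowLen (τ j) : ℤ) - (τ j : ℕ)) = ∑ i ∈ J.map (τ.toEmbedding.trans e),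
      l i := by rw [Finset.sum_map]; rfl
  have h2 : J.map e = Finset.range J.card := by
    have h3 : J.map e = Finset.range (min k (lam.colLen 0)) := by
      ext i
      simp only [Finset.mem_map, J, Finset.mem_filter, Finset.mem_univ, true_and,
        Finset.mem_range, lt_min_iff, e, Fin.valEmbedding_apply]
      exact ⟨fun ⟨j, hj, hji⟩ => hji ▸ ⟨hj, j.2⟩, fun ⟨a, b⟩ => ⟨⟨i, b⟩, a, rfl⟩⟩
    have h4 := congrArg Finset.card h3
    rw [Finset.card_map, Finset.card_range] at h4
    rw [h3, h4]
  have h3 : ∑ j ∈ J, ((j : ℕ) : ℤ) = ∑ i ∈ Finset.range J.card, (i : ℤ) := by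
    rw [← h2, Finset.sum_map]; rfl
  have h4 := sum_le_sum_range_card hl (J.map (τ.toEmbedding.trans e))
  rw [Finset.card_map] at h4
  have hJk : J.card ≤ k := by
    have h5 := congrArg (fun s => s ⊆ Finset.range k) h2
    simp only [Finset.range_subset_range, eq_iff_iff] at h5
    refine h5.1 fun i hi => ?_
    obtain ⟨j, hj, rfl⟩ := Finset.mem_map.1 hi
    exact Finset.mem_range.2 (Finset.mem_filter.1 hj).2
  rw [h1, h3]
  calc _ ≤ ∑ i ∈ Finset.range J.card, l i + ∑ i ∈ Finset.range J.card, (i : ℤ) := by gcongr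
    _ = ∑ i ∈ Finset.range J.card, (lam.rowLen i : ℤ) := by
      rw [← Finset.sum_add_distrib]
      simp [l]
    _ ≤ ∑ i ∈ Finset.range k, (lam.rowLen i : ℤ) :=
      Finset.sum_le_sum_of_subset_of_nonneg (Finset.range_subset_range.2 hJk)
        fun _ _ _ => by positivity
    _ = _ := by rw [rowSum]; push_cast; rfl

end Support

/-! ## Tableaux -/

/-- A bijective labelling of the cells of `λ` by `Fin n`. -/
structure IsTableau {n : ℕ} (lam : YoungDiagram) (T : Fin n → ℕ × ℕ) : Prop where
  injective : Function.Injective T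
  mem_iff : ∀ c, c ∈ lam ↔ ∃ x, T x = c

theorem isTableau_tableauCell (lam : YoungDiagram) : IsTableau lam (tableauCell lam) where
  injective := fun _ _ h => lam.cells.equivFin.symm.injective (Subtype.ext h)
  mem_iff := fun c => by
    constructor
    · intro h
      exact ⟨lam.cells.equivFin ⟨c, h⟩, by simp [tableauCell]⟩
    · rintro ⟨x, rfl⟩
      exact (lam.cells.equivFin.symm x).2

namespace IsTableau
variable {n : ℕ} {lam : YoungDiagram} {T : Fin n → ℕ × ℕ}

theorem mem (hT : IsTableau lam T) (x : Fin n) : T x ∈ lam := (hT.mem_iff _).2 ⟨x, rfl⟩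

theorem card_filter (hT : IsTableau lam T) (P : ℕ × ℕ → Prop) [DecidablePred P] :
    (Finset.univ.filter fun x => P (T x)).card = (lam.cells.filter P).card := by
  refine Finset.card_bij (fun x _ => T x) ?_ (fun _ _ _ _ h => hT.injective h) ?_
  · intro x hx
    exact Finset.mem_filter.2 ⟨hT.mem x, (Finset.mem_filter.1 hx).2⟩
  · intro c hc
    rw [Finset.mem_filter] at hc
    obtain ⟨x, rfl⟩ := (hT.mem_iff c).1 hc.1
    exact ⟨x, by simpa using hc.2, rfl⟩

theorem card_row (hT : IsTableau lam T) (i : ℕ) :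
    (Finset.univ.filter fun x => (T x).1 = i).card = lam.rowLen i := by
  rw [hT.card_filter fun c => c.1 = i, YoungDiagram.rowLen_eq_card]
  rfl

theorem card_col (hT : IsTableau lam T) (j : ℕ) :
    (Finset.univ.filter fun x => (T x).2 = j).card = lam.colLen j := by
  rw [hT.card_filter fun c => c.2 = j, YoungDiagram.colLen_eq_card]
  rfl

theorem card_row_lt (hT : IsTableau lam T) (k : ℕ) :
    (Finset.univ.filter fun x => (T x).1 < k).card = rowSum lam k := by
  rw [rowSum, Finset.card_eq_sum_card_fiberwise (t := Finset.range k) (f := fun x => (T x).1)]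
  · refine Finset.sum_congr rfl fun i hi => ?_
    rw [← hT.card_row i, Finset.filter_filter]
    congr 1
    ext x
    simp only [Finset.mem_filter, Finset.mem_univ, true_and]
    rw [Finset.mem_range] at hi
    omega
  · intro x hx
    simpa using hx

end IsTableau

theorem card_range_filter_lt (a b : ℕ) :
    ((Finset.range a).filter fun i => i < b).card = min a b := by
  have : (Finset.range a).filter (fun i => i < b) = Finset.range (min a b) := by
    ext i
    simp
  rw [this, Finset.card_range]

theorem card_filter_fst_lt (lam : YoungDiagram) (k j : ℕ) :
    ((lam.cells.filter fun c => c.1 < k).filter fun c => c.2 = j).card =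
      min k (lam.colLen j) := by
  rw [min_comm, ← card_range_filter_lt]
  refine Finset.card_bij (fun c _ => c.1) ?_ ?_ ?_
  · rintro ⟨a, b⟩ h
    simp only [Finset.mem_filter, YoungDiagram.mem_cells, YoungDiagram.mem_iff_lt_colLen,
      Finset.mem_range] at h ⊢
    obtain ⟨⟨h1, h2⟩, rfl⟩ := h
    exact ⟨h1, h2⟩
  · rintro ⟨a, b⟩ h ⟨a', b'⟩ h' e
    simp only [Finset.mem_filter] at h h'
    ext
    · exact e
    · exact h.2.trans h'.2.symm
  · intro a ha
    simp only [Finset.mem_filter, Finset.mem_range] at ha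
    exact ⟨(a, j), by simp [YoungDiagram.mem_iff_lt_colLen, ha], rfl⟩

theorem card_filter_snd_lt (lam : YoungDiagram) (k i : ℕ) :
    ((lam.cells.filter fun c => c.2 < k).filter fun c => c.1 = i).card =
      min k (lam.rowLen i) := by
  rw [← YoungDiagram.colLen_transpose, ← card_filter_fst_lt]
  refine Finset.card_bij (fun c _ => c.swap) ?_ (fun _ _ _ _ h => Prod.swap_injective h) ?_
  · rintro ⟨a, b⟩ h
    simpa using h
  · rintro ⟨a, b⟩ h
    exact ⟨(b, a), by simpa using h, rfl⟩

/-! ### Rows against columns: dominance and the factorization `g = p q`. -/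

section Counting
variable {n : ℕ} {lam : YoungDiagram} {T : Fin n → ℕ × ℕ}

/-- If the rows of `f` meet the columns of a tableau of shape `λ` at most once each, then `f` is
dominated by `λ`. -/
theorem card_lt_le_rowSum (hT : IsTableau lam T) (f : Fin n → ℕ) (g : Equiv.Perm (Fin n))
    (hf : Function.Injective fun x => (f x, (T (g x)).2)) (k : ℕ) :
    (Finset.univ.filter fun x => f x < k).card ≤ rowSum lam k := by
  have hcells : ∀ x, (T x).2 ∈ Finset.range (lam.rowLen 0) := fun x => by
    rw [Finset.mem_range, ← YoungDiagram.mem_iff_lt_rowLen]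
    exact lam.up_left_mem (Nat.zero_le _) le_rfl (hT.mem x)
  rw [← hT.card_row_lt, hT.card_filter fun c => c.1 < k,
    Finset.card_eq_sum_card_fiberwise (t := Finset.range (lam.rowLen 0))
      (f := fun x => (T (g x)).2) (fun x _ => hcells _),
    Finset.card_eq_sum_card_fiberwise (s := lam.cells.filter _)
      (t := Finset.range (lam.rowLen 0)) (f := fun c => c.2)]
  -- In column `j`, the points with `f x < k` have distinct values of `f`, so there are at most `min
  -- k (colLen j)` of them. This is the number of cells of the column in the first `k` rows.
  · refine Finset.sum_le_sum fun j _ => ?_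
    rw [card_filter_fst_lt]
    refine le_min ?_ ?_
    · rw [← Finset.card_range k]
      refine Finset.card_le_card_of_injOn f ?_ ?_
      · intro x hx
        simp only [Finset.coe_filter, Finset.mem_filter, Finset.mem_univ, true_and] at hx
        simpa using hx.1
      · intro x hx y hy h
        simp only [Finset.coe_filter, Finset.mem_filter, Finset.mem_univ, true_and] at hx hy
        exact hf (Prod.ext h (hx.2.trans hy.2.symm))
    · rw [← hT.card_col]
      refine Finset.card_le_card_of_injOn g ?_ g.injective.injOn
      intro x hx
      simp only [Finset.coe_filter, Finset.mem_filter, Finset.mem_univ, true_and] at hx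
      simpa using hx.2
  · intro c hc
    simp only [Finset.coe_filter] at hc
    obtain ⟨x, rfl⟩ := (hT.mem_iff c).1 hc.1
    exact hcells x

/-- The combinatorial lemma behind Young symmetrizers. -/
theorem exists_eq_mul_of_injective (hT : IsTableau lam T) (g : Equiv.Perm (Fin n))
    (hg : Function.Injective fun x => ((T x).1, (T (g⁻¹ x)).2)) :
    ∃ p ∈ fixer (fun x => (T x).1), ∃ q ∈ fixer (fun x => (T x).2), g = p * q := by
  have hrow : ∀ x, (T x).1 ∈ Finset.range (lam.colLen 0) := fun x => by
    rw [Finset.mem_range, ← YoungDiagram.mem_iff_lt_colLen]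
    exact lam.up_left_mem le_rfl (Nat.zero_le _) (hT.mem x)
  have hle : ∀ k, ∀ i ∈ Finset.range (lam.colLen 0),
      ((Finset.univ.filter fun x => (T (g⁻¹ x)).2 < k).filter fun x => (T x).1 = i).card ≤
        min k (lam.rowLen i) := by
    intro k i _
    refine le_min ?_ ?_
    · rw [← Finset.card_range k]
      refine Finset.card_le_card_of_injOn (fun x => (T (g⁻¹ x)).2) ?_ ?_
      · intro x hx
        simp only [Finset.coe_filter, Finset.mem_filter, Finset.mem_univ, true_and] at hx
        simpa using hx.1
      · intro x hx y hy h
        simp only [Finset.coe_filter, Finset.mem_filter, Finset.mem_univ, true_and] at hx hy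
        exact hg (Prod.ext (hx.2.trans hy.2.symm) h)
    · rw [← hT.card_row]
      refine Finset.card_le_card fun x hx => ?_
      simp only [Finset.mem_filter, Finset.mem_univ, true_and] at hx ⊢
      exact hx.2
  -- Summed over all rows, the bounds `hle` are attained, because permuting by `g` does not change
  -- how many labels lie in the first `k` columns. Hence each `hle` is an equality.
  have hsum : ∀ k, ∑ i ∈ Finset.range (lam.colLen 0),
      ((Finset.univ.filter fun x => (T (g⁻¹ x)).2 < k).filter fun x => (T x).1 = i).card =
        ∑ i ∈ Finset.range (lam.colLen 0), min k (lam.rowLen i) := by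
    intro k
    rw [← Finset.card_eq_sum_card_fiberwise (fun x _ => hrow x)]
    have h1 : (Finset.univ.filter fun x => (T (g⁻¹ x)).2 < k).card =
        (Finset.univ.filter fun x => (T x).2 < k).card := by
      refine Finset.card_bij (fun x _ => g⁻¹ x) ?_ (fun _ _ _ _ h => g⁻¹.injective h) ?_
      · intro x hx
        simpa using hx
      · intro x hx
        exact ⟨g x, by simpa using hx, by simp⟩
    rw [h1, hT.card_filter fun c => c.2 < k,
      Finset.card_eq_sum_card_fiberwise (t := Finset.range (lam.colLen 0)) (f := fun c => c.1)]
    · exact Finset.sum_congr rfl fun i _ => card_filter_snd_lt lam k i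
    · intro c hc
      simp only [Finset.coe_filter] at hc
      obtain ⟨x, rfl⟩ := (hT.mem_iff c).1 hc.1
      exact hrow x
  have hmem : ∀ x, ((T x).1, (T (g⁻¹ x)).2) ∈ lam := by
    intro x
    rw [YoungDiagram.mem_iff_lt_rowLen]
    -- Taking `k` to be the length of the row of `x`, equality says that every label of this row has
    -- its new column inside the row.
    have h1 := (Finset.sum_eq_sum_iff_of_le (hle (lam.rowLen (T x).1))).1 (hsum _) _ (hrow x)
    rw [min_self, ← hT.card_row] at h1
    have h2 := Finset.eq_of_subset_of_card_le (s := (Finset.univ.filter fun y =>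
      (T (g⁻¹ y)).2 < (Finset.univ.filter fun z => (T z).1 = (T x).1).card).filter
        fun y => (T y).1 = (T x).1) (t := Finset.univ.filter fun z => (T z).1 = (T x).1)
        (fun y hy => by simpa using (Finset.mem_filter.1 hy).2) h1.ge
    have h3 : x ∈ Finset.univ.filter fun z => (T z).1 = (T x).1 := by simp
    rw [← h2, Finset.mem_filter, Finset.mem_filter] at h3
    rw [← hT.card_row]
    exact h3.1.2
  choose s hs using fun x => (hT.mem_iff _).1 (hmem x)
  have hsinj : Function.Injective s := fun x y h => hg (by
    change ((T x).1, (T (g⁻¹ x)).2) = ((T y).1, (T (g⁻¹ y)).2)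
    rw [← hs, ← hs, h])
  -- The map `p` slides each label along its row into the column that `g⁻¹` prescribes, so `p`
  -- preserves rows and `p * g` preserves columns.
  let p := Equiv.ofBijective s (Finite.injective_iff_bijective.1 hsinj)
  have hp : ∀ x, T (p x) = ((T x).1, (T (g⁻¹ x)).2) := hs
  have hpr : p ∈ fixer (fun x => (T x).1) := fun x => by
    have := congrArg Prod.fst (hp x)
    exact this
  refine ⟨p⁻¹, (fixer _).inv_mem hpr, p * g, fun x => ?_, by group⟩
  rw [Equiv.Perm.mul_apply]
  refine (congrArg Prod.snd (hp (g x))).trans ?_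
  simp

end Counting

/-! ## Young symmetrizers -/

section GroupAlgebra
variable {n : ℕ}

theorem coeff_permElt_mul (g h : Equiv.Perm (Fin n)) (x : GroupAlg n) :
    (permElt g * x).coeff h = x.coeff (g⁻¹ * h) := by
  rw [permElt, MonoidAlgebra.of_apply, MonoidAlgebra.coeff_single_mul_apply, one_mul]

theorem coeff_mul_permElt (g h : Equiv.Perm (Fin n)) (x : GroupAlg n) :
    (x * permElt g).coeff h = x.coeff (h * g⁻¹) := by
  rw [permElt, MonoidAlgebra.of_apply, MonoidAlgebra.coeff_mul_single_apply, mul_one]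

theorem permElt_mul_permElt (g h : Equiv.Perm (Fin n)) :
    (permElt g * permElt h : GroupAlg n) = permElt (g * h) := (map_mul _ _ _).symm

theorem coeff_sum_smul_permElt (F : Equiv.Perm (Fin n) → ℂ) (h : Equiv.Perm (Fin n)) :
    (∑ g, F g • permElt g : GroupAlg n).coeff h = F h := by
  classical
  rw [MonoidAlgebra.coeff_sum, Finsupp.finsetSum_apply]
  simp [permElt, MonoidAlgebra.of_apply, Finsupp.single_apply]

theorem sum_coeff_smul_permElt (x : GroupAlg n) : ∑ g, x.coeff g • permElt g = x := by
  refine MonoidAlgebra.ext (Finsupp.ext fun h => ?_)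
  rw [coeff_sum_smul_permElt]

open Classical in
/-- The sum of the permutations preserving `f`. -/
def rowSym {ι : Type*} (f : Fin n → ι) : GroupAlg n :=
  ∑ p : Equiv.Perm (Fin n), if p ∈ fixer f then permElt p else 0

open Classical in
/-- The signed sum of the permutations preserving `f`. -/
def colSym {ι : Type*} (f : Fin n → ι) : GroupAlg n :=
  ∑ q : Equiv.Perm (Fin n),
    if q ∈ fixer f then ((Equiv.Perm.sign q : ℤ) : ℂ) • permElt q else 0

theorem permElt_mul_rowSym {ι : Type*} {f : Fin n → ι} {p : Equiv.Perm (Fin n)}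
    (hp : p ∈ fixer f) : permElt p * rowSym f = rowSym f := by
  classical
  rw [rowSym, Finset.mul_sum]
  refine Fintype.sum_equiv (Equiv.mulLeft p) _ _ fun g => ?_
  simp only [Equiv.coe_mulLeft, (fixer f).mul_mem_cancel_left hp, mul_ite, mul_zero,
    permElt_mul_permElt]

theorem rowSym_mul_permElt {ι : Type*} {f : Fin n → ι} {p : Equiv.Perm (Fin n)}
    (hp : p ∈ fixer f) : rowSym f * permElt p = rowSym f := by
  classical
  rw [rowSym, Finset.sum_mul]
  refine Fintype.sum_equiv (Equiv.mulRight p) _ _ fun g => ?_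
  simp only [Equiv.coe_mulRight, (fixer f).mul_mem_cancel_right hp, ite_mul, zero_mul,
    permElt_mul_permElt]

theorem sign_mul_self_complex (q : Equiv.Perm (Fin n)) :
    ((Equiv.Perm.sign q : ℤ) : ℂ) * ((Equiv.Perm.sign q : ℤ) : ℂ) = 1 := by
  rw [← Int.cast_mul, ← Units.val_mul, Int.units_mul_self]
  simp

theorem permElt_mul_colSym {ι : Type*} {f : Fin n → ι} {q : Equiv.Perm (Fin n)}
    (hq : q ∈ fixer f) :
    permElt q * colSym f = ((Equiv.Perm.sign q : ℤ) : ℂ) • colSym f := by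
  classical
  rw [colSym, Finset.mul_sum, Finset.smul_sum]
  refine Fintype.sum_equiv (Equiv.mulLeft q) _ _ fun g => ?_
  simp only [Equiv.coe_mulLeft, (fixer f).mul_mem_cancel_left hq, mul_ite, mul_zero, smul_ite,
    smul_zero, mul_smul_comm, permElt_mul_permElt, smul_smul, Equiv.Perm.sign_mul, Units.val_mul,
    Int.cast_mul, ← mul_assoc, sign_mul_self_complex, one_mul]

theorem colSym_mul_permElt {ι : Type*} {f : Fin n → ι} {q : Equiv.Perm (Fin n)}
    (hq : q ∈ fixer f) :
    colSym f * permElt q = ((Equiv.Perm.sign q : ℤ) : ℂ) • colSym f := by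
  classical
  rw [colSym, Finset.sum_mul, Finset.smul_sum]
  refine Fintype.sum_equiv (Equiv.mulRight q) _ _ fun g => ?_
  simp only [Equiv.coe_mulRight, (fixer f).mul_mem_cancel_right hq, ite_mul, zero_mul, smul_ite,
    smul_zero, smul_mul_assoc, permElt_mul_permElt, smul_smul, Equiv.Perm.sign_mul, Units.val_mul,
    Int.cast_mul]
  rw [mul_left_comm, sign_mul_self_complex, mul_one]

theorem swap_mem_fixer {ι : Type*} {f : Fin n → ι} {x y : Fin n} (h : f x = f y) :
    Equiv.swap x y ∈ fixer f := by
  intro z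
  rw [Equiv.swap_apply_def]
  split_ifs with h1 h2
  · rw [h1, h]
  · rw [h2, h]
  · rfl

theorem eq_zero_of_eq_neg {x : GroupAlg n} (h : x = -x) : x = 0 := by
  have h2 : (2 : ℂ) • x = 0 := by rw [two_smul]; nth_rewrite 2 [h]; exact add_neg_cancel x
  exact (smul_eq_zero.1 h2).resolve_left two_ne_zero

/-- Two points on a common row and, after `g⁻¹`, in a common column give a transposition. The row
sum absorbs it with sign `+` and the column sum with sign `-`. -/
theorem rowSym_mul_permElt_mul_colSym {ι κ : Type*} (f : Fin n → ι) (c : Fin n → κ)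
    (g : Equiv.Perm (Fin n)) (h : ¬ Function.Injective fun x => (f x, c (g⁻¹ x))) :
    rowSym f * permElt g * colSym c = 0 := by
  simp only [Function.Injective, not_forall, Prod.mk.injEq] at h
  obtain ⟨x, y, ⟨h1, h2⟩, hxy⟩ := h
  refine eq_zero_of_eq_neg ?_
  have hsw : Equiv.swap x y * g = g * Equiv.swap (g⁻¹ x) (g⁻¹ y) := by
    rw [Equiv.swap_mul_eq_mul_swap]
  have hs : Equiv.Perm.sign (Equiv.swap (g⁻¹ x) (g⁻¹ y)) = -1 :=
    Equiv.Perm.sign_swap fun h => hxy (g⁻¹.injective h)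
  calc rowSym f * permElt g * colSym c
      = rowSym f * permElt (Equiv.swap x y) * permElt g * colSym c := by
        rw [rowSym_mul_permElt (swap_mem_fixer h1)]
    _ = rowSym f * permElt g * (permElt (Equiv.swap (g⁻¹ x) (g⁻¹ y)) * colSym c) := by
        rw [mul_assoc (rowSym f), permElt_mul_permElt, hsw, ← permElt_mul_permElt]
        simp only [mul_assoc]
    _ = -(rowSym f * permElt g * colSym c) := by
        rw [permElt_mul_colSym (swap_mem_fixer h2), hs]
        simp

theorem colSym_mul_permElt_mul_rowSym {ι κ : Type*} (f : Fin n → ι) (c : Fin n → κ)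
    (g : Equiv.Perm (Fin n)) (h : ¬ Function.Injective fun x => (f x, c (g x))) :
    colSym c * permElt g * rowSym f = 0 := by
  simp only [Function.Injective, not_forall, Prod.mk.injEq] at h
  obtain ⟨x, y, ⟨h1, h2⟩, hxy⟩ := h
  refine eq_zero_of_eq_neg ?_
  have hsw : g * Equiv.swap x y = Equiv.swap (g x) (g y) * g := by
    rw [Equiv.mul_swap_eq_swap_mul]
  have hs : Equiv.Perm.sign (Equiv.swap (g x) (g y)) = -1 :=
    Equiv.Perm.sign_swap fun h => hxy (g.injective h)
  calc colSym c * permElt g * rowSym f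
      = colSym c * permElt g * (permElt (Equiv.swap x y) * rowSym f) := by
        rw [permElt_mul_rowSym (swap_mem_fixer h1)]
    _ = colSym c * permElt (Equiv.swap (g x) (g y)) * (permElt g * rowSym f) := by
        rw [← mul_assoc, mul_assoc (colSym c), permElt_mul_permElt, hsw, ← permElt_mul_permElt]
        simp only [mul_assoc]
    _ = -(colSym c * permElt g * rowSym f) := by
        rw [colSym_mul_permElt (swap_mem_fixer h2), hs]
        simp [mul_assoc]

theorem exists_injective_of_rowSym_mul_mul_colSym_ne_zero {ι κ : Type*} {f : Fin n → ι}
    {c : Fin n → κ} {x : GroupAlg n} (h : rowSym f * x * colSym c ≠ 0) :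
    ∃ g : Equiv.Perm (Fin n), Function.Injective fun x => (f x, c (g x)) := by
  by_contra! hg
  refine h ?_
  rw [← sum_coeff_smul_permElt x, Finset.mul_sum, Finset.sum_mul]
  refine Finset.sum_eq_zero fun g _ => ?_
  rw [mul_smul_comm, smul_mul_assoc, rowSym_mul_permElt_mul_colSym f c g (hg g⁻¹), smul_zero]

theorem exists_injective_of_colSym_mul_mul_rowSym_ne_zero {ι κ : Type*} {f : Fin n → ι}
    {c : Fin n → κ} {x : GroupAlg n} (h : colSym c * x * rowSym f ≠ 0) :
    ∃ g : Equiv.Perm (Fin n), Function.Injective fun x => (f x, c (g x)) := by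
  by_contra! hg
  refine h ?_
  rw [← sum_coeff_smul_permElt x, Finset.mul_sum, Finset.sum_mul]
  refine Finset.sum_eq_zero fun g _ => ?_
  rw [mul_smul_comm, smul_mul_assoc, colSym_mul_permElt_mul_rowSym f c g (hg g), smul_zero]

theorem coeff_colSym {ι : Type*} (f : Fin n → ι) (g : Equiv.Perm (Fin n)) :
    (colSym f).coeff g =
      (by classical exact if g ∈ fixer f then ((Equiv.Perm.sign g : ℤ) : ℂ) else 0) := by
  classical
  have : colSym f = ∑ q : Equiv.Perm (Fin n),
      (if q ∈ fixer f then ((Equiv.Perm.sign q : ℤ) : ℂ) else 0) • permElt q := by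
    rw [colSym]
    exact Finset.sum_congr rfl fun q _ => by rw [ite_smul, zero_smul]
  rw [this, coeff_sum_smul_permElt]

/-- The Young symmetrizer of a labelling. -/
def symmetrizer (T : Fin n → ℕ × ℕ) : GroupAlg n :=
  rowSym (fun x => (T x).1) * colSym fun x => (T x).2

/-- A permutation preserving both rows and columns fixes every cell, so the identity arises only
from `p = q = 1`. -/
theorem coeff_symmetrizer_one {T : Fin n → ℕ × ℕ} (hT : Function.Injective T) :
    (symmetrizer T).coeff 1 = 1 := by
  classical
  rw [symmetrizer, rowSym, Finset.sum_mul, MonoidAlgebra.coeff_sum, Finsupp.finsetSum_apply,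
    Finset.sum_eq_single 1]
  · rw [if_pos (one_mem _), coeff_permElt_mul, coeff_colSym, if_pos (by
      rw [inv_one, mul_one]; exact one_mem _)]
    simp
  · intro p _ hp
    split_ifs with h
    · rw [coeff_permElt_mul, coeff_colSym, if_neg]
      rw [mul_one]
      intro h2
      refine hp (Equiv.ext fun x => hT (Prod.ext (h x) ?_))
      have := (fixer _).inv_mem h2 x
      rwa [inv_inv] at this
    · simp
  · simp

/-- An element transforming like the Young symmetrizer and with vanishing coefficient at `1`
vanishes. -/
theorem eq_zero_of_transform {lam : YoungDiagram} {T : Fin n → ℕ × ℕ} (hT : IsTableau lam T)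
    {y : GroupAlg n} (hr : ∀ p ∈ fixer (fun x => (T x).1), permElt p * y = y)
    (hc : ∀ q ∈ fixer (fun x => (T x).2),
      y * permElt q = ((Equiv.Perm.sign q : ℤ) : ℂ) • y) (h1 : y.coeff 1 = 0) : y = 0 := by
  refine MonoidAlgebra.ext (Finsupp.ext fun g => ?_)
  change y.coeff g = 0
  have hr' : ∀ p ∈ fixer (fun x => (T x).1), ∀ g, y.coeff (p * g) = y.coeff g := by
    intro p hp g
    have := congrArg (fun z => z.coeff (p * g)) (hr p hp)
    simp only [coeff_permElt_mul, inv_mul_cancel_left] at this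
    exact this.symm
  have hc' : ∀ q ∈ fixer (fun x => (T x).2), ∀ g,
      y.coeff (g * q) = ((Equiv.Perm.sign q : ℤ) : ℂ) * y.coeff g := by
    intro q hq g
    have := congrArg (fun z => z.coeff (g * q)) (hc q hq)
    simp only [coeff_mul_permElt, mul_inv_cancel_right, MonoidAlgebra.coeff_smul_apply,
      smul_eq_mul] at this
    rw [this, ← mul_assoc, sign_mul_self_complex, one_mul]
  -- Either `g = p q`, and the coefficient is the one at `1` up to sign, or a transposition shows
  -- that the coefficient equals its negative.
  by_cases hg : Function.Injective fun x => ((T x).1, (T (g⁻¹ x)).2)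
  · obtain ⟨p, hp, q, hq, rfl⟩ := exists_eq_mul_of_injective hT g hg
    rw [hr' p hp, ← one_mul q, hc' q hq, h1, mul_zero]
  · simp only [Function.Injective, not_forall, Prod.mk.injEq] at hg
    obtain ⟨x, y', ⟨e1, e2⟩, hxy⟩ := hg
    have hsw : Equiv.swap x y' * g = g * Equiv.swap (g⁻¹ x) (g⁻¹ y') := by
      rw [Equiv.swap_mul_eq_mul_swap]
    have hs : Equiv.Perm.sign (Equiv.swap (g⁻¹ x) (g⁻¹ y')) = -1 :=
      Equiv.Perm.sign_swap fun h => hxy (g⁻¹.injective h)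
    have h2 := hr' _ (swap_mem_fixer (f := fun x => (T x).1) e1) g
    rw [hsw, hc' _ (swap_mem_fixer (f := fun x => (T x).2) e2), hs] at h2
    simp only [Units.val_neg, Units.val_one, Int.cast_neg, Int.cast_one, neg_mul, one_mul] at h2
    linear_combination (-1 / 2 : ℂ) * h2

/-- Both sides have the same row and column symmetry, and the symmetrizer has coefficient `1` at the
identity. The scalar is thus the coefficient of the left side at `1`. -/
theorem rowSym_mul_mul_colSym {lam : YoungDiagram} {T : Fin n → ℕ × ℕ} (hT : IsTableau lam T)
    (x : GroupAlg n) : ∃ κ : ℂ,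
      rowSym (fun x => (T x).1) * x * colSym (fun x => (T x).2) = κ • symmetrizer T := by
  set y := rowSym (fun x => (T x).1) * x * colSym (fun x => (T x).2) with hy
  refine ⟨y.coeff 1, sub_eq_zero.1 (eq_zero_of_transform hT ?_ ?_ ?_)⟩
  · intro p hp
    rw [mul_sub, mul_smul_comm, hy, symmetrizer, ← mul_assoc, ← mul_assoc, ← mul_assoc,
      permElt_mul_rowSym hp]
  · intro q hq
    have h1 : y * permElt q = ((Equiv.Perm.sign q : ℤ) : ℂ) • y := by
      rw [hy, mul_assoc, colSym_mul_permElt hq, mul_smul_comm]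
    have h2 : symmetrizer T * permElt q = ((Equiv.Perm.sign q : ℤ) : ℂ) • symmetrizer T := by
      rw [symmetrizer, mul_assoc, colSym_mul_permElt hq, mul_smul_comm]
    rw [sub_mul, smul_mul_assoc, h1, h2, smul_sub, smul_comm]
  · rw [MonoidAlgebra.coeff_sub, Finsupp.sub_apply, MonoidAlgebra.coeff_smul_apply,
      coeff_symmetrizer_one hT.injective]
    simp

end GroupAlgebra

/-! ## Characters of Specht modules -/

section Characters
variable {n : ℕ}

/-- The left ideal generated by the Young symmetrizer of a labelling. -/
abbrev spechtIdeal (T : Fin n → ℕ × ℕ) : Ideal (GroupAlg n) := Ideal.span {symmetrizer T}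

/-- The character of the left ideal generated by a Young symmetrizer, extended linearly. -/
def spechtChar (T : Fin n → ℕ × ℕ) : GroupAlg n →ₗ[ℂ] ℂ :=
  LinearMap.trace ℂ (spechtIdeal T) ∘ₗ
    (Algebra.lsmul ℂ ℂ (spechtIdeal T) : GroupAlg n →ₐ[ℂ] _).toLinearMap

theorem youngSymmetrizer_eq (lam : YoungDiagram) :
    youngSymmetrizer lam = symmetrizer (tableauCell lam) := by
  simp only [youngSymmetrizer, symmetrizer, rowSym, colSym, mem_fixer]

theorem irrChar_eq (lam : YoungDiagram) (g : Equiv.Perm (Fin lam.card)) :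
    irrChar lam g = spechtChar (tableauCell lam) (permElt g) := by
  have key : ∀ I J : Ideal (GroupAlg lam.card), I = J →
      LinearMap.trace ℂ I (Algebra.lsmul ℂ ℂ I (permElt g)) =
        LinearMap.trace ℂ J (Algebra.lsmul ℂ ℂ J (permElt g)) := by
    rintro I _ rfl
    rfl
  exact key _ _ (by rw [spechtModule, youngSymmetrizer_eq])

/-! ### Characters as traces of two-sided multiplications. -/

/-- The trace of `x ↦ y x c` on the group algebra. -/
def traceLR (c : GroupAlg n) (y : GroupAlg n) : ℂ :=
  LinearMap.trace ℂ (GroupAlg n) (LinearMap.mulLeft ℂ y ∘ₗ LinearMap.mulRight ℂ c)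

theorem traceLR_eq (c y : GroupAlg n) : traceLR c y = ∑ g, (y * permElt g * c).coeff g := by
  classical
  rw [traceLR, LinearMap.trace_eq_matrix_trace ℂ (MonoidAlgebra.basis (Equiv.Perm (Fin n)) ℂ),
    Matrix.trace]
  refine Finset.sum_congr rfl fun g _ => ?_
  rw [Matrix.diag_apply, LinearMap.toMatrix_apply, MonoidAlgebra.basis_apply, mul_assoc]
  rfl

theorem traceLR_one (c : GroupAlg n) : traceLR c 1 = n.factorial * c.coeff 1 := by
  rw [traceLR_eq]
  have : ∀ g : Equiv.Perm (Fin n), (1 * permElt g * c).coeff g = c.coeff 1 := fun g => by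
    rw [one_mul, coeff_permElt_mul, inv_mul_cancel]
  simp only [this]
  rw [Finset.sum_const, Finset.card_univ, Fintype.card_perm, Fintype.card_fin, nsmul_eq_mul]

theorem traceLR_permElt_inv (c : GroupAlg n) (g : Equiv.Perm (Fin n)) :
    traceLR c (permElt g⁻¹) = ∑ x : Equiv.Perm (Fin n), c.coeff (x⁻¹ * g * x) := by
  rw [traceLR_eq]
  refine Finset.sum_congr rfl fun x _ => ?_
  rw [permElt_mul_permElt, coeff_permElt_mul]
  rw [mul_inv_rev, inv_inv, mul_assoc]

instance : Module.Finite ℂ (GroupAlg n) :=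
  Module.Finite.of_basis (MonoidAlgebra.basis (Equiv.Perm (Fin n)) ℂ)

/-- An operator whose image lies in a line has as trace its eigenvalue on that line. -/
theorem traceLR_of_range {c v y : GroupAlg n} {μ : ℂ} (hv : v ≠ 0)
    (hr : ∀ x, ∃ κ : ℂ, y * x * c = κ • v) (hμ : y * v * c = μ • v) : traceLR c y = μ := by
  have hf : ∀ x, (LinearMap.mulLeft ℂ y ∘ₗ LinearMap.mulRight ℂ c) x ∈
      Submodule.span ℂ {v} := by
    intro x
    obtain ⟨κ, hκ⟩ := hr x
    exact Submodule.mem_span_singleton.2 ⟨κ, by simp [← hκ, mul_assoc]⟩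
  rw [traceLR, ← LinearMap.trace_restrict_eq_of_forall_mem (Submodule.span ℂ {v}) _ hf]
  have : (LinearMap.mulLeft ℂ y ∘ₗ LinearMap.mulRight ℂ c).restrict (fun x _ => hf x) =
      μ • (LinearMap.id : Submodule.span ℂ {v} →ₗ[ℂ] Submodule.span ℂ {v}) := by
    ext ⟨x, hx⟩
    obtain ⟨a, rfl⟩ := Submodule.mem_span_singleton.1 hx
    simp only [LinearMap.coe_restrict_apply, LinearMap.comp_apply, LinearMap.mulLeft_apply,
      LinearMap.mulRight_apply, LinearMap.smul_apply, LinearMap.id_apply, Submodule.coe_smul]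
    rw [smul_mul_assoc, mul_smul_comm, ← mul_assoc, hμ, smul_comm]
  rw [this, map_smul, LinearMap.trace_id, finrank_span_singleton hv]
  simp

variable {lam mu : YoungDiagram} {T T' : Fin n → ℕ × ℕ}

/-- Right multiplication by the symmetrizer maps into the Specht ideal and acts there as `η`. The
trace on the whole algebra is therefore computed on the ideal. The case `η = 0` is included, and
`exists_symmetrizer_sq` uses it. -/
theorem traceLR_symmetrizer {η : ℂ} (hη : symmetrizer T * symmetrizer T = η • symmetrizer T)
    (y : GroupAlg n) : traceLR (symmetrizer T) y = η * spechtChar T y := by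
  have hf : ∀ x, (LinearMap.mulLeft ℂ y ∘ₗ LinearMap.mulRight ℂ (symmetrizer T)) x ∈
      (spechtIdeal T).restrictScalars ℂ := by
    intro x
    simp only [LinearMap.comp_apply, LinearMap.mulLeft_apply, LinearMap.mulRight_apply,
      Submodule.restrictScalars_mem]
    exact Ideal.mul_mem_left _ _ (Ideal.mul_mem_left _ _ (Ideal.mem_span_singleton_self _))
  rw [traceLR, ← LinearMap.trace_restrict_eq_of_forall_mem _ _ hf, ← smul_eq_mul, spechtChar,
    LinearMap.comp_apply, ← map_smul]
  congr 1
  ext ⟨x, hx⟩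
  obtain ⟨a, rfl⟩ := Ideal.mem_span_singleton'.1 hx
  simp only [LinearMap.coe_restrict_apply, LinearMap.comp_apply, LinearMap.mulLeft_apply,
    LinearMap.mulRight_apply]
  rw [mul_assoc, hη]
  simp only [mul_smul_comm]
  rfl

/-- If `η` were `0`, right multiplication by the symmetrizer would have trace zero, but its trace is
`n!` times the coefficient at `1`. -/
theorem exists_symmetrizer_sq (hT : IsTableau lam T) :
    ∃ η : ℂ, symmetrizer T * symmetrizer T = η • symmetrizer T ∧ η ≠ 0 := by
  obtain ⟨η, hη⟩ := rowSym_mul_mul_colSym hT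
    (colSym (fun x => (T x).2) * rowSym (fun x => (T x).1))
  have hη' : symmetrizer T * symmetrizer T = η • symmetrizer T := by
    rw [← hη, symmetrizer]
    simp only [mul_assoc]
  refine ⟨η, hη', ?_⟩
  rintro rfl
  have h := traceLR_symmetrizer hη' 1
  rw [traceLR_one, coeff_symmetrizer_one hT.injective, zero_mul, mul_one] at h
  exact n.factorial_ne_zero (by exact_mod_cast h)

theorem spechtChar_one_ne_zero (hT : IsTableau lam T) : spechtChar T 1 ≠ 0 := by
  obtain ⟨η, hη, -⟩ := exists_symmetrizer_sq hT
  intro h0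
  have h := traceLR_symmetrizer hη 1
  rw [traceLR_one, coeff_symmetrizer_one hT.injective, h0, mul_zero, mul_one] at h
  exact n.factorial_ne_zero (by exact_mod_cast h)

theorem symmetrizer_ne_zero (hT : IsTableau lam T) : symmetrizer T ≠ 0 := by
  intro h
  have := coeff_symmetrizer_one hT.injective
  rw [h] at this
  simp at this

theorem spechtChar_mul_comm (x y : GroupAlg n) : spechtChar T (x * y) = spechtChar T (y * x) := by
  simp only [spechtChar, LinearMap.comp_apply, AlgHom.toLinearMap_apply, map_mul]
  exact LinearMap.trace_mul_comm _ _ _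

theorem spechtChar_conj (h g : Equiv.Perm (Fin n)) :
    spechtChar T (permElt (h * g * h⁻¹)) = spechtChar T (permElt g) := by
  rw [← permElt_mul_permElt, spechtChar_mul_comm, permElt_mul_permElt, ← mul_assoc,
    inv_mul_cancel, one_mul]

theorem spechtChar_eq_of_cyc_eq {g h : Equiv.Perm (Fin n)} (hc : cyc g = cyc h) :
    spechtChar T (permElt g) = spechtChar T (permElt h) := by
  obtain ⟨x, hx⟩ := isConj_iff.1 (cyc_eq_iff_isConj.1 hc)
  rw [← hx, spechtChar_conj]

theorem spechtChar_eq_sum (x : GroupAlg n) :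
    spechtChar T x = ∑ g, x.coeff g * spechtChar T (permElt g) := by
  conv_lhs => rw [← sum_coeff_smul_permElt x, map_sum]
  exact Finset.sum_congr rfl fun g _ => by rw [map_smul, smul_eq_mul]

theorem rowSum_le_of_injective (hT : IsTableau lam T) (hT' : IsTableau mu T')
    {g : Equiv.Perm (Fin n)} (hg : Function.Injective fun x => ((T x).1, (T' (g x)).2)) (k : ℕ) :
    rowSum lam k ≤ rowSum mu k := by
  rw [← hT.card_row_lt]
  exact card_lt_le_rowSum hT' (fun x => (T x).1) g hg k

theorem eq_of_rowSum_eq (h : ∀ k, rowSum lam k = rowSum mu k) : lam = mu := by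
  have hr : ∀ i, lam.rowLen i = mu.rowLen i := fun i => by
    have h1 := h i
    have h2 := h (i + 1)
    simp only [rowSum, Finset.sum_range_succ] at h1 h2
    omega
  ext ⟨i, j⟩
  simp only [YoungDiagram.mem_cells, YoungDiagram.mem_iff_lt_rowLen, hr]

/-- If the product were nonzero, its outer and its inner row and column sums would give dominance in
both directions. -/
theorem symmetrizer_mul_mul_symmetrizer (hT : IsTableau lam T) (hT' : IsTableau mu T')
    (hne : lam ≠ mu) (x : GroupAlg n) : symmetrizer T' * x * symmetrizer T = 0 := by
  by_contra h
  have h1 : rowSym (fun x => (T' x).1) *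
      (colSym (fun x => (T' x).2) * x * rowSym (fun x => (T x).1)) *
        colSym (fun x => (T x).2) ≠ 0 := by
    simpa only [symmetrizer, mul_assoc] using h
  have h2 : colSym (fun x => (T' x).2) * x * rowSym (fun x => (T x).1) ≠ 0 := by
    intro h0
    rw [h0, mul_zero, zero_mul] at h1
    exact h1 rfl
  obtain ⟨g, hg⟩ := exists_injective_of_rowSym_mul_mul_colSym_ne_zero h1
  obtain ⟨g', hg'⟩ := exists_injective_of_colSym_mul_mul_rowSym_ne_zero h2
  exact hne (eq_of_rowSum_eq fun k =>
    le_antisymm (rowSum_le_of_injective hT hT' hg' k) (rowSum_le_of_injective hT' hT hg k))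

theorem spechtChar_symmetrizer_of_ne (hT : IsTableau lam T) (hT' : IsTableau mu T')
    (hne : lam ≠ mu) : spechtChar T (symmetrizer T') = 0 := by
  obtain ⟨η, hη, h0⟩ := exists_symmetrizer_sq hT
  have h := traceLR_symmetrizer hη (symmetrizer T')
  rw [traceLR_of_range (symmetrizer_ne_zero hT) (μ := 0)
    (fun x => ⟨0, by rw [symmetrizer_mul_mul_symmetrizer hT hT' hne, zero_smul]⟩)
    (by rw [symmetrizer_mul_mul_symmetrizer hT hT' hne, zero_smul])] at h
  exact (mul_eq_zero.1 h.symm).resolve_left h0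

theorem spechtChar_symmetrizer_self (hT : IsTableau lam T) {η : ℂ}
    (hη : symmetrizer T * symmetrizer T = η • symmetrizer T) (h0 : η ≠ 0) :
    spechtChar T (symmetrizer T) = η := by
  have h := traceLR_symmetrizer hη (symmetrizer T)
  have hr : ∀ x, ∃ κ : ℂ, symmetrizer T * x * symmetrizer T = κ • symmetrizer T := fun x => by
    obtain ⟨κ, hκ⟩ := rowSym_mul_mul_colSym hT
      (colSym (fun x => (T x).2) * x * rowSym (fun x => (T x).1))
    exact ⟨κ, by rw [← hκ, symmetrizer]; simp only [mul_assoc]⟩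
  rw [traceLR_of_range (symmetrizer_ne_zero hT) (μ := η * η) hr
    (by rw [hη, smul_mul_assoc, hη, smul_smul])] at h
  exact (mul_left_cancel₀ h0 h).symm

/-- The number `η χ_{T'}(g⁻¹)` is the sum of the coefficients of the symmetrizer of `T'` over
conjugates of `g`. Since `χ_T` is a class function, each conjugation contributes `χ_T` of that
symmetrizer, and orthogonality reduces to this one value. -/
theorem sum_spechtChar_mul_spechtChar_inv {η : ℂ}
    (hη : symmetrizer T' * symmetrizer T' = η • symmetrizer T') :
    η * ∑ g, spechtChar T (permElt g) * spechtChar T' (permElt g⁻¹) =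
      n.factorial * spechtChar T (symmetrizer T') := by
  have h1 : ∀ g : Equiv.Perm (Fin n), η * (spechtChar T (permElt g) *
      spechtChar T' (permElt g⁻¹)) = ∑ x : Equiv.Perm (Fin n),
        spechtChar T (permElt g) * (symmetrizer T').coeff (x⁻¹ * g * x) := by
    intro g
    rw [mul_left_comm, ← traceLR_symmetrizer hη, traceLR_permElt_inv, Finset.mul_sum]
  rw [Finset.mul_sum, Finset.sum_congr rfl fun g _ => h1 g, Finset.sum_comm]
  have h2 : ∀ x : Equiv.Perm (Fin n), ∑ g, spechtChar T (permElt g) *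
      (symmetrizer T').coeff (x⁻¹ * g * x) = spechtChar T (symmetrizer T') := by
    intro x
    rw [spechtChar_eq_sum (symmetrizer T')]
    refine Fintype.sum_equiv (MulAut.conj x⁻¹).toEquiv _ _ fun g => ?_
    simp only [MulEquiv.toEquiv_eq_coe, EquivLike.coe_coe, MulAut.conj_apply, inv_inv]
    rw [mul_comm]
    congr 1
    have := spechtChar_conj (T := T) x⁻¹ g
    rw [inv_inv] at this
    exact this.symm
  rw [Finset.sum_congr rfl fun x _ => h2 x, Finset.sum_const, Finset.card_univ,
    Fintype.card_perm, Fintype.card_fin, nsmul_eq_mul]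

theorem sum_spechtChar_mul_inv_of_ne (hT : IsTableau lam T) (hT' : IsTableau mu T')
    (hne : lam ≠ mu) : ∑ g, spechtChar T (permElt g) * spechtChar T' (permElt g⁻¹) = 0 := by
  obtain ⟨η, hη, h0⟩ := exists_symmetrizer_sq hT'
  have h := sum_spechtChar_mul_spechtChar_inv (T := T) hη
  rw [spechtChar_symmetrizer_of_ne hT hT' hne, mul_zero] at h
  exact (mul_eq_zero.1 h).resolve_left h0

theorem sum_spechtChar_mul_inv_self (hT : IsTableau lam T) :
    ∑ g, spechtChar T (permElt g) * spechtChar T (permElt g⁻¹) = n.factorial := by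
  obtain ⟨η, hη, h0⟩ := exists_symmetrizer_sq hT
  have h := sum_spechtChar_mul_spechtChar_inv (T := T) hη
  rw [spechtChar_symmetrizer_self hT hη h0, mul_comm] at h
  exact mul_right_cancel₀ h0 h

/-! ### Characters evaluated at row sums -/

/-- The stabilizer sum cannot annihilate the whole ideal, or its trace would vanish. A nonzero
product with the symmetrizer gives an arrangement to which `card_lt_le_rowSum` applies. -/
theorem spechtChar_rowSym_ne_zero (hT : IsTableau lam T) {f : Fin n → ℕ}
    (h : spechtChar T (rowSym f) ≠ 0) (k : ℕ) :
    (Finset.univ.filter fun x => f x < k).card ≤ rowSum lam k := by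
  obtain ⟨η, hη, h0⟩ := exists_symmetrizer_sq hT
  by_cases hx : ∃ x, rowSym f * x * symmetrizer T ≠ 0
  · obtain ⟨x, hx⟩ := hx
    rw [symmetrizer, ← mul_assoc, mul_assoc (rowSym f)] at hx
    obtain ⟨g, hg⟩ := exists_injective_of_rowSym_mul_mul_colSym_ne_zero hx
    exact card_lt_le_rowSum hT f g hg k
  · push Not at hx
    have h1 := traceLR_symmetrizer hη (rowSym f)
    rw [traceLR_eq, Finset.sum_eq_zero fun g _ => by rw [hx]; rfl] at h1
    exact absurd ((mul_eq_zero.1 h1.symm).resolve_left h0) h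

open Classical in
theorem rowSym_mul_rowSym {ι : Type*} (f : Fin n → ι) :
    rowSym f * rowSym f =
      ((Finset.univ.filter fun p : Equiv.Perm (Fin n) => p ∈ fixer f).card : ℂ) • rowSym f := by
  conv_lhs => enter [1]; rw [rowSym]
  rw [Finset.sum_mul, Finset.sum_congr rfl
    (g := fun p : Equiv.Perm (Fin n) => if p ∈ fixer f then rowSym f else 0), ← Finset.sum_filter,
    Finset.sum_const, Nat.cast_smul_eq_nsmul]
  intro p _
  split_ifs with h
  · exact permElt_mul_rowSym h
  · exact zero_mul _

-- The row sum maps the ideal into the line of the symmetrizer, with eigenvalue the order of the row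
-- group. This is the source of `K_{λλ} = 1`.
open Classical in
theorem spechtChar_rowSym_self (hT : IsTableau lam T) :
    spechtChar T (rowSym fun x => (T x).1) =
      (Finset.univ.filter fun p : Equiv.Perm (Fin n) => p ∈ fixer fun x => (T x).1).card := by
  obtain ⟨η, hη, h0⟩ := exists_symmetrizer_sq hT
  have h := traceLR_symmetrizer hη (rowSym fun x => (T x).1)
  set N : ℂ :=
    ((Finset.univ.filter fun p : Equiv.Perm (Fin n) =>
      p ∈ fixer fun x => (T x).1).card : ℂ) with hN
  have hr : ∀ x, ∃ κ : ℂ,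
      rowSym (fun x => (T x).1) * x * symmetrizer T = κ • symmetrizer T := fun x => by
    obtain ⟨κ, hκ⟩ := rowSym_mul_mul_colSym hT (x * rowSym (fun x => (T x).1))
    exact ⟨κ, by rw [← hκ, symmetrizer]; simp only [mul_assoc]⟩
  have hs : rowSym (fun x => (T x).1) * symmetrizer T = N • symmetrizer T := by
    rw [symmetrizer, ← mul_assoc, rowSym_mul_rowSym, smul_mul_assoc]
  rw [traceLR_of_range (symmetrizer_ne_zero hT) (μ := η * N) hr
    (by rw [hs, smul_mul_assoc, hη, smul_smul, mul_comm])] at h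
  exact (mul_left_cancel₀ h0 h).symm

/-- Central elements act on Specht modules by scalars. -/
theorem exists_spechtChar_central_mul (hT : IsTableau lam T) {z : GroupAlg n}
    (hz : z ∈ Subalgebra.center ℂ (GroupAlg n)) :
    ∃ ω : ℂ, ∀ y, spechtChar T (z * y) = ω * spechtChar T y := by
  obtain ⟨η, hη, h0⟩ := exists_symmetrizer_sq hT
  rw [Subalgebra.mem_center_iff] at hz
  -- A central `z` can be moved between the row and the column sum, so it multiplies the symmetrizer
  -- by a scalar.
  obtain ⟨ω, hω⟩ := rowSym_mul_mul_colSym hT z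
  have hzc : z * symmetrizer T = ω • symmetrizer T := by
    rw [← hω, symmetrizer, ← mul_assoc, hz]
  refine ⟨ω, fun y => mul_left_cancel₀ h0 ?_⟩
  rw [mul_left_comm, ← traceLR_symmetrizer hη, ← traceLR_symmetrizer hη, traceLR_eq, traceLR_eq,
    Finset.mul_sum]
  refine Finset.sum_congr rfl fun g _ => ?_
  have : z * y * permElt g * symmetrizer T = ω • (y * permElt g * symmetrizer T) := by
    rw [mul_assoc z, mul_assoc z, ← hz, mul_assoc, hz, hzc, mul_smul_comm]
  rw [this, MonoidAlgebra.coeff_smul_apply, smul_eq_mul]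

end Characters

/-! ## Partitions and Young diagrams -/

theorem card_eq_sum_rowLen (lam : YoungDiagram) :
    lam.card = ∑ i ∈ Finset.range (lam.colLen 0), lam.rowLen i := by
  rw [YoungDiagram.card, Finset.card_eq_sum_ones, Finset.sum_finset_product lam.cells
    (Finset.range (lam.colLen 0)) (fun i => Finset.range (lam.rowLen i))]
  · simp
  · intro p
    rw [YoungDiagram.mem_cells, Finset.mem_range, Finset.mem_range,
      ← YoungDiagram.mem_iff_lt_rowLen, ← YoungDiagram.mem_iff_lt_colLen]
    exact ⟨fun h => ⟨lam.up_left_mem le_rfl (Nat.zero_le _) h, h⟩, fun h => h.2⟩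

theorem sum_rowLens (lam : YoungDiagram) : lam.rowLens.sum = lam.card := by
  rw [card_eq_sum_rowLen, YoungDiagram.rowLens]
  change _ = (Multiset.map lam.rowLen (List.range (lam.colLen 0) : Multiset ℕ)).sum
  rw [Multiset.map_coe, Multiset.sum_coe]

theorem rowLen_eq_zero (lam : YoungDiagram) {i : ℕ} (h : lam.colLen 0 ≤ i) :
    lam.rowLen i = 0 := by
  by_contra h0
  have h1 : (i, 0) ∈ lam := YoungDiagram.mem_iff_lt_rowLen.2 (Nat.pos_of_ne_zero h0)
  rw [YoungDiagram.mem_iff_lt_colLen] at h1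
  omega

theorem colLen_zero_le_card (lam : YoungDiagram) : lam.colLen 0 ≤ lam.card := by
  rw [YoungDiagram.colLen_eq_card]
  exact Finset.card_le_card (Finset.filter_subset _ _)

theorem rowSum_eq_card (lam : YoungDiagram) {k : ℕ} (h : lam.colLen 0 ≤ k) :
    rowSum lam k = lam.card := by
  rw [card_eq_sum_rowLen, rowSum]
  symm
  refine Finset.sum_subset (Finset.range_subset_range.2 h) fun i _ hi => ?_
  exact rowLen_eq_zero lam (by simpa using hi)

/-- The Young diagrams with `n` cells. -/
abbrev DiagramsOf (n : ℕ) : Type := {lam : YoungDiagram // lam.card = n}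

/-- The partition formed by the row lengths of a diagram. -/
def DiagramsOf.toPartition {n : ℕ} (lam : DiagramsOf n) : n.Partition where
  parts := lam.1.rowLens
  parts_pos := fun {i} hi => lam.1.pos_of_mem_rowLens i (by simpa using hi)
  parts_sum := by rw [Multiset.sum_coe, sum_rowLens, lam.2]

theorem DiagramsOf.toPartition_bijective (n : ℕ) :
    Function.Bijective (DiagramsOf.toPartition : DiagramsOf n → n.Partition) := by
  constructor
  · intro lam mu h
    have h1 : (lam.1.rowLens : Multiset ℕ) = mu.1.rowLens := congrArg Nat.Partition.parts h
    have h2 : lam.1.rowLens = mu.1.rowLens :=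
      (Multiset.coe_eq_coe.1 h1).eq_of_sortedGE lam.1.rowLens_sorted mu.1.rowLens_sorted
    have h3 : YoungDiagram.equivListRowLens lam.1 = YoungDiagram.equivListRowLens mu.1 :=
      Subtype.ext h2
    exact Subtype.ext (YoungDiagram.equivListRowLens.injective h3)
  · intro μ
    have hs : (μ.parts.sort (· ≥ ·)).SortedGE := (Multiset.pairwise_sort _ _).sortedGE
    have hpos : ∀ x ∈ μ.parts.sort (· ≥ ·), 0 < x := fun x hx =>
      μ.parts_pos (by simpa using hx)
    have hr := YoungDiagram.rowLens_ofRowLens_eq_self (hw := hs) hpos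
    refine ⟨⟨YoungDiagram.ofRowLens _ hs, ?_⟩, ?_⟩
    · rw [← sum_rowLens, hr, ← Multiset.sum_coe, Multiset.sort_eq, μ.parts_sum]
    · refine Nat.Partition.ext ?_
      simp only [DiagramsOf.toPartition]
      rw [hr, Multiset.sort_eq]

instance (n : ℕ) : Fintype (DiagramsOf n) :=
  Fintype.ofInjective _ (DiagramsOf.toPartition_bijective n).1

/-- A tableau of a diagram with `n` cells. -/
def DiagramsOf.tab {n : ℕ} (lam : DiagramsOf n) (x : Fin n) : ℕ × ℕ :=
  tableauCell lam.1 (Fin.cast lam.2.symm x)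

theorem DiagramsOf.isTableau {n : ℕ} (lam : DiagramsOf n) : IsTableau lam.1 lam.tab := by
  obtain ⟨lam, rfl⟩ := lam
  exact isTableau_tableauCell lam

/-- The irreducible character of a diagram with `n` cells. -/
def DiagramsOf.chi {n : ℕ} (lam : DiagramsOf n) (g : Equiv.Perm (Fin n)) : ℂ :=
  spechtChar lam.tab (permElt g)

theorem DiagramsOf.chi_eq_irrChar (lam : YoungDiagram) :
    DiagramsOf.chi ⟨lam, rfl⟩ = irrChar lam := by
  funext g
  rw [irrChar_eq]
  rfl

/-! ### Orthogonality, class functions and Kostka numbers. -/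

section Expansion
variable {n : ℕ}

theorem DiagramsOf.chi_eq_of_cyc_eq (lam : DiagramsOf n) {g h : Equiv.Perm (Fin n)}
    (hc : cyc g = cyc h) : lam.chi g = lam.chi h := spechtChar_eq_of_cyc_eq hc

theorem DiagramsOf.chi_inv (lam : DiagramsOf n) (g : Equiv.Perm (Fin n)) :
    lam.chi g⁻¹ = lam.chi g := lam.chi_eq_of_cyc_eq (cyc_inv g)

open Classical in
theorem DiagramsOf.sum_chi_mul_chi (lam mu : DiagramsOf n) :
    ∑ g, lam.chi g * mu.chi g = if lam = mu then (n.factorial : ℂ) else 0 := by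
  have h : ∑ g, lam.chi g * mu.chi g = ∑ g, lam.chi g * mu.chi g⁻¹ :=
    Finset.sum_congr rfl fun g _ => by rw [mu.chi_inv]
  rw [h]
  split_ifs with he
  · subst he
    exact sum_spechtChar_mul_inv_self lam.isTableau
  · exact sum_spechtChar_mul_inv_of_ne lam.isTableau mu.isTableau
      fun h => he (Subtype.ext h)

/-- The pairing of a function with an irreducible character. -/
def DiagramsOf.pairing (lam : DiagramsOf n) (β : Equiv.Perm (Fin n) → ℂ) : ℂ :=
  (n.factorial : ℂ)⁻¹ * ∑ g, β g * lam.chi g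

/-- The irreducible characters form a basis of the class functions. -/
theorem classFunction_expansion (β : Equiv.Perm (Fin n) → ℂ)
    (hβ : ∀ g h, cyc g = cyc h → β g = β h) (g : Equiv.Perm (Fin n)) :
    β g = ∑ lam : DiagramsOf n, lam.pairing β * lam.chi g := by
  classical
  have hn : (n.factorial : ℂ) ≠ 0 := by exact_mod_cast n.factorial_ne_zero
  choose r hr using fun s : partsFinset n => exists_cyc_eq s.2
  let x : DiagramsOf n → (partsFinset n → ℂ) := fun lam s => lam.chi (r s)
  have hx : ∀ lam g, lam.chi g = x lam ⟨cyc g, cyc_mem_partsFinset g⟩ := fun lam g =>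
    lam.chi_eq_of_cyc_eq (hr ⟨cyc g, cyc_mem_partsFinset g⟩).symm
  have hproj : ∀ (a : DiagramsOf n → ℂ) (mu : DiagramsOf n),
      ∑ g, (∑ lam, a lam * lam.chi g) * mu.chi g = n.factorial * a mu := by
    intro a mu
    simp only [Finset.sum_mul]
    rw [Finset.sum_comm]
    simp only [mul_assoc, ← Finset.mul_sum, DiagramsOf.sum_chi_mul_chi]
    simp [mul_comm]
  have hli : LinearIndependent ℂ x := by
    rw [Fintype.linearIndependent_iff]
    intro a ha mu
    have h1 : ∀ g, ∑ lam, a lam * lam.chi g = 0 := fun g => by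
      have := congrFun ha ⟨cyc g, cyc_mem_partsFinset g⟩
      simp only [Finset.sum_apply, Pi.smul_apply, smul_eq_mul, Pi.zero_apply] at this
      simpa only [hx] using this
    have h2 := hproj a mu
    simp only [h1, zero_mul, Finset.sum_const_zero] at h2
    exact (mul_eq_zero.1 h2.symm).resolve_left hn
  -- Orthogonality gives independence; there are as many diagrams as cycle types, so the characters
  -- span.
  have hcard : Fintype.card (DiagramsOf n) = Module.finrank ℂ (partsFinset n → ℂ) := by
    rw [Module.finrank_fintype_fun_eq_card, Fintype.card_coe, partsFinset,
      Finset.card_image_of_injective _ (fun _ _ => Nat.Partition.ext),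
      Fintype.card_of_bijective (DiagramsOf.toPartition_bijective n), Finset.card_univ]
  have hspan := hli.span_eq_top_of_card_eq_finrank' hcard
  have hmem : (fun s => β (r s)) ∈ Submodule.span ℂ (Set.range x) := hspan ▸ Submodule.mem_top
  obtain ⟨a, ha⟩ := (Submodule.mem_span_range_iff_exists_fun ℂ).1 hmem
  have hβa : ∀ g, β g = ∑ lam, a lam * lam.chi g := by
    intro g
    have := congrFun ha ⟨cyc g, cyc_mem_partsFinset g⟩
    simp only [Finset.sum_apply, Pi.smul_apply, smul_eq_mul] at this
    simp only [hx, this]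
    exact hβ _ _ (hr ⟨cyc g, cyc_mem_partsFinset g⟩).symm
  rw [hβa g]
  refine Finset.sum_congr rfl fun lam _ => ?_
  congr 1
  rw [DiagramsOf.pairing]
  simp only [hβa]
  rw [hproj, ← mul_assoc, inv_mul_cancel₀ hn, one_mul]

theorem frob_expansion (β : Equiv.Perm (Fin n) → ℂ)
    (hβ : ∀ g h, cyc g = cyc h → β g = β h) :
    frob β = ∑ lam : DiagramsOf n, lam.pairing β • frob lam.chi := by
  simp only [frob, Finset.smul_sum]
  rw [Finset.sum_comm]
  refine Finset.sum_congr rfl fun g _ => ?_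
  simp only [smul_smul]
  rw [← Finset.sum_smul]
  congr 1
  conv_lhs => rw [classFunction_expansion β hβ g, Finset.mul_sum]
  exact Finset.sum_congr rfl fun lam _ => mul_left_comm _ _ _

/-! ### Pairing with permutation characters -/

theorem permChar_eq_of_cyc_eq {ι : Type*} [Fintype ι] (α : ι →₀ ℕ) {g h : Equiv.Perm (Fin n)}
    (hc : cyc g = cyc h) : (permChar α g : ℂ) = permChar α h := by
  rw [← coeff_specAt_cyc, ← coeff_specAt_cyc, hc]

/-- Exchanging the sum over permutations with the sum over fixed colourings leaves one stabilizer
sum for each colouring. -/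
theorem DiagramsOf.pairing_permChar {ι : Type*} [Fintype ι] (lam : DiagramsOf n) (α : ι →₀ ℕ)
    [Fintype (Fin n → ι)] [DecidablePred fun f : Fin n → ι => content f = α] :
    lam.pairing (fun g => permChar α g) = (n.factorial : ℂ)⁻¹ *
      ∑ f ∈ Finset.univ.filter (fun f : Fin n → ι => content f = α),
        spechtChar lam.tab (rowSym f) := by
  classical
  have h : ∀ g : Equiv.Perm (Fin n), (permChar α g : ℂ) =
      ∑ f ∈ Finset.univ.filter (fun f : Fin n → ι => content f = α),
        if g ∈ fixer f then 1 else 0 := by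
    intro g
    rw [← Finset.sum_filter, Finset.sum_const, nsmul_eq_mul, mul_one, Finset.filter_filter,
      permChar]
    congr!
  rw [DiagramsOf.pairing]
  congr 1
  simp only [h, rowSym, map_sum, Finset.sum_mul]
  rw [Finset.sum_comm]
  refine Finset.sum_congr rfl fun f _ => Finset.sum_congr rfl fun g _ => ?_
  split_ifs
  · rw [one_mul]; rfl
  · rw [zero_mul, map_zero]

theorem headWeight_content {r : ℕ} (f : Fin n → Fin r) (k : ℕ) :
    headWeight r k (content f) = (Finset.univ.filter fun x => (f x : ℕ) < k).card := by
  classical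
  change ∑ i ∈ Finset.univ.filter (fun i : Fin r => (i : ℕ) < k), content f i = _
  simp only [content_apply]
  rw [Finset.card_eq_sum_card_fiberwise (f := f)
    (t := Finset.univ.filter (fun i : Fin r => (i : ℕ) < k))]
  · refine Finset.sum_congr rfl fun i hi => ?_
    rw [Finset.filter_filter]
    congr 1
    ext x
    simp only [Finset.mem_filter, Finset.mem_univ, true_and] at hi ⊢
    constructor
    · rintro rfl; exact ⟨hi, rfl⟩
    · exact fun h => h.2
  · intro x hx
    simpa using hx

theorem rowSym_comp_injective {ι κ : Type*} {e : ι → κ} (he : Function.Injective e)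
    (f : Fin n → ι) : rowSym (fun x => e (f x)) = rowSym f := by
  classical
  simp only [rowSym, mem_fixer, he.eq_iff]

theorem headWeight_le_of_pairing_ne_zero {r : ℕ} {lam : DiagramsOf n} {α : Fin r →₀ ℕ}
    (h : lam.pairing (fun g => permChar α g) ≠ 0) (k : ℕ) :
    headWeight r k α ≤ rowSum lam.1 k := by
  classical
  rw [DiagramsOf.pairing_permChar] at h
  obtain ⟨f, hf, hne⟩ := Finset.exists_ne_zero_of_sum_ne_zero (right_ne_zero_of_mul h)
  rw [Finset.mem_filter] at hf
  rw [← hf.2, headWeight_content]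
  rw [← rowSym_comp_injective Fin.val_injective] at hne
  exact spechtChar_rowSym_ne_zero lam.isTableau hne k

/-- The row lengths of a diagram as an exponent vector. -/
def rowContent (r : ℕ) (lam : YoungDiagram) : Fin r →₀ ℕ :=
  Finsupp.equivFunOnFinite.symm fun i => lam.rowLen i

theorem rowContent_apply (r : ℕ) (lam : YoungDiagram) (i : Fin r) :
    rowContent r lam i = lam.rowLen i := rfl

theorem headWeight_eq_sum_range (r k : ℕ) (ν : Fin r →₀ ℕ) :
    headWeight r k ν = ∑ i ∈ Finset.range k, if h : i < r then ν ⟨i, h⟩ else 0 := by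
  change ∑ i ∈ Finset.univ.filter (fun i : Fin r => (i : ℕ) < k), ν i = _
  rw [Finset.sum_filter]
  have h1 : ∀ i : Fin r, (if (i : ℕ) < k then ν i else 0) =
      (fun i : ℕ => if i < k then (if h : i < r then ν ⟨i, h⟩ else 0) else 0) i := by
    intro i
    simp
  rw [Finset.sum_congr rfl fun i _ => h1 i, Fin.sum_univ_eq_sum_range
    (fun i : ℕ => if i < k then (if h : i < r then ν ⟨i, h⟩ else 0) else 0), ← Finset.sum_filter]
  refine Finset.sum_subset_zero_on_sdiff (fun i hi => ?_) (fun i hi => ?_) fun _ _ => rfl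
  · simpa using (Finset.mem_filter.1 hi).2
  · simp only [Finset.mem_sdiff, Finset.mem_range, Finset.mem_filter, not_and] at hi
    rw [dif_neg]
    intro h
    exact hi.2 h hi.1

theorem headWeight_rowContent {r : ℕ} {lam : YoungDiagram} (h : lam.colLen 0 ≤ r) (k : ℕ) :
    headWeight r k (rowContent r lam) = rowSum lam k := by
  rw [headWeight_eq_sum_range, rowSum]
  refine Finset.sum_congr rfl fun i _ => ?_
  split_ifs with hi
  · rfl
  · exact (rowLen_eq_zero lam (by omega)).symm

theorem spechtChar_rowSym_comp {T : Fin n → ℕ × ℕ} {ι : Type*} (f : Fin n → ι)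
    (x : Equiv.Perm (Fin n)) :
    spechtChar T (rowSym fun y => f (x y)) = spechtChar T (rowSym f) := by
  classical
  simp only [rowSym, map_sum]
  refine Fintype.sum_equiv (MulAut.conj x).toEquiv _ _ fun p => ?_
  change _ = spechtChar T (if x * p * x⁻¹ ∈ fixer f then permElt (x * p * x⁻¹) else 0)
  have : p ∈ fixer (fun y => f (x y)) ↔ x * p * x⁻¹ ∈ fixer f := by
    constructor
    · intro h y
      have := h (x⁻¹ y)
      simpa using this
    · intro h y
      have := h (x y)
      simpa using this
  by_cases hp : p ∈ fixer (fun y => f (x y))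
  · rw [if_pos hp, if_pos (this.1 hp), spechtChar_conj]
  · rw [if_neg hp, if_neg fun h => hp (this.2 h)]

theorem exists_perm_comp_eq {ι : Type*} {f f₀ : Fin n → ι} (h : content f = content f₀) :
    ∃ x : Equiv.Perm (Fin n), (fun y => f₀ (x y)) = f := by
  classical
  have hc : ∀ i, Fintype.card {y // f y = i} = Fintype.card {y // f₀ y = i} := fun i => by
    rw [Fintype.card_subtype, Fintype.card_subtype, ← content_apply, ← content_apply, h]
  exact ⟨Equiv.ofFiberEquiv fun i => Fintype.equivOfCardEq (hc i),
    funext fun y => Equiv.ofFiberEquiv_map _ y⟩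

theorem content_comp_perm {ι : Type*} (f : Fin n → ι) (x : Equiv.Perm (Fin n)) :
    content (fun y => f (x y)) = content f :=
  Equiv.sum_comp x fun y => Finsupp.single (f y) 1

/-- The Kostka number `K_{λλ}`. The colourings of content `λ` are the `f₀ ∘ x`, where `f₀` is the
row colouring. Each arises from `N` permutations, `N` being the order of the stabilizer, and each
stabilizer sum has character value `N`. -/
theorem DiagramsOf.pairing_permChar_rowContent (lam : DiagramsOf n) {r : ℕ}
    (hr : lam.1.colLen 0 ≤ r) : lam.pairing (fun g => permChar (rowContent r lam.1) g) = 1 := by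
  classical
  have hn : (n.factorial : ℂ) ≠ 0 := by exact_mod_cast n.factorial_ne_zero
  have hrow : ∀ x, (lam.tab x).1 < r := fun x => by
    refine lt_of_lt_of_le ?_ hr
    rw [← YoungDiagram.mem_iff_lt_colLen]
    exact lam.1.up_left_mem le_rfl (Nat.zero_le _) (lam.isTableau.mem x)
  let f₀ : Fin n → Fin r := fun x => ⟨(lam.tab x).1, hrow x⟩
  have hf₀ : content f₀ = rowContent r lam.1 := by
    ext i
    rw [content_apply, rowContent_apply, ← lam.isTableau.card_row]
    congr 1
    ext x
    simp [f₀, Fin.ext_iff]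
  set N := (Finset.univ.filter fun p : Equiv.Perm (Fin n) => p ∈ fixer f₀).card with hN
  have hN0 : (N : ℂ) ≠ 0 := by
    rw [Nat.cast_ne_zero, hN, Finset.card_ne_zero]
    exact ⟨1, by simp [one_mem]⟩
  have hself : spechtChar lam.tab (rowSym f₀) = N := by
    rw [← rowSym_comp_injective Fin.val_injective]
    change spechtChar lam.tab (rowSym fun x => (lam.tab x).1) = N
    rw [spechtChar_rowSym_self lam.isTableau, hN]
    congr 2
    ext p
    simp [mem_fixer, f₀, Fin.ext_iff]
  have h1 : ∑ x : Equiv.Perm (Fin n), spechtChar lam.tab (rowSym fun y => f₀ (x y)) =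
      n.factorial * N := by
    simp only [spechtChar_rowSym_comp, hself]
    rw [Finset.sum_const, Finset.card_univ, Fintype.card_perm, Fintype.card_fin, nsmul_eq_mul]
  have h2 : ∑ x : Equiv.Perm (Fin n), spechtChar lam.tab (rowSym fun y => f₀ (x y)) =
      N * ∑ f ∈ Finset.univ.filter (fun f : Fin n → Fin r => content f = rowContent r lam.1),
        spechtChar lam.tab (rowSym f) := by
    rw [← Finset.sum_fiberwise_of_maps_to (s := Finset.univ)
      (g := fun x : Equiv.Perm (Fin n) => fun y => f₀ (x y))
      (t := Finset.univ.filter (fun f : Fin n → Fin r => content f = rowContent r lam.1)),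
      Finset.mul_sum]
    · refine Finset.sum_congr rfl fun f hf => ?_
      rw [Finset.mem_filter, ← hf₀] at hf
      obtain ⟨x₀, rfl⟩ := exists_perm_comp_eq hf.2
      rw [Finset.sum_congr rfl (g := fun _ => spechtChar lam.tab (rowSym fun y => f₀ (x₀ y)))
        (fun x hx => by rw [(Finset.mem_filter.1 hx).2]), Finset.sum_const, nsmul_eq_mul]
      congr 2
      rw [hN]
      refine Finset.card_bij (fun x _ => x * x₀⁻¹) ?_ (fun _ _ _ _ h => mul_right_cancel h) ?_
      · intro x hx
        simp only [Finset.mem_filter, Finset.mem_univ, true_and] at hx ⊢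
        intro y
        have := congrFun hx (x₀⁻¹ y)
        simpa using this
      · intro p hp
        simp only [Finset.mem_filter, Finset.mem_univ, true_and] at hp
        refine ⟨p * x₀, ?_, by group⟩
        simp only [Finset.mem_filter, Finset.mem_univ, true_and]
        funext y
        exact hp (x₀ y)
    · intro x _
      rw [Finset.mem_filter, content_comp_perm]
      exact ⟨Finset.mem_univ _, hf₀⟩
  rw [DiagramsOf.pairing_permChar]
  have h3 := mul_left_cancel₀ hN0 (h2.symm.trans (h1.trans (mul_comm _ _)))
  rw [h3, inv_mul_cancel₀ hn]

end Expansion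

/-! ## The Frobenius character formula -/

section Frobenius
variable {n : ℕ}

/-- The exponents of a term of the Jacobi–Trudi determinant. -/
def trudiExponent (lam : YoungDiagram) (σ : Equiv.Perm (Fin (lam.colLen 0))) :
    Fin (lam.colLen 0) →₀ ℕ :=
  Finsupp.equivFunOnFinite.symm fun i : Fin (lam.colLen 0) => ((lam.rowLen i : ℤ) - (i : ℤ) + (σ i : ℕ)).toNat

/-- The condition for a term of the Jacobi–Trudi determinant not to vanish. -/
def TrudiNonneg (lam : YoungDiagram) (σ : Equiv.Perm (Fin (lam.colLen 0))) : Prop :=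
  ∀ i : Fin (lam.colLen 0), 0 ≤ (lam.rowLen i : ℤ) - (i : ℤ) + ((σ i : ℕ) : ℤ)

/-- A permutation of `Fin l` as a function on `ℕ`. -/
def extendNat {l : ℕ} (σ : Equiv.Perm (Fin l)) (i : ℕ) : ℕ := if h : i < l then σ ⟨i, h⟩ else i

theorem extendNat_injective {l : ℕ} (σ : Equiv.Perm (Fin l)) :
    Function.Injective (extendNat σ) := by
  intro i j h
  unfold extendNat at h
  split_ifs at h with hi hj hj
  · simpa using σ.injective (Fin.ext h)
  · have := (σ ⟨i, hi⟩).2; omega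
  · have := (σ ⟨j, hj⟩).2; omega
  · exact h

/-- Partial sums of the exponents `λ_i - i + σ(i)`, arranged without subtraction. Extending `σ` by
the identity allows `k` beyond the number of rows. -/
theorem headWeight_trudiExponent {lam : YoungDiagram} {σ : Equiv.Perm (Fin (lam.colLen 0))}
    (hσ : TrudiNonneg lam σ) (k : ℕ) :
    headWeight _ k (trudiExponent lam σ) + ∑ i ∈ Finset.range k, i =
      rowSum lam k + ∑ i ∈ Finset.range k, extendNat σ i := by
  rw [headWeight_eq_sum_range, rowSum, ← Finset.sum_add_distrib, ← Finset.sum_add_distrib]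
  refine Finset.sum_congr rfl fun i _ => ?_
  unfold extendNat
  split_ifs with h
  · have := hσ ⟨i, h⟩
    simp only [trudiExponent, Finsupp.equivFunOnFinite_symm_apply_apply] at this ⊢
    omega
  · rw [rowLen_eq_zero lam (by omega)]

theorem sum_range_le_sum_extendNat {l : ℕ} (σ : Equiv.Perm (Fin l)) (k : ℕ) :
    ∑ i ∈ Finset.range k, i ≤ ∑ i ∈ Finset.range k, extendNat σ i := by
  classical
  have h := sum_le_sum_range_card (l := fun i => -(i : ℤ))
    (fun a b hab => by simpa using hab) ((Finset.range k).image (extendNat σ))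
  rw [Finset.sum_image fun _ _ _ _ h => extendNat_injective σ h,
    Finset.card_image_of_injective _ (extendNat_injective σ), Finset.card_range,
    Finset.sum_neg_distrib, Finset.sum_neg_distrib, neg_le_neg_iff, ← Nat.cast_sum, ← Nat.cast_sum] at h
  exact_mod_cast h

theorem rowSum_le_headWeight_trudiExponent {lam : YoungDiagram}
    {σ : Equiv.Perm (Fin (lam.colLen 0))} (hσ : TrudiNonneg lam σ) (k : ℕ) :
    rowSum lam k ≤ headWeight _ k (trudiExponent lam σ) := by
  have h1 := headWeight_trudiExponent hσ k
  have h2 := sum_range_le_sum_extendNat σ k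
  omega

/-- Equality in all partial sums makes `σ(0) + ⋯ + σ(k-1)` equal to `0 + ⋯ + (k-1)` for every `k`;
differences give `σ(i) = i`. -/
theorem eq_one_of_headWeight_trudiExponent_le {lam : YoungDiagram}
    {σ : Equiv.Perm (Fin (lam.colLen 0))} (hσ : TrudiNonneg lam σ)
    (h : ∀ k, headWeight _ k (trudiExponent lam σ) ≤ rowSum lam k) : σ = 1 := by
  have hs : ∀ k, ∑ i ∈ Finset.range k, extendNat σ i = ∑ i ∈ Finset.range k, i := fun k => by
    have h1 := headWeight_trudiExponent hσ k
    have h2 := sum_range_le_sum_extendNat σ k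
    have h3 := h k
    omega
  ext i
  have h1 := hs i
  have h2 := hs (i + 1)
  rw [Finset.sum_range_succ, Finset.sum_range_succ, h1] at h2
  have h3 := Nat.add_left_cancel h2
  simpa [extendNat] using h3

theorem sum_trudiExponent {lam : YoungDiagram} {σ : Equiv.Perm (Fin (lam.colLen 0))}
    (hσ : TrudiNonneg lam σ) : ∑ i, trudiExponent lam σ i = lam.card := by
  have h1 := headWeight_trudiExponent hσ (lam.colLen 0)
  have h2 : headWeight _ (lam.colLen 0) (trudiExponent lam σ) = ∑ i, trudiExponent lam σ i := by
    change ∑ i ∈ Finset.univ.filter (fun i : Fin (lam.colLen 0) => (i : ℕ) < lam.colLen 0), _ = _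
    rw [Finset.filter_true_of_mem fun i _ => i.2]
  have h3 : ∑ i ∈ Finset.range (lam.colLen 0), extendNat σ i =
      ∑ i ∈ Finset.range (lam.colLen 0), i := by
    rw [Finset.sum_range, Finset.sum_range]
    simp only [extendNat, Fin.is_lt, dif_pos]
    exact Equiv.sum_comp σ fun i => (i : ℕ)
  rw [h2, h3, rowSum_eq_card lam le_rfl] at h1
  omega

theorem trudiExponent_one (lam : YoungDiagram) :
    trudiExponent lam 1 = rowContent (lam.colLen 0) lam := by
  ext i
  simp [trudiExponent, rowContent]

open Classical in
theorem schur_eq_sum_frob (lam : DiagramsOf n) :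
    schur lam.1 = ∑ σ : Equiv.Perm (Fin (lam.1.colLen 0)),
      (if TrudiNonneg lam.1 σ then ((Equiv.Perm.sign σ : ℤ) : ℂ) else 0) •
        frob (n := n) fun g => permChar (trudiExponent lam.1 σ) g := by
  rw [schur, ← Matrix.det_transpose, Matrix.det_apply]
  refine Finset.sum_congr rfl fun σ _ => ?_
  rw [Units.smul_def, ← Int.cast_smul_eq_zsmul ℂ]
  simp only [Matrix.transpose_apply, Matrix.of_apply]
  split_ifs with h
  · rw [← prod_completeSym_eq_frob _ ((sum_trudiExponent h).trans lam.2)]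
    congr 1
    refine Finset.prod_congr rfl fun i _ => ?_
    rw [completeSymInt, if_pos (h i)]
    rfl
  · simp only [TrudiNonneg, not_forall, not_le] at h
    obtain ⟨i, hi⟩ := h
    rw [Finset.prod_eq_zero (Finset.mem_univ i) (completeSymInt_of_neg hi), smul_zero, zero_smul]

open Classical in
/-- The coefficients of a Schur function in the Frobenius images of the irreducible characters. -/
def schurCoeff (lam mu : DiagramsOf n) : ℂ :=
  ∑ σ : Equiv.Perm (Fin (lam.1.colLen 0)),
    (if TrudiNonneg lam.1 σ then ((Equiv.Perm.sign σ : ℤ) : ℂ) else 0) *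
      mu.pairing fun g => permChar (trudiExponent lam.1 σ) g

theorem schur_eq_sum_schurCoeff (lam : DiagramsOf n) :
    schur lam.1 = ∑ mu : DiagramsOf n, schurCoeff lam mu • frob mu.chi := by
  rw [schur_eq_sum_frob]
  simp only [schurCoeff, Finset.sum_smul]
  rw [Finset.sum_comm]
  refine Finset.sum_congr rfl fun σ _ => ?_
  rw [frob_expansion _ fun g h hc => permChar_eq_of_cyc_eq _ hc, Finset.smul_sum]
  exact Finset.sum_congr rfl fun mu _ => smul_smul _ _ _

/-- The exponents of a Jacobi–Trudi term dominate `λ`, and a character occurring in a permutation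
character dominates its content. -/
theorem rowSum_le_of_schurCoeff_ne_zero {lam mu : DiagramsOf n} (h : schurCoeff lam mu ≠ 0)
    (k : ℕ) : rowSum lam.1 k ≤ rowSum mu.1 k := by
  obtain ⟨σ, -, hne⟩ := Finset.exists_ne_zero_of_sum_ne_zero h
  have h1 : TrudiNonneg lam.1 σ := by
    by_contra h0
    exact left_ne_zero_of_mul hne (if_neg h0)
  exact (rowSum_le_headWeight_trudiExponent h1 k).trans
    (headWeight_le_of_pairing_ne_zero (right_ne_zero_of_mul hne) k)

theorem schurCoeff_self (lam : DiagramsOf n) : schurCoeff lam lam = 1 := by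
  have h1 : TrudiNonneg lam.1 1 := fun i => by simp
  rw [schurCoeff, Finset.sum_eq_single 1]
  · rw [if_pos h1, trudiExponent_one, lam.pairing_permChar_rowContent le_rfl]
    simp
  · intro σ _ hσ
    by_contra hne
    have h2 : TrudiNonneg lam.1 σ := by
      by_contra h0
      exact left_ne_zero_of_mul hne (if_neg h0)
    exact hσ (eq_one_of_headWeight_trudiExponent_le h2
      fun k => headWeight_le_of_pairing_ne_zero (right_ne_zero_of_mul hne) k)
  · simp

theorem coeff_specAt_frob {r : ℕ} (ν : Fin r →₀ ℕ) (mu : DiagramsOf n) :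
    MvPolynomial.coeff ν (specAt Finset.univ
      (MvPolynomial.X : Fin r → MvPolynomial (Fin r) ℂ) (frob mu.chi)) =
        mu.pairing fun g => permChar ν g := by
  rw [frob, map_sum, MvPolynomial.coeff_sum, DiagramsOf.pairing, Finset.mul_sum]
  refine Finset.sum_congr rfl fun g _ => ?_
  rw [map_smul, MvPolynomial.coeff_smul, coeff_specAt_cyc, smul_eq_mul, mul_assoc,
    mul_comm (mu.chi g)]

theorem rowSum_le_of_coeff_schur_ne_zero {lam mu : DiagramsOf n}
    (h : MvPolynomial.coeff (rowContent n mu.1) (specAt Finset.univ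
      (MvPolynomial.X : Fin n → MvPolynomial (Fin n) ℂ) (schur lam.1)) ≠ 0) (k : ℕ) :
    rowSum mu.1 k ≤ rowSum lam.1 k := by
  rw [← headWeight_rowContent ((colLen_zero_le_card mu.1).trans mu.2.le)]
  exact sum_le_rowSum_of_coeff_schur_ne_zero lam.1 _ h k

/-- Take an offending `μ` that is maximal. It dominates `λ`. The coefficient of `x^μ` in `s_λ`
receives contributions only from diagrams dominating `μ`, so by maximality only from `μ` itself, and
it is nonzero. The monomials of `s_λ` are dominated by `λ`, whence `μ = λ`. -/
theorem schurCoeff_of_ne {lam : DiagramsOf n} : ∀ mu, mu ≠ lam → schurCoeff lam mu = 0 := by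
  classical
  by_contra! hex
  let S := Finset.univ.filter fun mu : DiagramsOf n => mu ≠ lam ∧ schurCoeff lam mu ≠ 0
  have hS : S.Nonempty := by
    obtain ⟨mu, h⟩ := hex
    exact ⟨mu, Finset.mem_filter.2 ⟨Finset.mem_univ _, h⟩⟩
  -- The total of the partial sums is a numerical proxy for dominance: it is monotone, and equality
  -- under dominance forces equality of all partial sums.
  obtain ⟨mu, hmu, hmax⟩ := Finset.exists_max_image S
    (fun mu => ∑ k ∈ Finset.range (n + 1), rowSum mu.1 k) hS
  obtain ⟨-, hne, hcoeff⟩ := Finset.mem_filter.1 hmu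
  have hle := rowSum_le_of_schurCoeff_ne_zero hcoeff
  have hmun : mu.1.colLen 0 ≤ n := (colLen_zero_le_card mu.1).trans mu.2.le
  have hc : MvPolynomial.coeff (rowContent n mu.1) (specAt Finset.univ
      (MvPolynomial.X : Fin n → MvPolynomial (Fin n) ℂ) (schur lam.1)) = schurCoeff lam mu := by
    rw [schur_eq_sum_schurCoeff, map_sum, MvPolynomial.coeff_sum, Finset.sum_eq_single mu]
    · rw [map_smul, MvPolynomial.coeff_smul, coeff_specAt_frob,
        mu.pairing_permChar_rowContent hmun, smul_eq_mul, mul_one]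
    · intro ka _ hka
      rw [map_smul, MvPolynomial.coeff_smul, coeff_specAt_frob, smul_eq_mul]
      by_contra h0
      have h1 : ∀ k, rowSum mu.1 k ≤ rowSum ka.1 k := fun k => by
        rw [← headWeight_rowContent hmun]
        exact headWeight_le_of_pairing_ne_zero (right_ne_zero_of_mul h0) k
      by_cases hkl : ka = lam
      · subst hkl
        exact hne (Subtype.ext (eq_of_rowSum_eq fun k => le_antisymm (h1 k) (hle k)))
      · have hkS : ka ∈ S :=
          Finset.mem_filter.2 ⟨Finset.mem_univ _, hkl, left_ne_zero_of_mul h0⟩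
        have h2 := (Finset.sum_eq_sum_iff_of_le fun k _ => h1 k).1
          (le_antisymm (Finset.sum_le_sum fun k _ => h1 k) (hmax ka hkS))
        refine hka (Subtype.ext (eq_of_rowSum_eq fun k => ?_))
        rcases le_or_gt k n with hk | hk
        · exact (h2 k (Finset.mem_range.2 (by omega))).symm
        · rw [rowSum_eq_card _ (((colLen_zero_le_card ka.1).trans ka.2.le).trans hk.le),
            rowSum_eq_card _ (hmun.trans hk.le), ka.2, mu.2]
    · simp
  exact hne (Subtype.ext (eq_of_rowSum_eq fun k => le_antisymm
    (rowSum_le_of_coeff_schur_ne_zero (hc ▸ hcoeff) k) (hle k)))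

/-- The Frobenius character formula. -/
theorem schur_eq_frob (lam : DiagramsOf n) : schur lam.1 = frob lam.chi := by
  rw [schur_eq_sum_schurCoeff, Finset.sum_eq_single lam]
  · rw [schurCoeff_self, one_smul]
  · intro mu _ hmu
    rw [schurCoeff_of_ne mu hmu, zero_smul]
  · simp

end Frobenius

/-! ## The characteristic map -/

section Center
variable {n : ℕ}

/-- The sum `∑_g χ_λ(g) g`. -/
def DiagramsOf.chiSum (lam : DiagramsOf n) : GroupAlg n := ∑ g, lam.chi g • permElt g

theorem DiagramsOf.coeff_chiSum (lam : DiagramsOf n) (g : Equiv.Perm (Fin n)) :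
    lam.chiSum.coeff g = lam.chi g := coeff_sum_smul_permElt _ _

theorem cyc_conj (h g : Equiv.Perm (Fin n)) : cyc (h * g * h⁻¹) = cyc g :=
  cyc_eq_iff_isConj.2 (isConj_iff.2 ⟨h⁻¹, by group⟩)

theorem DiagramsOf.chiSum_mem_center (lam : DiagramsOf n) :
    lam.chiSum ∈ Subalgebra.center ℂ (GroupAlg n) :=
  classSum_mem_center _ fun h g => lam.chi_eq_of_cyc_eq (cyc_conj h g)

theorem coeff_eq_of_cyc_eq {z : GroupAlg n} (hz : z ∈ Subalgebra.center ℂ (GroupAlg n))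
    (g h : Equiv.Perm (Fin n)) (hc : cyc g = cyc h) : z.coeff g = z.coeff h := by
  obtain ⟨c, rfl⟩ := isConj_iff.1 (cyc_eq_iff_isConj.1 hc)
  have h1 := congrArg (fun x : GroupAlg n => x.coeff (c * g))
    ((Subalgebra.mem_center_iff.1 hz) (permElt c))
  simp only [coeff_permElt_mul, coeff_mul_permElt, inv_mul_cancel_left] at h1
  exact h1

/-- The elements `∑_g χ_λ(g) g` span the center. -/
theorem center_expansion {z : GroupAlg n} (hz : z ∈ Subalgebra.center ℂ (GroupAlg n)) :
    z = ∑ lam : DiagramsOf n, lam.pairing z.coeff • lam.chiSum := by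
  conv_lhs => rw [← sum_coeff_smul_permElt z]
  simp only [DiagramsOf.chiSum, Finset.smul_sum, smul_smul]
  rw [Finset.sum_comm]
  refine Finset.sum_congr rfl fun g _ => ?_
  rw [← Finset.sum_smul, ← classFunction_expansion _ (coeff_eq_of_cyc_eq hz)]

theorem chiSum_linearIndependent :
    LinearIndependent ℂ (DiagramsOf.chiSum : DiagramsOf n → GroupAlg n) := by
  classical
  rw [Fintype.linearIndependent_iff]
  intro a ha mu
  have h1 : ∀ g, ∑ lam, a lam * lam.chi g = 0 := fun g => by
    have := congrArg (fun x : GroupAlg n => x.coeff g) ha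
    simpa [MonoidAlgebra.coeff_sum, DiagramsOf.coeff_chiSum] using this
  have h2 : ∑ g, (∑ lam, a lam * lam.chi g) * mu.chi g = n.factorial * a mu := by
    simp only [Finset.sum_mul]
    rw [Finset.sum_comm]
    simp only [mul_assoc, ← Finset.mul_sum, DiagramsOf.sum_chi_mul_chi]
    simp [mul_comm]
  simp only [h1, zero_mul, Finset.sum_const_zero] at h2
  exact (mul_eq_zero.1 h2.symm).resolve_left (by exact_mod_cast n.factorial_ne_zero)

theorem chAlg_permElt (g : Equiv.Perm (Fin n)) :
    chAlg n (permElt g) = ((n.factorial : ℂ)⁻¹) • powerSumProd (cyc g) := by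
  change Finsupp.linearCombination ℂ _ (permElt g : GroupAlg n).coeff = _
  rw [permElt, MonoidAlgebra.of_apply, MonoidAlgebra.coeff_single,
    Finsupp.linearCombination_single, one_smul]

theorem chAlg_sum (β : Equiv.Perm (Fin n) → ℂ) : chAlg n (∑ g, β g • permElt g) = frob β := by
  rw [map_sum, frob]
  refine Finset.sum_congr rfl fun g _ => ?_
  rw [map_smul, chAlg_permElt, smul_smul, mul_comm]

theorem chAlg_chiSum (lam : DiagramsOf n) : chAlg n lam.chiSum = schur lam.1 := by
  rw [DiagramsOf.chiSum, chAlg_sum, schur_eq_frob]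

/-- The exponent of the monomial `P_μ`. -/
def partExponent (s : Multiset ℕ) : ℕ+ →₀ ℕ := Multiset.toFinsupp (s.map Nat.toPNat')

theorem powerSumProd_eq_monomial (s : Multiset ℕ) :
    powerSumProd s = MvPolynomial.monomial (partExponent s) 1 := by
  induction s using Multiset.induction_on with
  | empty => simp [powerSumProd, partExponent]
  | cons a s ih =>
    rw [powerSumProd, Multiset.map_cons, Multiset.prod_cons, ← powerSumProd, ih, powerSum,
      MvPolynomial.X, MvPolynomial.monomial_mul, partExponent, partExponent, Multiset.map_cons,
      ← Multiset.singleton_add, map_add, Multiset.toFinsupp_singleton, one_mul]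

theorem partExponent_map_coe (d : ℕ+ →₀ ℕ) :
    partExponent ((Multiset.toFinsupp.symm d).map fun k : ℕ+ => (k : ℕ)) = d := by
  rw [partExponent, Multiset.map_map]
  simp

theorem eq_of_partExponent_eq {s t : Multiset ℕ} (hs : ∀ i ∈ s, 0 < i) (ht : ∀ i ∈ t, 0 < i)
    (h : partExponent s = partExponent t) : s = t := by
  have key : ∀ s : Multiset ℕ, (∀ i ∈ s, 0 < i) →
      (s.map Nat.toPNat').map (fun k : ℕ+ => (k : ℕ)) = s := by
    intro s hs
    rw [Multiset.map_map]
    conv_rhs => rw [← Multiset.map_id s]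
    exact Multiset.map_congr rfl fun i hi => by simp [hs i hi]
  rw [← key s hs, ← key t ht, Multiset.toFinsupp.injective h]

theorem ch_lof (n : ℕ) (z : ZAlg n) :
    ch (DirectSum.lof ℂ ℕ (fun n => ZAlg n) n z) = chAlg n z := by
  rw [ch, DirectSum.toModule_lof]
  rfl

-- The `P_μ` are distinct monomials in the generators, so the coefficient at `cyc g` picks out the
-- degree `n` component and the value of its class function on the class of `g`.
open Classical in
theorem coeff_chAlg {k : ℕ} (z : ZAlg k) (g : Equiv.Perm (Fin n)) :
    MvPolynomial.coeff (partExponent (cyc g)) (chAlg k z) =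
      if h : k = n then (n.factorial : ℂ)⁻¹ *
        (Finset.univ.filter fun x : Equiv.Perm (Fin n) => cyc x = cyc g).card *
          (h ▸ z : ZAlg n).1.coeff g else 0 := by
  conv_lhs => rw [← sum_coeff_smul_permElt (z : GroupAlg k), chAlg_sum, frob]
  rw [MvPolynomial.coeff_sum]
  simp only [powerSumProd_eq_monomial, MvPolynomial.coeff_smul, MvPolynomial.coeff_monomial,
    smul_eq_mul, mul_ite, mul_one, mul_zero]
  have hcyc : ∀ x : Equiv.Perm (Fin k), partExponent (cyc x) = partExponent (cyc g) →
      cyc x = cyc g := fun x hx => eq_of_partExponent_eq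
    (mem_partsFinset.1 (cyc_mem_partsFinset x)).1 (mem_partsFinset.1 (cyc_mem_partsFinset g)).1 hx
  split_ifs with h
  · subst h
    rw [← Finset.sum_filter]
    have h1 : (Finset.univ.filter fun x : Equiv.Perm (Fin k) =>
        partExponent (cyc x) = partExponent (cyc g)) =
        Finset.univ.filter fun x : Equiv.Perm (Fin k) => cyc x = cyc g :=
      Finset.filter_congr fun x _ => ⟨hcyc x, fun h => by rw [h]⟩
    rw [h1, Finset.sum_congr rfl fun x hx => by
      rw [coeff_eq_of_cyc_eq z.2 x g (Finset.mem_filter.1 hx).2], Finset.sum_const, nsmul_eq_mul]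
    ring
  · refine Finset.sum_eq_zero fun x _ => if_neg fun hx => h ?_
    rw [← (mem_partsFinset.1 (cyc_mem_partsFinset x)).2, hcyc x hx,
      (mem_partsFinset.1 (cyc_mem_partsFinset g)).2]

open Classical in
theorem coeff_ch (x : ⨁ n : ℕ, ZAlg n) (g : Equiv.Perm (Fin n)) :
    MvPolynomial.coeff (partExponent (cyc g)) (ch x) = (n.factorial : ℂ)⁻¹ *
      (Finset.univ.filter fun x : Equiv.Perm (Fin n) => cyc x = cyc g).card *
        (x n : GroupAlg n).coeff g := by
  induction x using DirectSum.induction_on with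
  | zero => simp
  | of k z =>
    have := ch_lof k z
    rw [DirectSum.lof_eq_of] at this
    rw [this, coeff_chAlg]
    split_ifs with h
    · subst h
      rw [DirectSum.of_eq_same]
    · rw [DirectSum.of_eq_of_ne _ _ _ (Ne.symm h)]
      simp
  | add x y hx hy =>
    rw [map_add, MvPolynomial.coeff_add, hx, hy, DirectSum.add_apply]
    simp [mul_add]

theorem ch_injective : Function.Injective ch := by
  classical
  rw [injective_iff_map_eq_zero]
  intro x hx
  refine DFinsupp.ext fun n => Subtype.ext (MonoidAlgebra.ext (Finsupp.ext fun g => ?_))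
  have h := coeff_ch x g
  rw [hx, MvPolynomial.coeff_zero, eq_comm, mul_eq_zero, mul_eq_zero] at h
  refine (h.resolve_left ?_).trans (by simp)
  rintro (h | h)
  · exact n.factorial_ne_zero (by simpa using h)
  · rw [Nat.cast_eq_zero, Finset.card_eq_zero] at h
    exact Finset.notMem_empty g (h ▸ Finset.mem_filter.2 ⟨Finset.mem_univ _, rfl⟩)

/-- A class sum is sent to a nonzero multiple of the monomial `P_μ` of its cycle type; every
monomial in the generators arises. -/
theorem ch_surjective : Function.Surjective ch := by
  classical
  rw [← LinearMap.range_eq_top, eq_top_iff]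
  rintro p -
  induction p using MvPolynomial.induction_on' with
  | add p q hp hq => exact Submodule.add_mem _ hp hq
  | monomial d a =>
    rw [← mul_one a, ← smul_eq_mul, ← MvPolynomial.smul_monomial]
    refine Submodule.smul_mem _ _ ?_
    set s : Multiset ℕ := (Multiset.toFinsupp.symm d).map fun k : ℕ+ => (k : ℕ) with hs
    have hmem : s ∈ partsFinset s.sum := mem_partsFinset.2 ⟨fun i hi => by
      obtain ⟨k, -, rfl⟩ := Multiset.mem_map.1 hi
      exact k.pos, rfl⟩
    obtain ⟨g, hg⟩ := exists_cyc_eq hmem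
    let β : Equiv.Perm (Fin s.sum) → ℂ := fun x => if cyc x = s then 1 else 0
    have hβ : ∀ h g, β (h * g * h⁻¹) = β g := fun h g => by simp only [β, cyc_conj]
    have hch : ch (DirectSum.lof ℂ ℕ (fun n => ZAlg n) s.sum ⟨_, classSum_mem_center β hβ⟩) =
        (((s.sum).factorial : ℂ)⁻¹ *
          (Finset.univ.filter fun x : Equiv.Perm (Fin s.sum) => cyc x = s).card) •
            MvPolynomial.monomial d 1 := by
      rw [ch_lof, chAlg_sum, frob]
      simp only [β, mul_ite, mul_one, mul_zero, ite_smul, zero_smul]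
      rw [← Finset.sum_filter, Finset.sum_congr rfl fun x hx => by
        rw [(Finset.mem_filter.1 hx).2], Finset.sum_const, powerSumProd_eq_monomial, hs,
        partExponent_map_coe, ← Nat.cast_smul_eq_nsmul ℂ, smul_smul, mul_comm]
    have h0 : (((s.sum).factorial : ℂ)⁻¹ *
          (Finset.univ.filter fun x : Equiv.Perm (Fin s.sum) => cyc x = s).card) ≠ 0 := by
      refine mul_ne_zero (inv_ne_zero (by exact_mod_cast Nat.factorial_ne_zero _)) ?_
      rw [Nat.cast_ne_zero, Finset.card_ne_zero]
      exact ⟨g, Finset.mem_filter.2 ⟨Finset.mem_univ _, hg⟩⟩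
    exact (Submodule.smul_mem_iff _ h0).1 ⟨_, hch⟩

end Center

/-! ### The Schur basis -/

/-- `∑_g χ_λ(g) g` as an element of `⨁_n 𝒵(ℂ[S_n])`. -/
def chiTotal (lam : YoungDiagram) : ⨁ n : ℕ, ZAlg n :=
  DirectSum.lof ℂ ℕ (fun n => ZAlg n) lam.card
    ⟨_, DiagramsOf.chiSum_mem_center (⟨lam, rfl⟩ : DiagramsOf lam.card)⟩

theorem idemSum_eq (lam : YoungDiagram) :
    idemSum lam = (hookProd lam : ℂ)⁻¹ • chiTotal lam := by
  have h : (⟨∑ g, irrChar lam g • permElt g, classSum_mem_center _ (irrChar_conj lam)⟩ :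
      ZAlg lam.card) = ⟨_, DiagramsOf.chiSum_mem_center (⟨lam, rfl⟩ : DiagramsOf lam.card)⟩ :=
    Subtype.ext (Finset.sum_congr rfl fun g _ => by rw [← DiagramsOf.chi_eq_irrChar])
  rw [idemSum, idemF, map_smul, h, chiTotal]

theorem chiTotal_eq_lof {n : ℕ} (lam : DiagramsOf n) :
    chiTotal lam.1 = DirectSum.lof ℂ ℕ (fun n => ZAlg n) n ⟨_, lam.chiSum_mem_center⟩ := by
  obtain ⟨lam, rfl⟩ := lam
  rfl

theorem ch_chiTotal (lam : YoungDiagram) : ch (chiTotal lam) = schur lam := by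
  rw [chiTotal, ch_lof, chAlg_chiSum]

theorem ch_idemSum (lam : YoungDiagram) :
    ch (idemSum lam) = (hookProd lam : ℂ)⁻¹ • schur lam := by
  rw [idemSum_eq, map_smul, ch_chiTotal]

theorem span_chiTotal : Submodule.span ℂ (Set.range chiTotal) = ⊤ := by
  rw [eq_top_iff]
  rintro x -
  induction x using DirectSum.induction_on with
  | zero => exact Submodule.zero_mem _
  | add x y hx hy => exact Submodule.add_mem _ hx hy
  | of n z =>
    have hz : z = ∑ lam : DiagramsOf n, lam.pairing (z : GroupAlg n).coeff •
        (⟨_, lam.chiSum_mem_center⟩ : ZAlg n) := by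
      refine Subtype.ext ((center_expansion z.2).trans ?_)
      simp
    rw [← DirectSum.lof_eq_of ℂ, hz, map_sum]
    refine Submodule.sum_mem _ fun lam _ => ?_
    rw [map_smul, ← chiTotal_eq_lof]
    exact Submodule.smul_mem _ _ (Submodule.subset_span ⟨_, rfl⟩)

theorem chiTotal_apply (lam : YoungDiagram) (n : ℕ) :
    ((chiTotal lam n : ZAlg n) : GroupAlg n) =
      if h : lam.card = n then DiagramsOf.chiSum ⟨lam, h⟩ else 0 := by
  split_ifs with h
  · rw [chiTotal_eq_lof ⟨lam, h⟩, DirectSum.lof_eq_of, DirectSum.of_eq_same]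
  · rw [chiTotal, DirectSum.lof_eq_of, DirectSum.of_eq_of_ne _ _ _ (Ne.symm h)]
    rfl

theorem linearCombination_chiTotal_apply (l : YoungDiagram →₀ ℂ) (n : ℕ) :
    ((Finsupp.linearCombination ℂ chiTotal l n : ZAlg n) : GroupAlg n) =
      ∑ mu : DiagramsOf n, l mu.1 • mu.chiSum := by
  classical
  induction l using Finsupp.induction_linear with
  | zero => simp
  | add l m hl hm =>
    rw [map_add, DirectSum.add_apply, Subalgebra.coe_add, hl, hm, ← Finset.sum_add_distrib]
    exact Finset.sum_congr rfl fun mu _ => by rw [Finsupp.add_apply, add_smul]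
  | single lam a =>
    rw [Finsupp.linearCombination_single, DirectSum.smul_apply, Subalgebra.coe_smul,
      chiTotal_apply]
    simp only [Finsupp.single_apply, ite_smul, zero_smul]
    split_ifs with h
    · rw [Finset.sum_eq_single ⟨lam, h⟩, if_pos rfl]
      · intro mu _ hmu
        exact if_neg fun h => hmu (Subtype.ext h.symm)
      · simp
    · rw [smul_zero]
      exact (Finset.sum_eq_zero fun mu _ => if_neg fun h1 => h (by rw [h1, mu.2])).symm

theorem linearIndependent_chiTotal : LinearIndependent ℂ chiTotal := by
  intro l m hlm
  ext lam
  have h := linearCombination_chiTotal_apply l lam.card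
  rw [show Finsupp.linearCombination ℂ chiTotal l = Finsupp.linearCombination ℂ chiTotal m from hlm,
    linearCombination_chiTotal_apply, eq_comm, ← sub_eq_zero, ← Finset.sum_sub_distrib] at h
  simp only [← sub_smul] at h
  exact sub_eq_zero.1
    (Fintype.linearIndependent_iff.1 chiSum_linearIndependent _ h ⟨lam, rfl⟩)

/-- The characteristic map as a linear equivalence. -/
def chEquiv : (⨁ n : ℕ, ZAlg n) ≃ₗ[ℂ] SymFun :=
  LinearEquiv.ofBijective ch ⟨ch_injective, ch_surjective⟩

/-- The basis `∑_g χ_λ(g) g` of `⨁_n 𝒵(ℂ[S_n])`. -/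
def chiBasis : Module.Basis YoungDiagram ℂ (⨁ n : ℕ, ZAlg n) :=
  Module.Basis.mk linearIndependent_chiTotal span_chiTotal.ge

/-- The basis of Schur functions. -/
def schurBasis : Module.Basis YoungDiagram ℂ SymFun := chiBasis.map chEquiv

theorem schurBasis_apply (lam : YoungDiagram) : schurBasis lam = schur lam := by
  rw [schurBasis, Module.Basis.map_apply, chiBasis, Module.Basis.mk_apply]
  exact ch_chiTotal lam

/-! ## Jucys–Murphy elements -/

section JucysMurphy
variable {n : ℕ}

/-! ### Cycle counts -/

open Classical in
/-- The two-colourings fixed by a permutation. -/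
def twoColourings (g : Equiv.Perm (Fin n)) : Finset (Fin n → Fin 2) :=
  Finset.univ.filter fun f => g ∈ fixer f

theorem mem_twoColourings {g : Equiv.Perm (Fin n)} {f : Fin n → Fin 2} :
    f ∈ twoColourings g ↔ ∀ x, f (g x) = f x := by
  simp [twoColourings, mem_fixer]

theorem card_twoColourings (g : Equiv.Perm (Fin n)) :
    (twoColourings g).card = 2 ^ (cyc g).card := by
  have h := sum_fixed_colourings (R := ℤ) g (fun _ : Fin 2 => 1)
  simp only [Finset.prod_const_one, one_pow, Finset.sum_const, Finset.card_univ,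
    Fintype.card_fin, Multiset.map_const', Multiset.prod_replicate] at h
  have h2 : ((twoColourings g).card : ℤ) = 2 ^ (cyc g).card := by
    simpa [twoColourings] using h
  exact_mod_cast h2

/-- The fixed point `k` is inserted into the cycle of `a`. To avoid following cycles, count fixed
two-colourings, of which there are `2^{#cycles}`: multiplying by the swap adds the condition that
`k` has the colour of `a`, while for `h` the colour of `k` is free. -/
theorem card_cyc_mul_swap {h : Equiv.Perm (Fin n)} {a k : Fin n} (hk : h k = k) (hak : a ≠ k) :
    (cyc (h * Equiv.swap a k)).card + 1 = (cyc h).card := by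
  classical
  have hfix : ∀ f : Fin n → Fin 2, f ∈ twoColourings (h * Equiv.swap a k) ↔
      f ∈ twoColourings h ∧ f k = f a := by
    intro f
    simp only [mem_twoColourings, Equiv.Perm.mul_apply]
    constructor
    · intro H
      have h1 : f k = f a := by
        have := H a
        rwa [Equiv.swap_apply_left, hk] at this
      refine ⟨fun x => ?_, h1⟩
      by_cases hxa : x = a
      · subst hxa
        have := H k
        rwa [Equiv.swap_apply_right, h1] at this
      · by_cases hxk : x = k
        · rw [hxk, hk]
        · have := H x
          rwa [Equiv.swap_apply_of_ne_of_ne hxa hxk] at this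
    · rintro ⟨H, h1⟩ x
      rw [H]
      by_cases hxa : x = a
      · rw [hxa, Equiv.swap_apply_left, h1]
      · by_cases hxk : x = k
        · rw [hxk, Equiv.swap_apply_right, h1]
        · rw [Equiv.swap_apply_of_ne_of_ne hxa hxk]
  have hupd : ∀ (f : Fin n → Fin 2) (c : Fin 2), f ∈ twoColourings h →
      Function.update f k c ∈ twoColourings h := by
    intro f c hf
    rw [mem_twoColourings] at hf ⊢
    intro x
    by_cases hx : x = k
    · rw [hx, hk]
    · have : h x ≠ k := fun hx2 => hx (h.injective (hx2.trans hk.symm))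
      rw [Function.update_of_ne this, Function.update_of_ne hx, hf]
  have hcard : (twoColourings h).card =
      (twoColourings (h * Equiv.swap a k) ×ˢ (Finset.univ : Finset (Fin 2))).card := by
    refine Finset.card_nbij' (fun f => (Function.update f k (f a), f k))
      (fun p => Function.update p.1 k p.2) ?_ ?_ ?_ ?_
    · intro f hf
      rw [SetLike.mem_coe] at hf
      rw [SetLike.mem_coe, Finset.mem_product, hfix]
      refine ⟨⟨hupd _ _ hf, ?_⟩, Finset.mem_univ _⟩
      simp [Function.update_of_ne hak]
    · rintro ⟨f, c⟩ hf
      rw [SetLike.mem_coe, Finset.mem_product, hfix] at hf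
      exact hupd _ _ hf.1.1
    · intro f _
      simp
    · rintro ⟨f, c⟩ hf
      rw [SetLike.mem_coe, Finset.mem_product, hfix] at hf
      have h2 : f k = f a := hf.1.2
      simp [Function.update_of_ne hak, ← h2]
  rw [Finset.card_product, card_twoColourings, card_twoColourings, Finset.card_univ,
    Fintype.card_fin, ← pow_succ] at hcard
  exact (Nat.pow_right_injective le_rfl hcard).symm

theorem cyc_one : cyc (1 : Equiv.Perm (Fin n)) = Multiset.replicate n 1 := by
  simp [cyc, Equiv.Perm.parts_partition]

theorem card_cyc_eq_iff {g : Equiv.Perm (Fin n)} : (cyc g).card = n ↔ g = 1 := by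
  refine ⟨fun h => ?_, fun h => by rw [h, cyc_one, Multiset.card_replicate]⟩
  obtain ⟨hpos, hsum⟩ := mem_partsFinset.1 (cyc_mem_partsFinset g)
  have h1 : cyc g = Multiset.replicate n 1 := by
    rw [Multiset.eq_replicate]
    refine ⟨h, fun b hb => ?_⟩
    obtain ⟨t, ht⟩ := Multiset.exists_cons_of_mem hb
    have h2 : t.card ≤ t.sum := by
      have := Multiset.card_nsmul_le_sum (s := t) (a := 1)
        fun x hx => hpos x (ht ▸ Multiset.mem_cons_of_mem hx)
      simpa using this
    have h3 := hpos b hb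
    rw [ht, Multiset.sum_cons] at hsum
    rw [ht, Multiset.card_cons] at h
    omega
  rw [← cyc_one, cyc_eq_iff_isConj] at h1
  exact isConj_one_right.1 h1.symm

/-! ### The product of the shifted Jucys–Murphy elements -/

/-- The permutations fixing all points `≥ k`. -/
def prefixPerms (n k : ℕ) : Finset (Equiv.Perm (Fin n)) :=
  Finset.univ.filter fun g => ∀ y : Fin n, k ≤ y → g y = y

theorem mem_prefixPerms {k : ℕ} {g : Equiv.Perm (Fin n)} :
    g ∈ prefixPerms n k ↔ ∀ y : Fin n, k ≤ y → g y = y := by simp [prefixPerms]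

/-- The sum `∑_g x^{#cycles of g} g` over the permutations fixing all points `≥ k`. -/
def cycleSum (n k : ℕ) (x : ℂ) : GroupAlg n :=
  ∑ g ∈ prefixPerms n k, x ^ (cyc g).card • permElt g

/-- Coset decomposition: `g` is uniquely `h (a k)` with `h` fixing `k` and `a = g⁻¹ k`; `a = k`
stands for the trivial swap. -/
theorem sum_prefixPerms_succ {V : Type*} [AddCommMonoid V] (k : Fin n)
    (φ : Equiv.Perm (Fin n) → V) :
    ∑ g ∈ prefixPerms n (k + 1), φ g =
      ∑ p ∈ prefixPerms n k ×ˢ Finset.Iic k, φ (p.1 * Equiv.swap p.2 k) := by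
  symm
  refine Finset.sum_nbij' (fun p => p.1 * Equiv.swap p.2 k)
    (fun g => (g * Equiv.swap (g⁻¹ k) k, g⁻¹ k)) ?_ ?_ ?_ ?_ fun _ _ => rfl
  · rintro ⟨h, a⟩ hp
    obtain ⟨h1, h2⟩ := Finset.mem_product.1 hp
    rw [mem_prefixPerms] at h1 ⊢
    replace h2 : a ≤ k := Finset.mem_Iic.1 h2
    intro y hy
    have h3 : y ≠ a := by rintro rfl; exact absurd (Fin.le_def.1 h2) (by omega)
    have h4 : y ≠ k := by rintro rfl; omega
    rw [Equiv.Perm.mul_apply, Equiv.swap_apply_of_ne_of_ne h3 h4]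
    exact h1 y (by omega)
  · intro g hg
    rw [mem_prefixPerms] at hg
    rw [Finset.mem_product, mem_prefixPerms, Finset.mem_Iic]
    have h5 : g⁻¹ k ≤ k := by
      by_contra hlt
      rw [not_le, Fin.lt_def] at hlt
      have := hg (g⁻¹ k) (by omega)
      rw [show g (g⁻¹ k) = k from Equiv.apply_symm_apply g k] at this
      rw [← this] at hlt
      exact lt_irrefl _ hlt
    refine ⟨fun y hy => ?_, h5⟩
    change g (Equiv.swap (g⁻¹ k) k y) = y
    by_cases hyk : y = k
    · rw [hyk, Equiv.swap_apply_right, Equiv.Perm.coe_inv, Equiv.apply_symm_apply]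
    · have h6 : (k : ℕ) < y := lt_of_le_of_ne hy fun h => hyk (Fin.ext h.symm)
      have h7 : y ≠ g⁻¹ k := by
        rintro h
        have := Fin.le_def.1 h5
        rw [← h] at this
        omega
      rw [Equiv.swap_apply_of_ne_of_ne h7 hyk]
      exact hg y h6
  · rintro ⟨h, a⟩ hp
    have h1 : h k = k := mem_prefixPerms.1 (Finset.mem_product.1 hp).1 k le_rfl
    have h2 : (h * Equiv.swap a k)⁻¹ k = a := by
      rw [Equiv.Perm.inv_eq_iff_eq, Equiv.Perm.mul_apply, Equiv.swap_apply_left, h1]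
    simp only [h2, mul_assoc, Equiv.swap_mul_self, mul_one]
  · intro g _
    simp only [mul_assoc, Equiv.swap_mul_self, mul_one]

/-- A genuine swap lowers the cycle count by one. The extra factor `x` on the left compensates for
this, and it becomes the summand `x` of `x + 𝒥_k` when the swap is trivial. -/
theorem smul_cycleSum_succ (k : Fin n) (x : ℂ) :
    x • cycleSum n (k + 1) x = cycleSum n k x * (x • 1 + jucysMurphy k) := by
  rw [cycleSum, sum_prefixPerms_succ k fun g => x ^ (cyc g).card • permElt g, cycleSum,
    Finset.sum_product, Finset.smul_sum, Finset.sum_mul]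
  refine Finset.sum_congr rfl fun h hh => ?_
  have h1 : h k = k := mem_prefixPerms.1 hh k le_rfl
  have h2 : jucysMurphy k = ∑ a ∈ Finset.Iio k, permElt (Equiv.swap a k) := by
    rw [jucysMurphy]
    congr 1
    ext a
    simp
  rw [← Finset.Iio_insert k, Finset.sum_insert (by simp), h2, mul_add, smul_add,
    Equiv.swap_self, Finset.mul_sum, Finset.smul_sum]
  congr 1
  · rw [mul_smul_comm, mul_one]
    rfl
  · refine Finset.sum_congr rfl fun a ha => ?_
    rw [smul_mul_assoc, permElt_mul_permElt, smul_smul, ← pow_succ',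
      card_cyc_mul_swap h1 (Finset.mem_Iio.1 ha).ne]

theorem cycleSum_zero (x : ℂ) : cycleSum n 0 x = x ^ n • 1 := by
  have : prefixPerms n 0 = {1} := by
    ext g
    rw [mem_prefixPerms, Finset.mem_singleton]
    exact ⟨fun h => Equiv.ext fun y => h y (Nat.zero_le _), fun h _ _ => by rw [h]; rfl⟩
  rw [cycleSum, this, Finset.sum_singleton, cyc_one, Multiset.card_replicate]
  simp [permElt, MonoidAlgebra.one_def]

theorem pow_smul_cycleSum (x : ℂ) : ∀ k ≤ n, x ^ k • cycleSum n k x =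
    x ^ n • (((List.finRange n).take k).map fun b => x • 1 + jucysMurphy b).prod := by
  intro k
  induction k with
  | zero => simp [cycleSum_zero]
  | succ k ih =>
    intro hk
    rw [pow_succ, mul_smul, smul_cycleSum_succ ⟨k, hk⟩, ← smul_mul_assoc, ih (by omega),
      smul_mul_assoc, List.map_take, List.map_take, List.prod_take_succ _ _ (by simpa using hk)]
    simp

theorem cycleSum_eq_prod {x : ℂ} (hx : x ≠ 0) :
    ∑ g : Equiv.Perm (Fin n), x ^ (cyc g).card • permElt g =
      ((List.finRange n).map fun b => x • (1 : GroupAlg n) + jucysMurphy b).prod := by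
  have h := pow_smul_cycleSum (n := n) x n le_rfl
  have h2 : prefixPerms n n = Finset.univ := by
    ext g
    rw [mem_prefixPerms]
    exact ⟨fun _ => Finset.mem_univ _, fun _ y hy => absurd y.2 (by omega)⟩
  rw [List.take_of_length_le (by simp), cycleSum, h2] at h
  exact smul_right_injective _ (pow_ne_zero n hx) h

end JucysMurphy

/-! ### Eigenvalues -/

section Eigenvalues
variable {n : ℕ}

theorem DiagramsOf.chi_one_ne_zero (lam : DiagramsOf n) : lam.chi 1 ≠ 0 := by
  have := spechtChar_one_ne_zero lam.isTableau
  rwa [DiagramsOf.chi, permElt, map_one (MonoidAlgebra.of ℂ (Equiv.Perm (Fin n)))]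

theorem DiagramsOf.pairing_coeff (lam : DiagramsOf n) (z : GroupAlg n) :
    lam.pairing z.coeff = (n.factorial : ℂ)⁻¹ * spechtChar lam.tab z := by
  rw [DiagramsOf.pairing, spechtChar_eq_sum]
  rfl

/-- A central element acts on `∑_g χ_λ(g) g` by its normalized character. -/
theorem DiagramsOf.central_mul_chiSum (lam : DiagramsOf n) {z : GroupAlg n}
    (hz : z ∈ Subalgebra.center ℂ (GroupAlg n)) {ω : ℂ}
    (hω : spechtChar lam.tab z = ω * lam.chi 1) : z * lam.chiSum = ω • lam.chiSum := by
  classical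
  have hn : (n.factorial : ℂ) ≠ 0 := by exact_mod_cast n.factorial_ne_zero
  -- The coefficient at `μ` is a scalar times the pairing of `χ_λ` with `χ_μ`, so orthogonality
  -- leaves only `λ`.
  rw [center_expansion (mul_mem hz lam.chiSum_mem_center), Finset.sum_eq_single lam]
  · congr 1
    obtain ⟨ω', h⟩ := exists_spechtChar_central_mul lam.isTableau hz
    have h1 := h 1
    rw [mul_one, hω] at h1
    have h2 : ω = ω' := by
      refine mul_right_cancel₀ lam.chi_one_ne_zero (h1.trans ?_)
      rw [DiagramsOf.chi, permElt, map_one (MonoidAlgebra.of ℂ (Equiv.Perm (Fin n)))]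
    rw [pairing_coeff, h, spechtChar_eq_sum, h2]
    simp only [coeff_chiSum]
    change _ * (_ * ∑ g, lam.chi g * lam.chi g) = _
    rw [sum_chi_mul_chi, if_pos rfl]
    field_simp
  · intro mu _ hmu
    obtain ⟨ω', h⟩ := exists_spechtChar_central_mul mu.isTableau hz
    rw [pairing_coeff, h, spechtChar_eq_sum]
    simp only [coeff_chiSum]
    change (_ * (_ * ∑ g, lam.chi g * mu.chi g)) • _ = _
    rw [sum_chi_mul_chi, if_neg (Ne.symm hmu)]
    simp
  · simp

theorem aeval_const_powerSumProd (x : ℂ) (s : Multiset ℕ) :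
    MvPolynomial.aeval (fun _ : ℕ+ => x) (powerSumProd s) = x ^ s.card := by
  rw [map_powerSumProd]
  simp [powerSum]

/-- Both sides are polynomials in `x`. At large integers `N` the left side is `n!` times the Schur
function at `P_k = N`, which is proportional to the content product. The constant is read off in
degree `n`, where only the identity permutation contributes. -/
theorem DiagramsOf.sum_chi_mul_pow (lam : DiagramsOf n) (x : ℂ) :
    ∑ g, lam.chi g * x ^ (cyc g).card =
      lam.chi 1 * ∏ c ∈ lam.1.cells, (x + ((c.2 : ℂ) - (c.1 : ℂ))) := by
  classical
  have hn : (n.factorial : ℂ) ≠ 0 := by exact_mod_cast n.factorial_ne_zero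
  obtain ⟨K, hK⟩ := exists_schur_principal lam.1
  let p : Polynomial ℂ := ∑ g : Equiv.Perm (Fin n), Polynomial.C (lam.chi g) *
    Polynomial.X ^ (cyc g).card
  let r : Polynomial ℂ := ∏ c ∈ lam.1.cells, (Polynomial.X + Polynomial.C ((c.2 : ℂ) - (c.1 : ℂ)))
  have hp : ∀ y : ℂ, p.eval y = ∑ g, lam.chi g * y ^ (cyc g).card := fun y => by
    simp [p, Polynomial.eval_finsetSum]
  have hr : ∀ y : ℂ, r.eval y = ∏ c ∈ lam.1.cells, (y + ((c.2 : ℂ) - (c.1 : ℂ))) := fun y => by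
    simp [r, Polynomial.eval_prod]
  have hpr : p = Polynomial.C (n.factorial * K) * r := by
    refine Polynomial.eq_of_infinite_eval_eq _ _ (((Set.Ici_infinite (lam.1.colLen 0)).image
      (Nat.cast_injective (R := ℂ)).injOn).mono ?_)
    rintro _ ⟨N, hN, rfl⟩
    have h1 := hK N hN
    rw [schur_eq_frob, frob, map_sum] at h1
    simp only [map_smul, aeval_const_powerSumProd, smul_eq_mul, mul_assoc] at h1
    rw [← Finset.mul_sum] at h1
    change p.eval (N : ℂ) = _
    rw [hp, Polynomial.eval_mul, Polynomial.eval_C, hr, mul_assoc, ← h1, mul_inv_cancel_left₀ hn]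
  have hrmonic : r.Monic := Polynomial.monic_prod_of_monic _ _ fun c _ => Polynomial.monic_X_add_C _
  have hrdeg : r.natDegree = n := by
    rw [Polynomial.natDegree_prod_of_monic _ _ fun c _ => Polynomial.monic_X_add_C _]
    simp only [Polynomial.natDegree_X_add_C]
    rw [Finset.sum_const, smul_eq_mul, mul_one]
    exact lam.2
  have hlead : lam.chi 1 = n.factorial * K := by
    have h1 : p.coeff n = lam.chi 1 := by
      simp only [p, Polynomial.finsetSum_coeff, Polynomial.coeff_C_mul_X_pow]
      rw [Finset.sum_eq_single 1]
      · rw [if_pos (card_cyc_eq_iff.2 rfl).symm]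
      · intro g _ hg
        exact if_neg fun h => hg (card_cyc_eq_iff.1 h.symm)
      · simp
    have h2 : r.coeff n = 1 := by rw [← hrdeg]; exact hrmonic
    rw [← h1, hpr, Polynomial.coeff_C_mul, h2, mul_one]
  rw [← hp, hpr, Polynomial.eval_mul, Polynomial.eval_C, hr, hlead]

/-- The product `∏_b (1 - z 𝒥_b)`. -/
def jucysMurphyProd (n : ℕ) (z : ℂ) : GroupAlg n :=
  ((List.finRange n).map fun b => 1 - z • jucysMurphy b).prod

theorem list_prod_map_smul {A ι : Type*} [Ring A] [Algebra ℂ A] (c : ℂ) (l : List ι) (f : ι → A) :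
    (l.map fun i => c • f i).prod = c ^ l.length • (l.map f).prod := by
  induction l with
  | nil => simp
  | cons a l ih =>
    rw [List.map_cons, List.prod_cons, ih, List.map_cons, List.prod_cons, List.length_cons,
      smul_mul_smul_comm, pow_succ']

theorem jucysMurphyProd_zero : jucysMurphyProd n 0 = 1 := by
  simp [jucysMurphyProd]

theorem jucysMurphyProd_eq {z : ℂ} (hz : z ≠ 0) :
    jucysMurphyProd n z =
      (-z) ^ n • ∑ g : Equiv.Perm (Fin n), (-z⁻¹) ^ (cyc g).card • permElt g := by
  rw [cycleSum_eq_prod (neg_ne_zero.2 (inv_ne_zero hz))]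
  have h := list_prod_map_smul (-z) (List.finRange n)
    fun b => (-z⁻¹) • (1 : GroupAlg n) + jucysMurphy b
  rw [List.length_finRange] at h
  rw [← h, jucysMurphyProd]
  congr 2
  funext b
  rw [smul_add, smul_smul, neg_mul_neg, mul_inv_cancel₀ hz, one_smul, neg_smul, sub_eq_add_neg]

theorem jucysMurphyProd_mem_center (z : ℂ) :
    jucysMurphyProd n z ∈ Subalgebra.center ℂ (GroupAlg n) := by
  by_cases hz : z = 0
  · rw [hz, jucysMurphyProd_zero]
    exact one_mem _
  · rw [jucysMurphyProd_eq hz]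
    exact Subalgebra.smul_mem _ (classSum_mem_center _ fun h g => by rw [cyc_conj]) _

theorem jucysMurphyProd_mul_chiSum (z : ℂ) (lam : DiagramsOf n) :
    jucysMurphyProd n z * lam.chiSum =
      (∏ c ∈ lam.1.cells, (1 - ((c.2 : ℂ) - (c.1 : ℂ)) * z)) • lam.chiSum := by
  by_cases hz : z = 0
  · simp [hz, jucysMurphyProd_zero]
  · have h1 : (∑ g : Equiv.Perm (Fin n), (-z⁻¹) ^ (cyc g).card • permElt g) * lam.chiSum =
        (∏ c ∈ lam.1.cells, (-z⁻¹ + ((c.2 : ℂ) - (c.1 : ℂ)))) • lam.chiSum := by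
      refine lam.central_mul_chiSum (classSum_mem_center _ fun h g => by rw [cyc_conj]) ?_
      rw [mul_comm, ← lam.sum_chi_mul_pow, map_sum]
      refine Finset.sum_congr rfl fun g _ => ?_
      rw [map_smul, smul_eq_mul, mul_comm]
      rfl
    rw [jucysMurphyProd_eq hz, smul_mul_assoc, h1, smul_smul]
    congr 1
    have h2 : (-z) ^ n = ∏ c ∈ lam.1.cells, (-z) := by
      rw [Finset.prod_const]
      exact congrArg _ lam.2.symm
    rw [h2, ← Finset.prod_mul_distrib]
    refine Finset.prod_congr rfl fun c _ => ?_
    field_simp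
    ring

theorem one_sub_content_mul_ne_zero {z : ℂ} (hz : ∀ k : ℤ, (k : ℂ) * z ≠ 1) (c : ℕ × ℕ) :
    1 - ((c.2 : ℂ) - (c.1 : ℂ)) * z ≠ 0 := by
  have := hz ((c.2 : ℤ) - (c.1 : ℤ))
  push_cast at this
  exact fun h => this (sub_eq_zero.1 h).symm

/-- The inverse of `∏_b (1 - z 𝒥_b)`. -/
def jucysMurphyInv (n : ℕ) (z : ℂ) : GroupAlg n :=
  ∑ lam : DiagramsOf n, (lam.pairing (1 : GroupAlg n).coeff *
    ∏ c ∈ lam.1.cells, (1 - ((c.2 : ℂ) - (c.1 : ℂ)) * z)⁻¹) • lam.chiSum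

theorem jucysMurphyInv_mem_center (z : ℂ) :
    jucysMurphyInv n z ∈ Subalgebra.center ℂ (GroupAlg n) :=
  sum_mem fun lam _ => Subalgebra.smul_mem _ lam.chiSum_mem_center _

/-- The candidate inverse is the expansion of `1` in the `e_λ` with each component divided by its
eigenvalue, which is nonzero since contents are integers. -/
theorem jucysMurphyProd_mul_inv {z : ℂ} (hz : ∀ k : ℤ, (k : ℂ) * z ≠ 1) :
    jucysMurphyProd n z * jucysMurphyInv n z = 1 := by
  rw [jucysMurphyInv, Finset.mul_sum]
  conv_rhs => rw [center_expansion (one_mem (Subalgebra.center ℂ (GroupAlg n)))]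
  refine Finset.sum_congr rfl fun lam _ => ?_
  rw [mul_smul_comm, jucysMurphyProd_mul_chiSum, smul_smul, mul_assoc, ← Finset.prod_mul_distrib,
    Finset.prod_eq_one fun c _ => inv_mul_cancel₀ (one_sub_content_mul_ne_zero hz c), mul_one]

theorem jucysMurphyInv_mul_prod {z : ℂ} (hz : ∀ k : ℤ, (k : ℂ) * z ≠ 1) :
    jucysMurphyInv n z * jucysMurphyProd n z = 1 := by
  rw [← (Subalgebra.mem_center_iff.1 (jucysMurphyInv_mem_center z)), jucysMurphyProd_mul_inv hz]

theorem jucysMurphyInv_mul_chiSum {z : ℂ} (hz : ∀ k : ℤ, (k : ℂ) * z ≠ 1) (lam : DiagramsOf n) :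
    jucysMurphyInv n z * lam.chiSum =
      (∏ c ∈ lam.1.cells, (1 - ((c.2 : ℂ) - (c.1 : ℂ)) * z)⁻¹) • lam.chiSum := by
  have h := congrArg (jucysMurphyInv n z * ·) (jucysMurphyProd_mul_chiSum z lam)
  simp only [← mul_assoc, jucysMurphyInv_mul_prod hz, one_mul, mul_smul_comm] at h
  conv_rhs => rw [h, smul_smul, ← Finset.prod_mul_distrib,
    Finset.prod_eq_one fun c _ => inv_mul_cancel₀ (one_sub_content_mul_ne_zero hz c), one_smul]

/-! ### Commutativity -/

/-- Conjugation by such `g` permutes the transpositions `(a b)` with `a < b`. -/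
theorem permElt_commute_jucysMurphy {b : Fin n} {g : Equiv.Perm (Fin n)}
    (hg : ∀ y : Fin n, b ≤ y → g y = y) : Commute (permElt g : GroupAlg n) (jucysMurphy b) := by
  rw [Commute, SemiconjBy, jucysMurphy, Finset.mul_sum, Finset.sum_mul]
  have hlt : ∀ g : Equiv.Perm (Fin n), (∀ y : Fin n, b ≤ y → g y = y) → ∀ a < b, g a < b := by
    intro g hg a ha
    by_contra h
    have h1 := g.injective (hg _ (not_lt.1 h))
    exact h (h1.symm ▸ ha)
  have hg' : ∀ y : Fin n, b ≤ y → g⁻¹ y = y := fun y hy => by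
    rw [Equiv.Perm.inv_eq_iff_eq, hg y hy]
  refine Finset.sum_nbij' (fun a => g a) (fun a => g⁻¹ a) ?_ ?_ ?_ ?_ ?_
  · intro a ha
    simpa using hlt g hg a (by simpa using ha)
  · intro a ha
    simpa using hlt g⁻¹ hg' a (by simpa using ha)
  · intro a _
    simp
  · intro a _
    simp
  · intro a _
    rw [permElt_mul_permElt, permElt_mul_permElt, Equiv.mul_swap_eq_swap_mul, hg b le_rfl]

theorem jucysMurphy_commute (a b : Fin n) :
    Commute (jucysMurphy a : GroupAlg n) (jucysMurphy b) := by
  have key : ∀ a b : Fin n, a < b → Commute (jucysMurphy a : GroupAlg n) (jucysMurphy b) := by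
    intro a b hab
    rw [jucysMurphy]
    refine Commute.sum_left _ _ _ fun c hc => permElt_commute_jucysMurphy fun y hy => ?_
    have hca : c < a := by simpa using hc
    exact Equiv.swap_apply_of_ne_of_ne (hca.trans (hab.trans_le hy)).ne' (hab.trans_le hy).ne'
  rcases lt_trichotomy a b with h | h | h
  · exact key a b h
  · rw [h]
  · exact (key b a h).symm

theorem list_prod_inverse {A ι : Type*} [Ring A] (l : List ι) (f : ι → A)
    (hf : ∀ i j, Commute (f i) (f j)) :
    (l.map fun i => Ring.inverse (f i)).prod = Ring.inverse (l.map f).prod := by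
  induction l with
  | nil => simp
  | cons a l ih =>
    have hc : Commute (f a) (l.map f).prod := Commute.list_prod_right _ _ fun x hx => by
      obtain ⟨i, -, rfl⟩ := List.mem_map.1 hx
      exact hf a i
    rw [List.map_cons, List.prod_cons, ih, List.map_cons, List.prod_cons, Ring.mul_inverse_rev' hc,
      hc.ringInverse_ringInverse.eq]

/-- This yields invertibility of each `1 - z 𝒥_b` from that of the central product, with no need for
the spectrum of a single `𝒥_b`. -/
theorem isUnit_of_isUnit_list_prod {A ι : Type*} [Ring A] (l : List ι) (f : ι → A)
    (hf : ∀ i j, Commute (f i) (f j)) (h : IsUnit (l.map f).prod) : ∀ i ∈ l, IsUnit (f i) := by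
  induction l with
  | nil => simp
  | cons a l ih =>
    have hc : Commute (f a) (l.map f).prod := Commute.list_prod_right _ _ fun x hx => by
      obtain ⟨i, -, rfl⟩ := List.mem_map.1 hx
      exact hf a i
    rw [List.map_cons, List.prod_cons, hc.isUnit_mul_iff] at h
    intro i hi
    rcases List.mem_cons.1 hi with rfl | hi
    · exact h.1
    · exact ih h.2 i hi

theorem one_sub_smul_jucysMurphy_commute (z : ℂ) (a b : Fin n) :
    Commute (1 - z • jucysMurphy a : GroupAlg n) (1 - z • jucysMurphy b) :=
  (Commute.one_left _).sub_left ((Commute.one_right _).sub_right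
    (((jucysMurphy_commute a b).smul_left z).smul_right z))

theorem completeJM_eq {z : ℂ} (hz : ∀ k : ℤ, (k : ℂ) * z ≠ 1) :
    completeJM n z = jucysMurphyInv n z := by
  rw [completeJM, list_prod_inverse _ _ (one_sub_smul_jucysMurphy_commute z)]
  exact Ring.inverse_unit ⟨_, _, jucysMurphyProd_mul_inv hz, jucysMurphyInv_mul_prod hz⟩

theorem isUnit_one_sub_smul_jucysMurphy {z : ℂ} (hz : ∀ k : ℤ, (k : ℂ) * z ≠ 1) (b : Fin n) :
    IsUnit (1 - z • jucysMurphy b : GroupAlg n) :=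
  isUnit_of_isUnit_list_prod _ _ (one_sub_smul_jucysMurphy_commute z)
    ⟨⟨_, _, jucysMurphyProd_mul_inv hz, jucysMurphyInv_mul_prod hz⟩, rfl⟩ b (List.mem_finRange b)

end Eigenvalues

/-! ## Maya diagrams of charge zero -/

section MayaDiagrams

/-- The charge can be counted from any level below which all sites are filled: occupied sites above
it, minus the `N` that the vacuum has there. -/
theorem charge_eq (M : Maya) (N : ℕ) (h : ∀ k : ℤ, k < -N → k ∈ M.1) :
    charge M = ((M.1 ∩ Set.Ici (-N : ℤ)).ncard : ℤ) - N := by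
  have h1 : M.1 ∩ Set.Ici (-N : ℤ) = (M.1 ∩ Set.Ici 0) ∪ (M.1 ∩ Set.Ico (-N : ℤ) 0) := by
    ext k
    simp only [Set.mem_inter_iff, Set.mem_Ici, Set.mem_union, Set.mem_Ico]
    have : (0 : ℤ) ≤ N := Int.natCast_nonneg N
    by_cases hk : k ∈ M.1 <;> simp only [hk, true_and, false_and, or_false]; omega
  have h2 : Set.Ico (-N : ℤ) 0 = (M.1 ∩ Set.Ico (-N : ℤ) 0) ∪ (Set.Iio 0 \ M.1) := by
    ext k
    simp only [Set.mem_inter_iff, Set.mem_union, Set.mem_Ico, Set.mem_sdiff, Set.mem_Iio]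
    have := h k
    by_cases hk : k ∈ M.1
    · simp [hk]
    · have h3 : -(N : ℤ) ≤ k := by
        by_contra h4
        exact hk (this (not_le.1 h4))
      simp [hk, h3]
  have hfin : (M.1 ∩ Set.Ico (-N : ℤ) 0).Finite := (Set.finite_Ico _ _).subset Set.inter_subset_right
  have h3 := congrArg Set.ncard h1
  have h4 := congrArg Set.ncard h2
  rw [Set.ncard_union_eq (Set.disjoint_left.2 fun k hk hk2 =>
    absurd hk.2 (not_le.2 hk2.2.2)) M.2.1 hfin] at h3
  rw [Set.ncard_union_eq (Set.disjoint_left.2 fun k hk hk2 => hk2.2 hk.1) hfin M.2.2] at h4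
  have h5 : (Set.Ico (-N : ℤ) 0).ncard = N := by
    rw [← Finset.coe_Ico, Set.ncard_coe_finset, Int.card_Ico]
    omega
  rw [h5] at h4
  rw [charge]
  omega

theorem ncard_range_inter_Ici {a : ℕ → ℤ} (ha : StrictAnti a) (i : ℕ) :
    (Set.range a ∩ Set.Ici (a i + 1)).ncard = i := by
  have : Set.range a ∩ Set.Ici (a i + 1) = a '' Set.Iio i := by
    ext k
    constructor
    · rintro ⟨⟨j, rfl⟩, hj⟩
      exact ⟨j, ha.lt_iff_gt.1 (Set.mem_Ici.1 hj), rfl⟩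
    · rintro ⟨j, hj, rfl⟩
      exact ⟨⟨j, rfl⟩, ha.lt_iff_gt.2 hj⟩
  rw [this, Set.ncard_image_of_injective _ ha.injective, ← Finset.coe_Iio, Set.ncard_coe_finset,
    Nat.card_Iio]

theorem charge_eq_of_range {M : Maya} {a : ℕ → ℤ} (ha : StrictAnti a) (hM : M.1 = Set.range a)
    {i : ℕ} (hi : a i < 0) (h : ∀ k ≤ a i, k ∈ M.1) : charge M = i + a i + 1 := by
  have h1 : (-((-a i - 1).toNat : ℤ)) = a i + 1 := by omega
  rw [charge_eq M (-a i - 1).toNat fun k hk => h k (by omega), h1, hM, ncard_range_inter_Ici ha]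
  omega

/-- The occupied sites of `|λ; 0⟩`. -/
def mayaSite (lam : YoungDiagram) (i : ℕ) : ℤ := (lam.rowLen i : ℤ) - ((i : ℤ) + 1)

theorem mayaSite_strictAnti (lam : YoungDiagram) : StrictAnti (mayaSite lam) :=
  strictAnti_nat_of_succ_lt fun i => by
    have := lam.rowLen_anti i (i + 1) (Nat.le_succ i)
    simp only [mayaSite]
    push_cast
    omega

theorem coe_mayaOf_zero (lam : YoungDiagram) : (mayaOf lam 0).1 = Set.range (mayaSite lam) := by
  simp only [mayaOf, add_zero]
  rfl

theorem mem_mayaOf_of_lt (lam : YoungDiagram) {k : ℤ} (hk : k < -(lam.colLen 0 : ℤ)) :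
    k ∈ (mayaOf lam 0).1 := by
  rw [coe_mayaOf_zero]
  refine ⟨(-k - 1).toNat, ?_⟩
  rw [mayaSite, rowLen_eq_zero lam (by omega)]
  omega

theorem charge_mayaOf (lam : YoungDiagram) : charge (mayaOf lam 0) = 0 := by
  have h : mayaSite lam (lam.colLen 0) = -(lam.colLen 0 : ℤ) - 1 := by
    rw [mayaSite, rowLen_eq_zero lam le_rfl]
    omega
  rw [charge_eq_of_range (mayaSite_strictAnti lam) (coe_mayaOf_zero lam) (i := lam.colLen 0)
    (by omega) fun k hk => mem_mayaOf_of_lt lam (by omega)]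
  omega

theorem eq_of_rowLen_eq {lam mu : YoungDiagram} (h : ∀ i, lam.rowLen i = mu.rowLen i) :
    lam = mu := by
  ext ⟨i, j⟩
  rw [YoungDiagram.mem_cells, YoungDiagram.mem_cells, YoungDiagram.mem_iff_lt_rowLen,
    YoungDiagram.mem_iff_lt_rowLen, h]

theorem mayaOf_injective : Function.Injective fun lam => mayaOf lam 0 := by
  intro lam mu h
  have h1 : Set.range (mayaSite lam) = Set.range (mayaSite mu) := by
    rw [← coe_mayaOf_zero, ← coe_mayaOf_zero]
    exact congrArg Subtype.val h
  have h2 : (fun i => -mayaSite lam i) = fun i => -mayaSite mu i := by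
    have hmono : ∀ lam, StrictMono fun i => -mayaSite lam i := fun lam i j hij =>
      neg_lt_neg (mayaSite_strictAnti lam hij)
    refine (StrictMono.range_inj (hmono lam) (hmono mu)).1 ?_
    have h3 : ∀ lam, Set.range (fun i => -mayaSite lam i) = Neg.neg '' Set.range (mayaSite lam) :=
      fun lam => Set.range_comp Neg.neg (mayaSite lam)
    rw [h3, h3, h1]
  refine eq_of_rowLen_eq fun i => ?_
  have := congrFun h2 i
  simp only [mayaSite] at this
  omega

/-- The diagram with prescribed row lengths. -/
def diagramOfRows (r : ℕ → ℕ) (hr : Antitone r) (N : ℕ) : YoungDiagram where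
  cells := (Finset.range N ×ˢ Finset.range (r 0)).filter fun c => c.2 < r c.1
  isLowerSet := by
    rintro ⟨i, j⟩ ⟨i', j'⟩ ⟨hi, hj⟩ h
    simp only [Finset.coe_filter, Finset.mem_product, Finset.mem_range, Set.mem_ofPred_eq] at *
    have := hr hi
    omega

theorem rowLen_diagramOfRows {r : ℕ → ℕ} (hr : Antitone r) {N : ℕ} (hN : ∀ i, N ≤ i → r i = 0)
    (i : ℕ) : (diagramOfRows r hr N).rowLen i = r i := by
  have h : ∀ j, j < (diagramOfRows r hr N).rowLen i ↔ j < r i := by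
    intro j
    rw [← YoungDiagram.mem_iff_lt_rowLen, ← YoungDiagram.mem_cells, diagramOfRows,
      Finset.mem_filter, Finset.mem_product, Finset.mem_range, Finset.mem_range]
    refine ⟨fun h => h.2, fun h => ⟨⟨?_, h.trans_le (hr (Nat.zero_le i))⟩, h⟩⟩
    by_contra h1
    have := hN i (by omega)
    omega
  exact le_antisymm (le_of_forall_lt fun j hj => (h j).1 hj)
    (le_of_forall_lt fun j hj => (h j).2 hj)

/-- Reflecting at an upper bound `b` turns the occupied sites into an infinite set of natural
numbers, which is enumerated increasingly. -/
theorem Maya.exists_strictAnti (M : Maya) :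
    ∃ a : ℕ → ℤ, StrictAnti a ∧ M.1 = Set.range a := by
  classical
  obtain ⟨c, hc⟩ := M.2.1.bddAbove
  obtain ⟨d, hd⟩ := M.2.2.bddBelow
  have hlow : ∀ k : ℤ, k < d → k < 0 → k ∈ M.1 := by
    intro k hk hk0
    by_contra h
    exact absurd (hd ⟨hk0, h⟩) (not_le.2 hk)
  have hup : ∀ k ∈ M.1, k ≤ max c 0 := by
    intro k hk
    by_cases h0 : 0 ≤ k
    · exact (hc ⟨hk, h0⟩).trans (le_max_left _ _)
    · exact (not_le.1 h0).le.trans (le_max_right _ _)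
  set b := max c 0
  let s : Set ℕ := {m | b - (m : ℤ) ∈ M.1}
  have hs : s.Infinite := by
    refine Set.infinite_of_not_bddAbove ?_
    rintro ⟨e, he⟩
    have h1 : (max (e + 1) (b - min d 0 + 1).toNat) ∈ s := by
      have h2 := le_max_right (e + 1) (b - min d 0 + 1).toNat
      have h3 := min_le_left d 0
      have h4 := min_le_right d 0
      exact hlow _ (by omega) (by omega)
    have h5 := he h1
    have h6 := le_max_left (e + 1) (b - min d 0 + 1).toNat
    omega
  have : Infinite s := hs.to_subtype
  refine ⟨fun i => b - (Nat.orderEmbeddingOfSet s i : ℤ), fun i j hij => ?_, ?_⟩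
  · have := (Nat.orderEmbeddingOfSet s).strictMono hij
    dsimp only
    omega
  · ext k
    constructor
    · intro hk
      have h1 := hup k hk
      have h2 : (b - k).toNat ∈ s := by
        change b - ((b - k).toNat : ℤ) ∈ M.1
        have : b - ((b - k).toNat : ℤ) = k := by omega
        rwa [this]
      rw [← Nat.orderEmbeddingOfSet_range s] at h2
      obtain ⟨i, hi⟩ := h2
      exact ⟨i, by dsimp only; omega⟩
    · rintro ⟨i, rfl⟩
      have h := Set.mem_range_self (f := Nat.orderEmbeddingOfSet s) i
      rw [Nat.orderEmbeddingOfSet_range] at h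
      exact h

/-- List the sites decreasingly as `a_i`. Charge zero forces `a_i = -i - 1` far down, so `a_i + i +
1` is antitone and eventually zero. These are the row lengths. -/
theorem exists_mayaOf_eq {M : Maya} (hM : charge M = 0) : ∃ lam, mayaOf lam 0 = M := by
  obtain ⟨a, ha, hr⟩ := M.exists_strictAnti
  obtain ⟨d, hd⟩ := M.2.2.bddBelow
  have hlow : ∀ k : ℤ, k < d → k < 0 → k ∈ M.1 := by
    intro k hk hk0
    by_contra h
    exact absurd (hd ⟨hk0, h⟩) (not_le.2 hk)
  have hstep : ∀ i, a i ≤ a 0 - i := by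
    intro i
    induction i with
    | zero => simp
    | succ i ih =>
      have := ha (Nat.lt_add_one i)
      push_cast
      omega
  -- From this index on, `a_i ≤ a_0 - i` lies below `0` and below the lowest hole, so
  -- `charge_eq_of_range` applies.
  let N := (a 0 - min d 0 + 1).toNat
  have hN : ∀ i, N ≤ i → a i = -(i : ℤ) - 1 := by
    intro i hi
    have h1 := hstep i
    have h2 := min_le_left d 0
    have h3 := min_le_right d 0
    have h4 := charge_eq_of_range ha hr (i := i) (by omega) fun k hk =>
      hlow k (by omega) (by omega)
    omega
  have hanti : Antitone fun i : ℕ => a i + i + 1 := antitone_nat_of_succ_le fun i => by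
    have := ha (Nat.lt_add_one i)
    push_cast
    omega
  have hpos : ∀ i : ℕ, 0 ≤ a i + i + 1 := by
    intro i
    have h1 := hanti (le_max_left i N)
    have h2 := hN _ (le_max_right i N)
    dsimp only at h1
    omega
  have hr' : Antitone fun i : ℕ => (a i + i + 1).toNat := fun i j hij =>
    Int.toNat_le_toNat (hanti hij)
  refine ⟨diagramOfRows _ hr' N, Subtype.ext ?_⟩
  rw [coe_mayaOf_zero, hr]
  congr 1
  funext i
  rw [mayaSite, rowLen_diagramOfRows hr' fun i hi => by have := hN i hi; omega]
  have := hpos i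
  omega

/-- Young diagrams correspond to Maya diagrams of charge zero. -/
def mayaEquiv : YoungDiagram ≃ {M : Maya | charge M = 0} :=
  Equiv.ofBijective (fun lam => ⟨mayaOf lam 0, charge_mayaOf lam⟩)
    ⟨fun _ _ h => mayaOf_injective (congrArg Subtype.val h), fun ⟨_, hM⟩ => by
      obtain ⟨lam, h⟩ := exists_mayaOf_eq hM
      exact ⟨lam, Subtype.ext h⟩⟩

/-- Fermionization. -/
def fermionization : SymFun ≃ₗ[ℂ] sector 0 :=
  schurBasis.repr ≪≫ₗ Finsupp.domLCongr mayaEquiv ≪≫ₗ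
    (Finsupp.supportedEquivFinsupp {M : Maya | charge M = 0}).symm

theorem fermionization_schur (lam : YoungDiagram) :
    (fermionization (schur lam) : Fock) = ket lam 0 := by
  rw [fermionization, LinearEquiv.trans_apply, LinearEquiv.trans_apply, ← schurBasis_apply,
    Module.Basis.repr_self, Finsupp.domLCongr_single,
    Finsupp.supportedEquivFinsupp_symm_single]
  rfl

end MayaDiagrams

/-! ### Eigenvalues of convolution symmetries -/

section ConvEigenvalues

/-- Below `-ℓ(λ)` all sites are filled, as in the vacuum. In the remaining window the occupied sites
come from the first `ℓ(λ)` rows, and the vacuum occupies `-1, …, -ℓ(λ)`. -/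
theorem diagEig_mayaOf (T : ℤ → ℂ) (lam : YoungDiagram) :
    diagEig T (mayaOf lam 0) = ∑ i ∈ Finset.range (lam.colLen 0),
      (T (mayaSite lam i) - T (-((i : ℤ) + 1))) := by
  classical
  set l := lam.colLen 0
  have hl : ∀ i, mayaSite lam i < -(l : ℤ) ↔ l ≤ i := by
    intro i
    constructor
    · intro h
      by_contra h1
      simp only [mayaSite] at h
      omega
    · intro h
      rw [mayaSite, rowLen_eq_zero lam h]
      omega
  set I := Finset.Ico (-(l : ℤ)) (max (mayaSite lam 0 + 1) 0) with hI
  have hsub : (Function.support fun j => T j * occ j (mayaOf lam 0)) ⊆ I := by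
    intro j hj
    rw [Finset.mem_coe, hI, Finset.mem_Ico]
    by_contra h
    refine hj ?_
    have h0 : occ j (mayaOf lam 0) = 0 := by
      rw [not_and_or, not_le, not_lt] at h
      rcases h with h | h
      · rw [occ, if_pos (mem_mayaOf_of_lt lam h), if_pos (by omega), sub_self]
      · have h1 : ¬ j < 0 := not_lt.2 ((le_max_right _ _).trans h)
        have h2 : j ∉ (mayaOf lam 0).1 := by
          rw [coe_mayaOf_zero]
          rintro ⟨i, rfl⟩
          have h3 := (mayaSite_strictAnti lam).antitone (Nat.zero_le i)
          have h4 := (le_max_left (mayaSite lam 0 + 1) 0).trans h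
          omega
        rw [occ, if_neg h1, if_neg h2, sub_self]
    change T j * occ j (mayaOf lam 0) = 0
    rw [h0, mul_zero]
  rw [diagEig, finsum_eq_sum_of_support_subset _ hsub]
  simp only [occ, mul_sub, mul_ite, mul_one, mul_zero]
  rw [Finset.sum_sub_distrib, Finset.sum_sub_distrib, ← Finset.sum_filter, ← Finset.sum_filter]
  congr 1
  · symm
    refine Finset.sum_bij (fun i _ => mayaSite lam i) ?_ ?_ ?_ fun _ _ => rfl
    · intro i hi
      rw [Finset.mem_range] at hi
      rw [Finset.mem_filter, hI, Finset.mem_Ico, coe_mayaOf_zero]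
      have h3 := (mayaSite_strictAnti lam).antitone (Nat.zero_le i)
      have h4 := le_max_left (mayaSite lam 0 + 1) 0
      refine ⟨⟨?_, by omega⟩, i, rfl⟩
      by_contra h
      exact absurd ((hl i).1 (not_le.1 h)) (by omega)
    · exact fun _ _ _ _ h => (mayaSite_strictAnti lam).injective h
    · intro j hj
      rw [Finset.mem_filter, hI, Finset.mem_Ico, coe_mayaOf_zero] at hj
      obtain ⟨⟨h1, -⟩, i, rfl⟩ := hj
      refine ⟨i, Finset.mem_range.2 ?_, rfl⟩
      by_contra h
      exact absurd ((hl i).2 (not_lt.1 h)) (by omega)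
  · symm
    refine Finset.sum_bij (fun i _ => -((i : ℤ) + 1)) ?_ ?_ ?_ fun _ _ => rfl
    · intro i hi
      rw [Finset.mem_range] at hi
      have h4 := le_max_right (mayaSite lam 0 + 1) 0
      rw [Finset.mem_filter, hI, Finset.mem_Ico]
      omega
    · intro i _ j _ h
      omega
    · intro j hj
      rw [Finset.mem_filter, hI, Finset.mem_Ico] at hj
      exact ⟨(-j - 1).toNat, Finset.mem_range.2 (by omega), by omega⟩

variable {m : ℕ} (θ₀ : ℂ) (z : Fin m → ℂ)

/-- The two branches of `paramT` are the solutions of one difference equation with value `0` at `j =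
0`; it holds across the change of sign as well. -/
theorem paramT_sub (j : ℤ) : paramT θ₀ z j - paramT θ₀ z (j - 1) =
    θ₀ - ∑ α, Complex.log (1 - j * z α) := by
  simp only [paramT]
  rcases lt_trichotomy j 0 with h | h | h
  · rw [if_neg (by omega), if_neg (by omega)]
    have h1 : Finset.Icc (j - 1 + 1) 0 = insert j (Finset.Icc (j + 1) 0) := by
      ext k
      simp only [Finset.mem_Icc, Finset.mem_insert]
      omega
    have h2 : ∀ α, ∑ k ∈ Finset.Icc (j - 1 + 1) 0, Complex.log (1 - k * z α) =
        Complex.log (1 - j * z α) + ∑ k ∈ Finset.Icc (j + 1) 0, Complex.log (1 - k * z α) := by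
      intro α
      rw [h1, Finset.sum_insert (by simp)]
    simp only [h2, Finset.sum_add_distrib]
    push_cast
    ring
  · subst h
    simp
  · rw [if_pos (by omega), if_pos (by omega)]
    have h1 : Finset.Icc 1 j = insert j (Finset.Icc 1 (j - 1)) := by
      ext k
      simp only [Finset.mem_Icc, Finset.mem_insert]
      omega
    have h2 : ∀ α, ∑ k ∈ Finset.Icc 1 j, Complex.log (1 - k * z α) =
        Complex.log (1 - j * z α) + ∑ k ∈ Finset.Icc 1 (j - 1), Complex.log (1 - k * z α) := by
      intro α
      rw [h1, Finset.sum_insert (by simp)]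
    simp only [h2, Finset.sum_add_distrib]
    push_cast
    ring

theorem paramT_add_sub (j : ℤ) (r : ℕ) : paramT θ₀ z (j + r) - paramT θ₀ z j =
    ∑ s ∈ Finset.range r, (θ₀ - ∑ α, Complex.log (1 - ((j + (s + 1) : ℤ) : ℂ) * z α)) := by
  induction r with
  | zero => simp
  | succ r ih =>
    rw [Finset.sum_range_succ, ← ih, ← paramT_sub]
    have : j + ((r : ℤ) + 1) - 1 = j + r := by ring
    rw [this]
    push_cast
    ring

variable {z}

theorem one_sub_mul_ne_zero (hz : Admissible z) (k : ℤ) (α : Fin m) : 1 - (k : ℂ) * z α ≠ 0 :=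
  fun h => hz α k (sub_eq_zero.1 h).symm

theorem exp_paramT (hz : Admissible z) (j : ℤ) :
    Complex.exp (paramT θ₀ z j) = paramRho θ₀ z j := by
  rw [paramT, paramRho]
  split_ifs
  · rw [Complex.exp_sub, Complex.exp_sum, div_eq_mul_inv, ← Finset.prod_inv_distrib]
    congr 1
    refine Finset.prod_congr rfl fun α _ => ?_
    rw [Complex.exp_sum, Finset.prod_inv_distrib]
    congr 1
    exact Finset.prod_congr rfl fun k _ => Complex.exp_log (one_sub_mul_ne_zero hz k α)
  · rw [Complex.exp_add, Complex.exp_sum]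
    congr 1
    refine Finset.prod_congr rfl fun α _ => ?_
    rw [Complex.exp_sum]
    exact Finset.prod_congr rfl fun k _ => Complex.exp_log (one_sub_mul_ne_zero hz k α)

/-- In row `i` the difference of `T` between `λ_i - (i+1)` and `-(i+1)` telescopes into one term for
each cell, evaluated at the content `s - i`. -/
theorem exp_diagEig_paramT (hz : Admissible z) (lam : YoungDiagram) :
    Complex.exp (diagEig (paramT θ₀ z) (mayaOf lam 0)) = contentEig θ₀ z lam := by
  rw [diagEig_mayaOf, Complex.exp_sum, contentEig, YoungDiagram.card, Finset.card_eq_sum_ones,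
    Nat.cast_sum, Finset.mul_sum, Complex.exp_sum, Finset.prod_comm, ← Finset.prod_mul_distrib,
    prod_cells]
  refine Finset.prod_congr rfl fun i _ => ?_
  have h1 : mayaSite lam i = -((i : ℤ) + 1) + (lam.rowLen i : ℕ) := by
    rw [mayaSite]
    ring
  rw [h1, paramT_add_sub, Complex.exp_sum]
  refine Finset.prod_congr rfl fun s _ => ?_
  have h2 : ∀ α, 1 - ((-((i : ℤ) + 1) + ((s : ℤ) + 1) : ℤ) : ℂ) * z α = 1 - ((s : ℂ) - i) * z α := by
    intro α
    push_cast
    ring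
  rw [Complex.exp_sub, Complex.exp_sum, div_eq_mul_inv, ← Finset.prod_inv_distrib]
  congr 1
  · simp
  · refine Finset.prod_congr rfl fun α _ => ?_
    rw [Complex.exp_log (one_sub_mul_ne_zero hz _ α), h2]

end ConvEigenvalues

/-! ## The group `𝒜_P` -/

theorem add_pow_div_factorial (x y : ℂ) (k : ℕ) :
    (x + y) ^ k / (k.factorial : ℂ) = ∑ p ∈ Finset.HasAntidiagonal.antidiagonal k,
      x ^ p.1 / (p.1.factorial : ℂ) * (y ^ p.2 / (p.2.factorial : ℂ)) := by
  rw [(Commute.all x y).add_pow', Finset.sum_div]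
  refine Finset.sum_congr rfl fun p hp => ?_
  rw [Finset.HasAntidiagonal.mem_antidiagonal] at hp
  subst hp
  have h : (((p.1 + p.2).choose p.1 * p.1.factorial * p.2.factorial : ℕ) : ℂ) =
      ((p.1 + p.2).factorial : ℕ) := by
    rw [Nat.choose_symm_add, Nat.add_choose_mul_factorial_mul_factorial]
  push_cast at h
  have h1 : (p.1.factorial : ℂ) ≠ 0 := by exact_mod_cast Nat.factorial_ne_zero _
  have h2 : (p.2.factorial : ℂ) ≠ 0 := by exact_mod_cast Nat.factorial_ne_zero _
  have h3 : ((p.1 + p.2).factorial : ℂ) ≠ 0 := by exact_mod_cast Nat.factorial_ne_zero _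
  rw [nsmul_eq_mul, ← h]
  rw [← h] at h3
  have h4 := left_ne_zero_of_mul (left_ne_zero_of_mul h3)
  field_simp

theorem expPower_add (θ η : ℕ → ℂ) : expPower (θ + η) = expPower θ * expPower η := by
  classical
  ext d
  rw [MvPowerSeries.coeff_mul]
  change d.prod (fun i k => (θ i + η i) ^ k / (k.factorial : ℂ)) =
    ∑ p ∈ Finset.HasAntidiagonal.antidiagonal d, p.1.prod (fun i k => θ i ^ k / (k.factorial : ℂ)) *
      p.2.prod fun i k => η i ^ k / (k.factorial : ℂ)
  rw [Finsupp.prod]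
  simp only [add_pow_div_factorial]
  rw [Finset.prod_sum]
  symm
  -- Splitting the exponent vector `d` means splitting each of its entries; this turns the product
  -- of binomial sums into the Cauchy product.
  refine Finset.sum_nbij' (fun p i _ => (p.1 i, p.2 i))
    (fun f => (Finsupp.indicator d.support fun i hi => (f i hi).1,
      Finsupp.indicator d.support fun i hi => (f i hi).2)) ?_ ?_ ?_ ?_ ?_
  · intro p hp
    rw [Finset.HasAntidiagonal.mem_antidiagonal] at hp
    rw [Finset.mem_pi]
    intro i _
    rw [Finset.HasAntidiagonal.mem_antidiagonal, ← hp, Finsupp.add_apply]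
  · intro f hf
    rw [Finset.mem_pi] at hf
    rw [Finset.HasAntidiagonal.mem_antidiagonal]
    ext i
    rw [Finsupp.add_apply, Finsupp.indicator_apply, Finsupp.indicator_apply]
    split_ifs with hi
    · exact Finset.HasAntidiagonal.mem_antidiagonal.1 (hf i hi)
    · exact (Finsupp.notMem_support_iff.1 hi).symm
  · intro p hp
    rw [Finset.HasAntidiagonal.mem_antidiagonal] at hp
    have h : ∀ i, i ∉ d.support → p.1 i = 0 ∧ p.2 i = 0 := by
      intro i hi
      rw [Finsupp.notMem_support_iff, ← hp, Finsupp.add_apply] at hi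
      omega
    refine Prod.ext (Finsupp.ext fun i => ?_) (Finsupp.ext fun i => ?_) <;>
      rw [Finsupp.indicator_apply] <;> split_ifs with hi
    · rfl
    · exact (h i hi).1.symm
    · rfl
    · exact (h i hi).2.symm
  · intro f _
    funext i hi
    dsimp only
    rw [Finsupp.indicator_of_mem hi, Finsupp.indicator_of_mem hi]
  · intro p hp
    rw [Finset.HasAntidiagonal.mem_antidiagonal] at hp
    have h1 : p.1.support ⊆ d.support := by
      rw [← hp]
      exact Finsupp.support_mono (by simp)
    have h2 : p.2.support ⊆ d.support := by
      rw [← hp]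
      exact Finsupp.support_mono (by simp)
    rw [Finsupp.prod_of_support_subset _ h1 _ (by simp),
      Finsupp.prod_of_support_subset _ h2 _ (by simp), ← Finset.prod_mul_distrib,
      Finset.prod_attach d.support fun i =>
        θ i ^ p.1 i / ((p.1 i).factorial : ℂ) * (η i ^ p.2 i / ((p.2 i).factorial : ℂ))]

theorem expPower_injective : Function.Injective expPower := by
  intro θ η h
  funext i
  have h1 : (Finsupp.single i 1).prod (fun i k => θ i ^ k / (k.factorial : ℂ)) =
      (Finsupp.single i 1).prod (fun i k => η i ^ k / (k.factorial : ℂ)) :=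
    congrFun h (Finsupp.single i 1)
  rw [Finsupp.prod_single_index (by simp), Finsupp.prod_single_index (by simp)] at h1
  simpa using h1

theorem thetaParam_append (θ₀ η₀ : ℂ) {m l : ℕ} (z : Fin m → ℂ) (w : Fin l → ℂ) :
    thetaParam (θ₀ + η₀) (Fin.append z w) = thetaParam θ₀ z + thetaParam η₀ w := by
  funext i
  simp only [thetaParam, Pi.add_apply]
  split_ifs
  · rfl
  · simp [Fin.sum_univ_add, mul_add]

theorem twistUnit_append (θ₀ η₀ : ℂ) {m l : ℕ} (z : Fin m → ℂ) (w : Fin l → ℂ) :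
    twistUnit (θ₀ + η₀) (Fin.append z w) = twistUnit θ₀ z * twistUnit η₀ w := by
  refine Units.ext ?_
  change expPower _ = expPower _ * expPower _
  rw [thetaParam_append, expPower_add]

theorem Admissible.append {m l : ℕ} {z : Fin m → ℂ} {w : Fin l → ℂ} (hz : Admissible z)
    (hw : Admissible w) : Admissible (Fin.append z w) := by
  intro α k
  induction α using Fin.addCases with
  | left α => rw [Fin.append_left]; exact hz α k
  | right α => rw [Fin.append_right]; exact hw α k

/-! ### Equal power sums -/

/-- Equality of all positive power sums gives equality of `∑ x q(x)` for every polynomial `q`. A `q`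
vanishing at all other points isolates the multiplicity of `w` times `w q(w)`, and `w ≠ 0`. -/
theorem filter_ne_zero_eq_of_pow_sum_eq {Z W : Multiset ℂ}
    (h : ∀ i : ℕ, i ≠ 0 → (Z.map (· ^ i)).sum = (W.map (· ^ i)).sum) :
    Z.filter (· ≠ 0) = W.filter (· ≠ 0) := by
  classical
  have hpoly : ∀ q : Polynomial ℂ, (Z.map fun x => x * q.eval x).sum =
      (W.map fun x => x * q.eval x).sum := by
    intro q
    induction q using Polynomial.induction_on' with
    | add p q hp hq => simp only [Polynomial.eval_add, mul_add, Multiset.sum_map_add, hp, hq]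
    | monomial k a =>
      have h1 : ∀ x : ℂ, x * (Polynomial.monomial k a).eval x = a * x ^ (k + 1) := fun x => by
        rw [Polynomial.eval_monomial]
        ring
      simp only [h1, Multiset.sum_map_mul_left, h (k + 1) k.succ_ne_zero]
  ext w
  by_cases hw : w = 0
  · simp [hw]
  · rw [Multiset.count_filter_of_pos (p := (· ≠ 0)) hw, Multiset.count_filter_of_pos (p := (· ≠ 0)) hw]
    let S : Finset ℂ := (Z.toFinset ∪ W.toFinset).erase w
    let q : Polynomial ℂ := ∏ x ∈ S, (Polynomial.X - Polynomial.C x)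
    have hq : ∀ x, q.eval x = ∏ y ∈ S, (x - y) := fun x => by simp [q, Polynomial.eval_prod]
    have hq0 : ∀ x ∈ S, q.eval x = 0 := fun x hx => by
      rw [hq, Finset.prod_eq_zero hx (sub_self x)]
    have hqw : q.eval w ≠ 0 := by
      rw [hq, Finset.prod_ne_zero_iff]
      rintro y hy h0
      rw [← sub_eq_zero.1 h0] at hy
      exact Finset.notMem_erase _ _ hy
    have h1 := hpoly q
    rw [Multiset.sum_map_eq_nsmul_single w fun x hx hxZ => by
        rw [hq0 x (Finset.mem_erase.2 ⟨hx, Finset.mem_union_left _ (Multiset.mem_toFinset.2 hxZ)⟩),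
          mul_zero],
      Multiset.sum_map_eq_nsmul_single w fun x hx hxW => by
        rw [hq0 x (Finset.mem_erase.2 ⟨hx, Finset.mem_union_right _ (Multiset.mem_toFinset.2 hxW)⟩),
          mul_zero], nsmul_eq_mul, nsmul_eq_mul] at h1
    exact_mod_cast mul_right_cancel₀ (mul_ne_zero hw hqw) h1

/-- Power sums do not see zeros, and `φ 0 = 1` makes the product blind to them too. -/
theorem prod_eq_of_pow_sum_eq {M : Type*} [CommMonoid M] {φ : ℂ → M} (hφ : φ 0 = 1) {m l : ℕ}
    {z : Fin m → ℂ} {w : Fin l → ℂ} (h : ∀ i : ℕ, i ≠ 0 → ∑ α, z α ^ i = ∑ β, w β ^ i) :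
    ∏ α, φ (z α) = ∏ β, φ (w β) := by
  classical
  have key : ∀ Z : Multiset ℂ, (Z.map φ).prod = ((Z.filter (· ≠ 0)).map φ).prod := by
    intro Z
    induction Z using Multiset.induction_on with
    | empty => rfl
    | cons a Z ih =>
      by_cases ha : a = 0
      · rw [Multiset.map_cons, Multiset.prod_cons, ih, Multiset.filter_cons_of_neg _ (by simpa),
          ha, hφ, one_mul]
      · rw [Multiset.map_cons, Multiset.prod_cons, ih, Multiset.filter_cons_of_pos (p := (· ≠ 0)) _ ha,
          Multiset.map_cons, Multiset.prod_cons]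
  have hprod : ∀ {k : ℕ} (u : Fin k → ℂ),
      ∏ α, φ (u α) = ((Finset.univ.val.map u).map φ).prod := by
    intro k u
    rw [Multiset.map_map]
    rfl
  have hf : (Finset.univ.val.map z).filter (· ≠ 0) = (Finset.univ.val.map w).filter (· ≠ 0) := by
    refine filter_ne_zero_eq_of_pow_sum_eq fun i hi => ?_
    rw [Multiset.map_map, Multiset.map_map]
    exact h i hi
  rw [hprod, hprod, key, hf, ← key]

theorem eq_and_pow_sum_eq_of_twistUnit_eq {θ₀ η₀ : ℂ} {m l : ℕ} {z : Fin m → ℂ} {w : Fin l → ℂ}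
    (h : twistUnit θ₀ z = twistUnit η₀ w) :
    θ₀ = η₀ ∧ ∀ i : ℕ, i ≠ 0 → ∑ α, z α ^ i = ∑ β, w β ^ i := by
  have h1 : thetaParam θ₀ z = thetaParam η₀ w := expPower_injective (congrArg Units.val h)
  refine ⟨by simpa [thetaParam] using congrFun h1 0, fun i hi => ?_⟩
  have h2 := congrFun h1 i
  simp only [thetaParam, if_neg hi] at h2
  exact mul_left_cancel₀ (inv_ne_zero (Nat.cast_ne_zero.2 hi)) h2

/-! ### Homomorphisms out of `𝒜_P` -/

/-- A map on generators that are closed under products extends to the generated subgroup. -/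
theorem exists_hom_closure {G H ι : Type*} [CommGroup G] [CommGroup H] {S : Set G} (u : ι → G)
    (v : ι → H) (hmem : ∀ i, u i ∈ S) (hS : ∀ s ∈ S, ∃ i, s = u i) (hne : Nonempty ι)
    (hmul : ∀ i j, ∃ k, u k = u i * u j ∧ v k = v i * v j)
    (hwd : ∀ i j, u i = u j → v i = v j) :
    ∃ φ : Subgroup.closure S →* H, ∀ i, φ ⟨u i, Subgroup.subset_closure (hmem i)⟩ = v i := by
  -- Cross-multiplication turns an equality of ratios into one of generators, since these are closed
  -- under products.
  have hwd' : ∀ i j k l, u i / u j = u k / u l → v i / v j = v k / v l := by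
    intro i j k l h
    obtain ⟨a, ha, ha'⟩ := hmul i l
    obtain ⟨b, hb, hb'⟩ := hmul k j
    rw [div_eq_div_iff_mul_eq_mul] at h ⊢
    rw [← ha', ← hb']
    exact hwd a b (by rw [ha, hb, h])
  -- The generated group consists of ratios of generators; a generator itself is `u i * u i / u i`.
  have hrep : ∀ g ∈ Subgroup.closure S, ∃ p : ι × ι, g = u p.1 / u p.2 := by
    intro g hg
    induction hg using Subgroup.closure_induction with
    | mem x hx =>
      obtain ⟨i, rfl⟩ := hS x hx
      obtain ⟨k, hk, -⟩ := hmul i i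
      exact ⟨(k, i), by rw [hk, mul_div_cancel_right]⟩
    | one =>
      obtain ⟨i⟩ := hne
      exact ⟨(i, i), (div_self' _).symm⟩
    | mul x y _ _ hx hy =>
      obtain ⟨⟨i, j⟩, rfl⟩ := hx
      obtain ⟨⟨k, l⟩, rfl⟩ := hy
      obtain ⟨a, ha, -⟩ := hmul i k
      obtain ⟨b, hb, -⟩ := hmul j l
      exact ⟨(a, b), by rw [ha, hb, div_mul_div_comm]⟩
    | inv x _ hx =>
      obtain ⟨⟨i, j⟩, rfl⟩ := hx
      exact ⟨(j, i), inv_div _ _⟩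
  choose p hp using hrep
  refine ⟨MonoidHom.mk' (fun g => v (p g.1 g.2).1 / v (p g.1 g.2).2) ?_, ?_⟩
  · rintro ⟨g, hg⟩ ⟨h, hh⟩
    have h1 := hp g hg
    have h2 := hp h hh
    have h3 := hp (g * h) (mul_mem hg hh)
    obtain ⟨a, ha, ha'⟩ := hmul (p g hg).1 (p h hh).1
    obtain ⟨b, hb, hb'⟩ := hmul (p g hg).2 (p h hh).2
    change v (p (g * h) _).1 / v (p (g * h) _).2 = v _ / v _ * (v _ / v _)
    rw [div_mul_div_comm, ← ha', ← hb']
    refine hwd' _ _ _ _ ?_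
    rw [← h3, ha, hb, ← div_mul_div_comm, ← h1, ← h2]
  · intro i
    have h1 := hp (u i) (Subgroup.subset_closure (hmem i))
    obtain ⟨k, hk, hk'⟩ := hmul i i
    change v _ / v _ = v i
    rw [hwd' _ _ k i (by rw [← h1, hk, mul_div_cancel_right]), hk', mul_div_cancel_right]

/-- The parameters of the generators of `𝒜_P`. -/
structure TwistParam where
  theta : ℂ
  size : ℕ
  point : Fin size → ℂ
  admissible : Admissible point

theorem exists_hom_groupAP {H : Type*} [CommGroup H] (v : TwistParam → H)
    (hmul : ∀ (θ₀ η₀ : ℂ) (m l : ℕ) (z : Fin m → ℂ) (w : Fin l → ℂ) (hz : Admissible z)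
      (hw : Admissible w), v ⟨θ₀ + η₀, _, _, hz.append hw⟩ = v ⟨θ₀, _, _, hz⟩ * v ⟨η₀, _, _, hw⟩)
    (hwd : ∀ (θ₀ : ℂ) (m l : ℕ) (z : Fin m → ℂ) (w : Fin l → ℂ) (hz : Admissible z)
      (hw : Admissible w), (∀ i : ℕ, i ≠ 0 → ∑ α, z α ^ i = ∑ β, w β ^ i) →
        v ⟨θ₀, _, _, hz⟩ = v ⟨θ₀, _, _, hw⟩) :
    ∃ φ : groupAP →* H, ∀ (θ₀ : ℂ) (m : ℕ) (z : Fin m → ℂ) (hz : Admissible z),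
      φ (twistElt θ₀ z hz) = v ⟨θ₀, m, z, hz⟩ := by
  obtain ⟨φ, hφ⟩ := exists_hom_closure
    (S := {u | ∃ (θ₀ : ℂ) (m : ℕ) (z : Fin m → ℂ), Admissible z ∧ u = twistUnit θ₀ z})
    (fun p : TwistParam => twistUnit p.theta p.point) v
    (fun p => ⟨p.theta, p.size, p.point, p.admissible, rfl⟩)
    (by
      rintro _ ⟨θ₀, m, z, hz, rfl⟩
      exact ⟨⟨θ₀, m, z, hz⟩, rfl⟩)
    ⟨⟨0, 0, Fin.elim0, fun α => α.elim0⟩⟩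
    (fun p q => ⟨⟨p.theta + q.theta, _, _, p.admissible.append q.admissible⟩,
      twistUnit_append _ _ _ _, hmul _ _ _ _ _ _ _ _⟩)
    (by
      rintro ⟨θ₀, m, z, hz⟩ ⟨η₀, l, w, hw⟩ h
      obtain ⟨rfl, h2⟩ := eq_and_pow_sum_eq_of_twistUnit_eq h
      exact hwd _ _ _ _ _ _ _ h2)
  exact ⟨φ, fun θ₀ m z hz => hφ ⟨θ₀, m, z, hz⟩⟩

/-! ### Evaluation at the Jucys–Murphy elements -/

open Classical in
/-- The unit `∏_b (1 - z 𝒥_b)⁻¹` of the center (`1` if `z` is the inverse of an integer). -/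
def jucysMurphyUnit (n : ℕ) (z : ℂ) : (ZAlg n)ˣ :=
  if hz : ∀ k : ℤ, (k : ℂ) * z ≠ 1 then
    ⟨⟨_, jucysMurphyInv_mem_center z⟩, ⟨_, jucysMurphyProd_mem_center z⟩,
      Subtype.ext (jucysMurphyInv_mul_prod hz), Subtype.ext (jucysMurphyProd_mul_inv hz)⟩
  else 1

theorem jucysMurphyUnit_zero (n : ℕ) : jucysMurphyUnit n 0 = 1 := by
  rw [jucysMurphyUnit, dif_pos (by simp), ← inv_inj, inv_one]
  exact Units.ext (Subtype.ext jucysMurphyProd_zero)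

theorem coe_jucysMurphyUnit {n : ℕ} {z : ℂ} (hz : ∀ k : ℤ, (k : ℂ) * z ≠ 1) :
    ((jucysMurphyUnit n z : ZAlg n) : GroupAlg n) = completeJM n z := by
  rw [jucysMurphyUnit, dif_pos hz, completeJM_eq hz]

/-- The scalar `e^{θ₀ n}` as a unit of the center. -/
def scalarUnit (n : ℕ) (θ₀ : ℂ) : (ZAlg n)ˣ :=
  Units.map (algebraMap ℂ (ZAlg n)).toMonoidHom (Units.mk0 _ (Complex.exp_ne_zero (θ₀ * n)))

theorem scalarUnit_add (n : ℕ) (θ₀ η₀ : ℂ) :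
    scalarUnit n (θ₀ + η₀) = scalarUnit n θ₀ * scalarUnit n η₀ := by
  rw [scalarUnit, scalarUnit, scalarUnit, ← map_mul]
  congr 1
  refine Units.ext ?_
  change Complex.exp _ = Complex.exp _ * Complex.exp _
  rw [add_mul, Complex.exp_add]

theorem exists_evaluation (n : ℕ) : ∃ ev : groupAP →* (ZAlg n)ˣ,
    ∀ (θ₀ : ℂ) (m : ℕ) (z : Fin m → ℂ) (hz : Admissible z),
      ev (twistElt θ₀ z hz) = scalarUnit n θ₀ * ∏ α, jucysMurphyUnit n (z α) := by
  refine exists_hom_groupAP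
    (fun p => scalarUnit n p.theta * ∏ α, jucysMurphyUnit n (p.point α)) ?_ ?_
  · intro θ₀ η₀ m l z w _ _
    simp only [scalarUnit_add, Fin.prod_univ_add, Fin.append_left, Fin.append_right]
    exact mul_mul_mul_comm _ _ _ _
  · intro θ₀ m l z w _ _ h
    exact congrArg _ (prod_eq_of_pow_sum_eq (jucysMurphyUnit_zero n) h)

theorem coe_evaluation (n : ℕ) (θ₀ : ℂ) {m : ℕ} {z : Fin m → ℂ} (hz : Admissible z) :
    (((scalarUnit n θ₀ * ∏ α, jucysMurphyUnit n (z α) : (ZAlg n)ˣ) : ZAlg n) : GroupAlg n) =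
      twistJM n θ₀ z := by
  have h : (((∏ α, jucysMurphyUnit n (z α) : (ZAlg n)ˣ) : ZAlg n) : GroupAlg n) =
      ((List.finRange m).map fun α => completeJM n (z α)).prod := by
    rw [Fin.prod_univ_def]
    change ((Subalgebra.center ℂ (GroupAlg n)).val.toMonoidHom.comp (Units.coeHom (ZAlg n)))
      (List.map _ _).prod = _
    rw [map_list_prod, List.map_map]
    congr 2
    funext α
    exact coe_jucysMurphyUnit (hz α)
  rw [Units.val_mul, Subalgebra.coe_mul, h, twistJM, Algebra.smul_def]
  rfl

theorem evaluation_mul_chiSum {n : ℕ} (θ₀ : ℂ) {m : ℕ} {z : Fin m → ℂ} (hz : Admissible z)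
    (lam : DiagramsOf n) : twistJM n θ₀ z * lam.chiSum = contentEig θ₀ z lam.1 • lam.chiSum := by
  have h : ∀ l : List (Fin m), (l.map fun α => completeJM n (z α)).prod * lam.chiSum =
      (l.map fun α => ∏ c ∈ lam.1.cells, (1 - ((c.2 : ℂ) - (c.1 : ℂ)) * z α)⁻¹).prod •
        lam.chiSum := by
    intro l
    induction l with
    | nil => simp
    | cons α l ih =>
      rw [List.map_cons, List.prod_cons, mul_assoc, ih, mul_smul_comm, completeJM_eq (hz α),
        jucysMurphyInv_mul_chiSum (hz α), smul_smul, List.map_cons, List.prod_cons, mul_comm]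
  rw [twistJM, smul_mul_assoc, h, smul_smul, contentEig, Fin.prod_univ_def, lam.2]

theorem mulFamily_chiTotal (u : ∀ n : ℕ, ZAlg n) (θ₀ : ℂ) {m : ℕ} {z : Fin m → ℂ}
    (hz : Admissible z) (hu : ∀ n, (u n : GroupAlg n) = twistJM n θ₀ z) (lam : YoungDiagram) :
    mulFamily u (chiTotal lam) = contentEig θ₀ z lam • chiTotal lam := by
  have h : LinearMap.mulLeft ℂ (u lam.card)
      ⟨_, DiagramsOf.chiSum_mem_center (⟨lam, rfl⟩ : DiagramsOf lam.card)⟩ =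
      contentEig θ₀ z lam • ⟨_, DiagramsOf.chiSum_mem_center (⟨lam, rfl⟩ : DiagramsOf lam.card)⟩ := by
    refine Subtype.ext ?_
    rw [LinearMap.mulLeft_apply, Subalgebra.coe_mul, hu, evaluation_mul_chiSum θ₀ hz,
      Subalgebra.coe_smul]
  rw [chiTotal, mulFamily, DirectSum.lmap_lof, h, map_smul]

theorem mulFamily_mul (u v : ∀ n : ℕ, ZAlg n) (x : ⨁ n : ℕ, ZAlg n) :
    mulFamily (fun n => u n * v n) x = mulFamily u (mulFamily v x) := by
  refine DFinsupp.ext fun n => ?_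
  simp only [mulFamily, DirectSum.lmap_apply, LinearMap.mulLeft_apply, mul_assoc]

theorem mulFamily_one (x : ⨁ n : ℕ, ZAlg n) : mulFamily (fun _ => 1) x = x := by
  refine DFinsupp.ext fun n => ?_
  simp only [mulFamily, DirectSum.lmap_apply, LinearMap.mulLeft_apply, one_mul]

/-! ### The homomorphism to convolution symmetries -/

/-- The operator `convSym T` as an element of `convGroup`. -/
def convElt (T : ℤ → ℂ) : convGroup :=
  ⟨⟨convSym T, convSym (-T), by rw [convSym_mul, add_neg_cancel, convSym_zero],
    by rw [convSym_mul, neg_add_cancel, convSym_zero]⟩, T, rfl⟩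

theorem convElt_add (S T : ℤ → ℂ) : convElt (S + T) = convElt S * convElt T :=
  Subtype.ext (Units.ext (convSym_mul S T).symm)

/-- Convolution symmetries commute. -/
abbrev convCommGroup : CommGroup convGroup :=
  { (inferInstance : Group convGroup) with
    mul_comm := by
      rintro ⟨u, S, hS⟩ ⟨v, T, hT⟩
      refine Subtype.ext (Units.ext ?_)
      change (u : Module.End ℂ Fock) * v = v * u
      rw [hS, hT, convSym_mul, convSym_mul, add_comm] }

/-- The contribution of a single `z` to `T_j`. -/
def logParam (w : ℂ) (j : ℤ) : ℂ :=
  if 0 ≤ j then -∑ k ∈ Finset.Icc 1 j, Complex.log (1 - k * w)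
  else ∑ k ∈ Finset.Icc (j + 1) 0, Complex.log (1 - k * w)

theorem logParam_zero : logParam 0 = 0 := by
  funext j
  simp [logParam]

theorem paramT_eq (θ₀ : ℂ) {m : ℕ} (z : Fin m → ℂ) :
    paramT θ₀ z = (fun j : ℤ => (j : ℂ) * θ₀) + ∑ α, logParam (z α) := by
  funext j
  rw [Pi.add_apply, Finset.sum_apply]
  simp only [paramT, logParam]
  split_ifs
  · rw [Finset.sum_neg_distrib, sub_eq_add_neg]
  · rfl

theorem paramT_append (θ₀ η₀ : ℂ) {m l : ℕ} (z : Fin m → ℂ) (w : Fin l → ℂ) :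
    paramT (θ₀ + η₀) (Fin.append z w) = paramT θ₀ z + paramT η₀ w := by
  simp only [paramT_eq, Fin.sum_univ_add, Fin.append_left, Fin.append_right, mul_add]
  exact add_add_add_comm (fun j : ℤ => (j : ℂ) * θ₀) (fun j : ℤ => (j : ℂ) * η₀) _ _

/-- The `T_j` themselves, and not only their exponentials, depend on the multiset of nonzero points
alone: the same logarithms are added in a different order. -/
theorem paramT_eq_of_pow_sum_eq (θ₀ : ℂ) {m l : ℕ} {z : Fin m → ℂ} {w : Fin l → ℂ}
    (h : ∀ i : ℕ, i ≠ 0 → ∑ α, z α ^ i = ∑ β, w β ^ i) : paramT θ₀ z = paramT θ₀ w := by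
  rw [paramT_eq, paramT_eq]
  congr 1
  exact Multiplicative.ofAdd.injective (prod_eq_of_pow_sum_eq
    (φ := fun x => Multiplicative.ofAdd (logParam x)) (congrArg _ logParam_zero) h)

theorem exists_convHom : ∃ I : groupAP →* convGroup,
    ∀ (θ₀ : ℂ) (m : ℕ) (z : Fin m → ℂ) (hz : Admissible z),
      I (twistElt θ₀ z hz) = convElt (paramT θ₀ z) := by
  -- The extension theorem needs a commutative target; this instance extends the existing group
  -- structure, so the multiplication is unchanged.
  let _ := convCommGroup
  refine exists_hom_groupAP (fun p => convElt (paramT p.theta p.point)) ?_ ?_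
  · intro θ₀ η₀ m l z w _ _
    rw [paramT_append, convElt_add]
  · intro θ₀ m l z w _ _ h
    exact congrArg convElt (paramT_eq_of_pow_sum_eq θ₀ h)

theorem convSym_ket (θ₀ : ℂ) {m : ℕ} {z : Fin m → ℂ} (hz : Admissible z) (lam : YoungDiagram) :
    convSym (paramT θ₀ z) (ket lam 0) = contentEig θ₀ z lam • ket lam 0 := by
  rw [ket, convSym_mayaVec, exp_diagEig_paramT θ₀ hz]

/-! ### Intertwining -/

/-- The relation is multiplicative in `a`. For generators it suffices to check the spanning elements
`e_λ`, where both sides have the eigenvalue `contentEig`. -/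
theorem intertwining_of_generators (ev : ∀ n : ℕ, groupAP →* (ZAlg n)ˣ) (I : groupAP →* convGroup)
    (hev : ∀ (n : ℕ) (θ₀ : ℂ) (m : ℕ) (z : Fin m → ℂ) (hz : Admissible z),
      ((ev n (twistElt θ₀ z hz) : ZAlg n) : GroupAlg n) = twistJM n θ₀ z)
    (hI : ∀ (θ₀ : ℂ) (m : ℕ) (z : Fin m → ℂ) (hz : Admissible z),
      ((I (twistElt θ₀ z hz) : (Module.End ℂ Fock)ˣ) : Module.End ℂ Fock) =
        convSym (paramT θ₀ z))
    (a : groupAP) (x : ⨁ n : ℕ, ZAlg n) :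
    (fermionization (ch (mulFamily (fun n => (ev n a : ZAlg n)) x)) : Fock) =
      ((I a : (Module.End ℂ Fock)ˣ) : Module.End ℂ Fock) (fermionization (ch x) : Fock) := by
  obtain ⟨g, hg⟩ := a
  induction hg using Subgroup.closure_induction generalizing x with
  | mem g hg =>
    obtain ⟨θ₀, m, z, hz, rfl⟩ := hg
    change (fermionization (ch (mulFamily (fun n => (ev n (twistElt θ₀ z hz) : ZAlg n)) x)) : Fock) =
      ((I (twistElt θ₀ z hz) : (Module.End ℂ Fock)ˣ) : Module.End ℂ Fock)
        (fermionization (ch x) : Fock)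
    rw [hI]
    have hx : x ∈ Submodule.span ℂ (Set.range chiTotal) := span_chiTotal ▸ Submodule.mem_top
    induction hx using Submodule.span_induction with
    | mem x hx =>
      obtain ⟨lam, rfl⟩ := hx
      rw [mulFamily_chiTotal _ θ₀ hz (fun n => hev n θ₀ m z hz), map_smul, map_smul, ch_chiTotal,
        Submodule.coe_smul, fermionization_schur, convSym_ket θ₀ hz]
    | zero => simp
    | add x y _ _ hx hy => simp only [map_add, Submodule.coe_add, hx, hy]
    | smul c x _ hx => simp only [map_smul, Submodule.coe_smul, hx]
  | one =>
    change (fermionization (ch (mulFamily (fun n => (ev n 1 : ZAlg n)) x)) : Fock) =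
      ((I 1 : (Module.End ℂ Fock)ˣ) : Module.End ℂ Fock) (fermionization (ch x) : Fock)
    simp only [map_one, Units.val_one, mulFamily_one]
    rfl
  | mul g h hg hh ihg ihh =>
    have h1 : (fun n => (ev n (⟨g, hg⟩ * ⟨h, hh⟩) : ZAlg n)) =
        fun n => (ev n ⟨g, hg⟩ : ZAlg n) * (ev n ⟨h, hh⟩ : ZAlg n) := by
      funext n
      rw [map_mul, Units.val_mul]
    have h2 := ihg (mulFamily (fun n => (ev n ⟨h, hh⟩ : ZAlg n)) x)
    rw [ihh, ← mulFamily_mul, ← h1] at h2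
    refine h2.trans ?_
    have h3 := map_mul I ⟨g, hg⟩ ⟨h, hh⟩
    change _ = ((I (⟨g, hg⟩ * ⟨h, hh⟩) : (Module.End ℂ Fock)ˣ) : Module.End ℂ Fock) _
    rw [h3]
    rfl
  | inv g hg ih =>
    -- For inverses, the relation for `g` is applied to `g⁻¹ · x` and the operator `I g` is then
    -- inverted.
    have h1 := ih (mulFamily (fun n => (ev n ⟨g, hg⟩⁻¹ : ZAlg n)) x)
    rw [← mulFamily_mul] at h1
    have h2 : (fun n => (ev n ⟨g, hg⟩ : ZAlg n) * (ev n ⟨g, hg⟩⁻¹ : ZAlg n)) = fun _ => 1 := by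
      funext n
      rw [map_inv, Units.mul_inv]
    rw [h2, mulFamily_one] at h1
    change (fermionization (ch (mulFamily (fun n => (ev n ⟨g, hg⟩⁻¹ : ZAlg n)) x)) : Fock) =
      ((I ⟨g, hg⟩⁻¹ : (Module.End ℂ Fock)ˣ) : Module.End ℂ Fock) (fermionization (ch x) : Fock)
    rw [h1, map_inv]
    change _ = (((I ⟨g, hg⟩ : (Module.End ℂ Fock)ˣ)⁻¹ * (I ⟨g, hg⟩ : (Module.End ℂ Fock)ˣ) :
      (Module.End ℂ Fock)ˣ) : Module.End ℂ Fock) _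
    rw [inv_mul_cancel]
    rfl

end

end TodaFock

theorem mainTheorem1 :
    ∃ (f : SymFun ≃ₗ[ℂ] sector 0) (ev : ∀ n : ℕ, groupAP →* (ZAlg n)ˣ)
      (I : groupAP →* convGroup),
      -- `f` is the fermionization map
      (∀ lam : YoungDiagram, (f (schur lam) : Fock) = ket lam 0) ∧
      -- `𝔉 = f ∘ ch` is a linear isomorphism, and it sends `F_λ` to `(1 / h_λ) |λ; 0⟩`
      Function.Bijective (fun x => f (ch x)) ∧
      (∀ lam : YoungDiagram, (f (ch (idemSum lam)) : Fock) = (hookProd lam : ℂ)⁻¹ • ket lam 0) ∧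
      (∀ (θ₀ : ℂ) (m : ℕ) (z : Fin m → ℂ) (hz : Admissible z),
        -- `ev n` is the evaluation of elements of `𝒜_P` at the Jucys-Murphy elements of `S_n`
        (∀ (n : ℕ) (b : Fin n) (α : Fin m), IsUnit (1 - z α • jucysMurphy b)) ∧
        (∀ n : ℕ, ((ev n (twistElt θ₀ z hz) : ZAlg n) : GroupAlg n) = twistJM n θ₀ z) ∧
        -- `I` is the explicit homomorphism `𝒜_P → Ĉ`
        (∀ j : ℤ, Complex.exp (paramT θ₀ z j) = paramRho θ₀ z j) ∧
        ((I (twistElt θ₀ z hz) : (Module.End ℂ Fock)ˣ) : Module.End ℂ Fock) =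
          convSym (paramT θ₀ z) ∧
        -- both operators are diagonal, with the same eigenvalues
        (∀ lam : YoungDiagram,
          mulFamily (fun n => (ev n (twistElt θ₀ z hz) : ZAlg n)) (idemSum lam) =
              contentEig θ₀ z lam • idemSum lam ∧
            ((I (twistElt θ₀ z hz) : (Module.End ℂ Fock)ˣ) : Module.End ℂ Fock) (ket lam 0) =
              contentEig θ₀ z lam • ket lam 0)) ∧
      -- `𝔉` intertwines the two actions
      (∀ (a : groupAP) (x : ⨁ n : ℕ, ZAlg n),
        (f (ch (mulFamily (fun n => (ev n a : ZAlg n)) x)) : Fock) =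
          ((I a : (Module.End ℂ Fock)ˣ) : Module.End ℂ Fock) (f (ch x) : Fock)) := by
  choose ev hev using exists_evaluation
  obtain ⟨I, hI⟩ := exists_convHom
  have hev' : ∀ (n : ℕ) (θ₀ : ℂ) (m : ℕ) (z : Fin m → ℂ) (hz : Admissible z),
      ((ev n (twistElt θ₀ z hz) : ZAlg n) : GroupAlg n) = twistJM n θ₀ z := by
    intro n θ₀ m z hz
    rw [hev, coe_evaluation n θ₀ hz]
  have hI' : ∀ (θ₀ : ℂ) (m : ℕ) (z : Fin m → ℂ) (hz : Admissible z),
      ((I (twistElt θ₀ z hz) : (Module.End ℂ Fock)ˣ) : Module.End ℂ Fock) =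
        convSym (paramT θ₀ z) := by
    intro θ₀ m z hz
    rw [hI]
    rfl
  refine ⟨fermionization, ev, I, fermionization_schur,
    fermionization.bijective.comp ⟨ch_injective, ch_surjective⟩, ?_, ?_,
    intertwining_of_generators ev I hev' hI'⟩
  · intro lam
    rw [ch_idemSum, map_smul, Submodule.coe_smul, fermionization_schur]
  · intro θ₀ m z hz
    refine ⟨fun n b α => isUnit_one_sub_smul_jucysMurphy (hz α) b, fun n => hev' n θ₀ m z hz,
      exp_paramT θ₀ hz, hI' θ₀ m z hz, fun lam => ⟨?_, ?_⟩⟩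
    · rw [idemSum_eq, map_smul, mulFamily_chiTotal _ θ₀ hz (fun n => hev' n θ₀ m z hz), smul_comm]
    · rw [hI', convSym_ket θ₀ hz]
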